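/- Let $A=(\mathbf a_1,\dots,\mathbf a_n)\in\mathbb Z^{d\times n}$ be an integer matrix with nonzero columns such that $\mathbb ZA=\mathbb Z^d$ and the semigroup $\mathbb NA$ is positive, i.e. $x,-x\in\mathbb NA$ implies $x=0$. Let $L\in\mathbb Q^n$ be a weight vector with $L_j>0$ for all $j$. Let $R=\mathbb C[\partial_1,\dots,\partial_n]$, filtered by $L_kR=\operatorname{span}_{\mathbb C}\{\partial^{\mathbf u}\mid L\cdot\mathbf u\le k\}$ and $\mathbb Z^d$-graded by $\deg\partial_j=\mathbf a_j$. Let $I_A=\langle \partial^{\mathbf u_+}-\partial^{\mathbf u_-}\mid \mathbf u\in\mathbb Z^n,\ A\mathbf u=0\rangle$ be the toric ideal, $S_A=R/I_A$, and let $S_A^L=\operatorname{gr}^L(S_A)=R/\operatorname{gr}^L(I_A)$ be the associated graded ring, with its induced $\mathbb Z^d$-grading $S_A^L=\bigoplus_{\mathbf a}(S_A^L)_{\mathbf a}$. Let $\Delta_A^L\subseteq\mathbb Q^d$ be the convex hull of $0$ and the points $\mathbf a_j/L_j$ for $j=1,\dots,n$, let $\Phi_A^L$ be the set of faces of $\Delta_A^L$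 not containing $0$ (including the empty face), and let $\Gamma_A^L=\bigcup_{\tau\in\Phi_A^L}\tau$. Radial projection from $0$ identifies $\Gamma_A^L$ with a cross-section of the cone $\mathbb Q_+A$; thus $\Gamma_A^L$ is a piecewise linear $(d-1)$-disk, and its boundary as a manifold with boundary is the set of points of $\Gamma_A^L$ that lie in the topological boundary of $\mathbb Q_+A$ in $\mathbb Q^d$. For $\tau\in\Phi_A^L$ let $\mathbb Q_+\tau$ be the convex cone generated by $\tau$ (with $\mathbb Q_+\emptyset=\{0\}$), and let $S_A^L(\tau)=\bigoplus_{\mathbf a\in\mathbb Z^d\cap\mathbb Q_+\tau}(S_A^L)_{\mathbf a}$, a $\mathbb C$-subalgebra of $S_A^L$. If $S_A^L(\tau)$ is a Cohen–Macaulay ring for every $\tau\in\Phi_A^L$ that is not contained in the boundary of $\Gamma_A^L$, then $S_A^L$ is a Cohen–Macaulay ring. -/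

import Mathlib

noncomputable section

namespace ToricGr

open MvPolynomial

/-! ### Cohen–Macaulay rings -/

/-- The depth of a local ring `R`: the supremum of the lengths of the `R`-regular sequences
contained in the maximal ideal. -/
def localDepth (R : Type*) [CommRing R] [IsLocalRing R] : ℕ∞ :=
  ⨆ rs : {rs : List R // (∀ r ∈ rs, r ∈ IsLocalRing.maximalIdeal R) ∧
    RingTheory.Sequence.IsRegular R rs}, (rs.1.length : ℕ∞)

/-- A local ring is Cohen–Macaulay if it is Noetherian and its depth equals its Krull dimension. -/
def IsCohenMacaulayLocalRing (R : Type*) [CommRing R] [IsLocalRing R] : Prop :=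
  IsNoetherianRing R ∧ ((localDepth R : ℕ∞) : WithBot ℕ∞) = ringKrullDim R

/-- A ring is Cohen–Macaulay if it is Noetherian and all its localizations at maximal ideals are
Cohen–Macaulay local rings. -/
def IsCohenMacaulayRing (R : Type*) [CommRing R] : Prop :=
  IsNoetherianRing R ∧ ∀ (m : Ideal R) [m.IsMaximal],
    IsCohenMacaulayLocalRing (Localization.AtPrime m)

variable {d n : ℕ}

/-! ### The toric ideal and its associated graded ring -/

/-- The semigroup `ℕ A` generated by the columns of `A`. -/
def semigroup (A : Matrix (Fin d) (Fin n) ℤ) : AddSubmonoid (Fin d → ℤ) :=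
  AddSubmonoid.closure (Set.range A.col)

/-- The binomial `∂^(u₊) - ∂^(u₋)`, where `∂₁, …, ∂ₙ` are the variables. -/
def binomial (u : Fin n → ℤ) : MvPolynomial (Fin n) ℂ :=
  monomial (Finsupp.equivFunOnFinite.symm fun j => (u j).toNat) 1 -
    monomial (Finsupp.equivFunOnFinite.symm fun j => (-u j).toNat) 1

/-- The toric ideal `I_A`, generated by the binomials of all integer vectors `u` with `A u = 0`. -/
def toricIdeal (A : Matrix (Fin d) (Fin n) ℤ) : Ideal (MvPolynomial (Fin n) ℂ) :=
  Ideal.span {f | ∃ u : Fin n → ℤ, A.mulVec u = 0 ∧ f = binomial u}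

/-- The step `L_k R` of the filtration of `R = ℂ[∂₁, …, ∂ₙ]` induced by the weight vector `L`:
the span of the monomials `∂^u` with `L · u ≤ k`. -/
def weightFiltration (L : Fin n → ℚ) (k : ℚ) : Submodule ℂ (MvPolynomial (Fin n) ℂ) :=
  restrictSupport ℂ {u : Fin n →₀ ℕ | Finsupp.weight L u ≤ k}

/-- The ideal `gr^L(I)` of `gr^L(R) = R`. Its homogeneous part of weight `k` consists of the classes
modulo `L_{<k} R`, i.e. the weight `k` components, of the elements of `I ∩ L_k R`. -/
def gradedIdeal (L : Fin n → ℚ) (I : Ideal (MvPolynomial (Fin n) ℂ)) :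
    Ideal (MvPolynomial (Fin n) ℂ) :=
  Ideal.span {g | ∃ k : ℚ, ∃ f ∈ I, f ∈ weightFiltration L k ∧
    g = weightedHomogeneousComponent L k f}

/-- The graded toric ring `S_A^L = gr^L(R / I_A) = R / gr^L(I_A)`. -/
abbrev GradedToricRing (A : Matrix (Fin d) (Fin n) ℤ) (L : Fin n → ℚ) : Type :=
  MvPolynomial (Fin n) ℂ ⧸ gradedIdeal L (toricIdeal A)

/-- The homogeneous part of degree `a ∈ ℤ^d` of `S_A^L`, for the grading in which the class of the
variable `∂ⱼ` has as its degree the `j`-th column of `A`. -/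
def degreePart (A : Matrix (Fin d) (Fin n) ℤ) (L : Fin n → ℚ) (a : Fin d → ℤ) :
    Submodule ℂ (GradedToricRing A L) :=
  (weightedHomogeneousSubmodule ℂ A.col a).map
    (Ideal.Quotient.mkₐ ℂ (gradedIdeal L (toricIdeal A))).toLinearMap

/-! ### The umbrella -/

/-- The `j`-th column of `A` as a point of `ℚ^d`. -/
def column (A : Matrix (Fin d) (Fin n) ℤ) (j : Fin n) : Fin d → ℚ := fun i => (A i j : ℚ)

/-- The `(A, L)`-polyhedron for positive weights: the convex hull in `ℚ^d` of `0` and the points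
`a_j / L_j`. -/
def polyhedron (A : Matrix (Fin d) (Fin n) ℤ) (L : Fin n → ℚ) : Set (Fin d → ℚ) :=
  convexHull ℚ (insert 0 (Set.range fun j => (L j)⁻¹ • column A j))

/-- The `(A, L)`-umbrella: the set of faces of the `(A, L)`-polyhedron, the empty face included,
that do not contain `0`. -/
def umbrella (A : Matrix (Fin d) (Fin n) ℤ) (L : Fin n → ℚ) : Set (Set (Fin d → ℚ)) :=
  {τ | IsExposed ℚ (polyhedron A L) τ ∧ (0 : Fin d → ℚ) ∉ τ}

/-- The point set underlying the `(A, L)`-umbrella. -/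
def umbrellaSupport (A : Matrix (Fin d) (Fin n) ℤ) (L : Fin n → ℚ) : Set (Fin d → ℚ) :=
  ⋃₀ umbrella A L

/-- The boundary of the point set of the umbrella as a manifold with boundary. For positive weights,
radial projection from `0` identifies that point set with a cross-section of the full-dimensional
cone `ℚ₊ A`; so its boundary consists of its points in the topological boundary of that cone. -/
def umbrellaBoundary (A : Matrix (Fin d) (Fin n) ℤ) (L : Fin n → ℚ) : Set (Fin d → ℚ) :=
  umbrellaSupport A L ∩
    frontier (PointedCone.hull ℚ (Set.range (column A)) : Set (Fin d → ℚ))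

/-- The underlying space of `S_A^L(τ)`: the sum of the homogeneous parts of `S_A^L` whose degrees
lie in the cone `ℚ₊ τ`. -/
def facePart (A : Matrix (Fin d) (Fin n) ℤ) (L : Fin n → ℚ) (τ : Set (Fin d → ℚ)) :
    Submodule ℂ (GradedToricRing A L) :=
  ⨆ a : {a : Fin d → ℤ // (fun i => (a i : ℚ)) ∈ PointedCone.hull ℚ τ}, degreePart A L a

theorem degreePart_mul_le (A : Matrix (Fin d) (Fin n) ℤ) (L : Fin n → ℚ) (a b : Fin d → ℤ) :
    degreePart A L a * degreePart A L b ≤ degreePart A L (a + b) := by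
  unfold degreePart
  rw [← Submodule.map_mul]
  exact Submodule.map_mono (weightedHomogeneousSubmodule_mul _ _ _)

theorem facePart_mul_le (A : Matrix (Fin d) (Fin n) ℤ) (L : Fin n → ℚ) (τ : Set (Fin d → ℚ)) :
    facePart A L τ * facePart A L τ ≤ facePart A L τ := by
  conv_lhs => unfold facePart
  simp only [Submodule.iSup_mul, Submodule.mul_iSup]
  refine iSup_le fun a => iSup_le fun b => (degreePart_mul_le A L _ _).trans ?_
  have h : (fun i => (((b : Fin d → ℤ) + (a : Fin d → ℤ)) i : ℚ)) ∈ PointedCone.hull ℚ τ := by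
    have h' := Submodule.add_mem _ b.2 a.2
    convert h' using 1
    ext i
    simp
  exact le_iSup (fun a : {a : Fin d → ℤ // (fun i => (a i : ℚ)) ∈ PointedCone.hull ℚ τ} =>
    degreePart A L a) ⟨_, h⟩

theorem one_mem_facePart (A : Matrix (Fin d) (Fin n) ℤ) (L : Fin n → ℚ) (τ : Set (Fin d → ℚ)) :
    (1 : GradedToricRing A L) ∈ facePart A L τ := by
  have h : (fun i => (((0 : Fin d → ℤ) i : ℤ) : ℚ)) ∈ PointedCone.hull ℚ τ := by
    have h' := Submodule.zero_mem (PointedCone.hull ℚ τ)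
    convert h' using 1
    ext i
    simp
  refine (le_iSup (fun a : {a : Fin d → ℤ // (fun i => (a i : ℚ)) ∈ PointedCone.hull ℚ τ} =>
    degreePart A L a) ⟨_, h⟩) ?_
  exact ⟨1, isWeightedHomogeneous_one _ _,
    map_one (Ideal.Quotient.mkₐ ℂ (gradedIdeal L (toricIdeal A)))⟩

/-- The subalgebra `S_A^L(τ)` of `S_A^L`. -/
def faceSubalgebra (A : Matrix (Fin d) (Fin n) ℤ) (L : Fin n → ℚ) (τ : Set (Fin d → ℚ)) :
    Subalgebra ℂ (GradedToricRing A L) :=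
  (facePart A L τ).toSubalgebra (one_mem_facePart A L τ)
    fun _ _ hx hy => facePart_mul_le A L τ (Submodule.mul_mem_mul hx hy)

end ToricGr

end

/-!
After clearing denominators the weights are `L j = w j / N` with positive integers `w j`. Every
element `a` of the semigroup `ℕA` has an order `ord A w a`, the least weight of a representation of
`a` by the columns. The graded toric ring has a basis `e a` indexed by `ℕA`, with
`e a * e b = e (a + b)` if the order is additive on `a` and `b`, and `e a * e b = 0` otherwise
(`isFaceAlgebra_monomialClass`). The algebra of a face of the umbrella is spanned by the `e a` with
`a` in the cone over the face (`isFaceAlgebra_faceMonomialClass`).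

The polyhedral side is the cone `epigraph` spanned by the lifted columns `(a_j, w_j)` and the
vertical direction. Its lower faces correspond to the faces of the umbrella
(`umbrellaFace_mem_umbrella`, `mem_hull_umbrellaFace_iff`), and a lower face that lies in no
vertical facet corresponds to a face not contained in the boundary
(`not_umbrellaFace_subset_boundary`). The lower boundary of the cone is the graph of the Newton
function, which is subadditive and bounds the order from below, hence defines a second filtration.
In the common refinement of both structures, on the space of formal sums of elements of `ℕA`, a
product is nonzero only if both functions are additive; in particular both factors lie on a common lower face.
Let `theta i` be the multiplication by the sum of the barycentres of the lower faces of dimension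
`i`. These operators play the role of the colour classes of vertices in a barycentric subdivision,
whose sums are parameters of a Stanley–Reisner ring.

On a lower face the Newton function is additive, so that `theta i` acts there as an element of the
algebra of the face. A flag of faces gives a chain of primes, which bounds the dimension of the
algebra at the vertex from below (`IsFaceAlgebra.exists_prime_le_height`), while a prime that
contains all the parameters contains every `e a` with `a ≠ 0`
(`IsFaceAlgebra.mem_of_parameter_mem`). So the parameters form a system of parameters at the
vertex. If the algebra is Cohen–Macaulay they are regular there, and by homogeneity they are regular
on the algebra itself (`IsFaceAlgebra.regularMod_thetas`).

The local statements are glued by convexity. The facets of a cone that are visible from a point can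
be ordered by sweeping along a generic line, such that each facet meets the union of the previous
ones in a visible part of its own boundary. An induction on the dimension along this shelling
(`sweep`), with the depth estimate for unions of Mayer–Vietoris type (`RegularMod.inf`), shows that
the operators are regular on the whole lower boundary as soon as they are so on the lower faces that
meet its interior (`regularMod_thetas_bot`).

Finally, `theta i` is the leading part, for the filtration by the Newton function, of the
multiplication by `θ_i - c_i` in the graded toric ring, where `θ_i` is the parameter and `c_i` any
constant; a sequence is regular if its leading parts are (`Grading.regularMod_of_leading`,
`IsFaceAlgebra.isWeaklyRegular_sub`). By the Nullstellensatz every maximal ideal contains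
`θ_i - c_i` for suitable constants, and every prime that contains them is maximal
(`IsFaceAlgebra.isMaximal_of_parameter_sub_mem`). Hence all the localizations at maximal ideals are
Cohen–Macaulay.
-/

namespace ToricGr

/-! ### Regular sequences and the Cohen–Macaulay property of local rings -/

section CohenMacaulay

open RingTheory.Sequence IsLocalRing CategoryTheory Abelian Module
open scoped Pointwise

universe u

variable {R : Type u} [CommRing R] [IsLocalRing R] [IsNoetherianRing R]

omit [IsNoetherianRing R] in
lemma maximalIdeal_smul_top_lt (M : Type u) [AddCommGroup M] [Module R M] [Module.Finite R M]
    [Nontrivial M] : maximalIdeal R • (⊤ : Submodule R M) < ⊤ :=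
  (Submodule.top_ne_ideal_smul_of_le_jacobson_annihilator
    (maximalIdeal_le_jacobson _)).symm.lt_top

omit [IsNoetherianRing R] in
lemma ringKrullDim_le_zero_of_surjective {R' : Type u} [CommRing R'] {f : R →+* R'}
    (hf : Function.Surjective f)
    (h : ∀ Q : Ideal R', Q.IsPrime → Q.comap f = maximalIdeal R) : ringKrullDim R' ≤ 0 := by
  rw [← Nat.cast_zero, ← Ring.krullDimLE_iff, Ring.krullDimLE_zero_iff]
  intro Q hQ
  exact Ideal.isMaximal_of_isIntegral_of_isMaximal_comap' f (f.isIntegral_of_surjective hf) Q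
    (h Q hQ ▸ inferInstance)

/-- Dividing a module by one regular element lowers the depth by one at most. By the Rees theorem
depth is read off from the vanishing of `Ext`, and the claim follows from the long exact
sequence. -/
lemma exists_isRegular_quotSMulTop (M : Type u) [AddCommGroup M] [Module R M] [Module.Finite R M]
    [Nontrivial M] {rs : List R} (mem : ∀ r ∈ rs, r ∈ maximalIdeal R) (reg : IsRegular M rs)
    {k : ℕ} (len : rs.length = k + 1) {x : R} (hx : x ∈ maximalIdeal R) (hxM : IsSMulRegular M x) :
    ∃ rs' : List R, rs'.length = k ∧ (∀ r ∈ rs', r ∈ maximalIdeal R) ∧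
      IsRegular (QuotSMulTop x M) rs' := by
  have := nontrivial_quotSMulTop_of_mem_maximalIdeal M hx
  have hex : ∃ rs : List R, rs.length = k + 1 ∧ (∀ r ∈ rs, r ∈ maximalIdeal R) ∧
      IsRegular (ModuleCat.of R M) rs := ⟨rs, len, mem, reg⟩
  have h1 := ((ModuleCat.exists_isRegular_tfae (maximalIdeal R) (k + 1) (ModuleCat.of R M)
    (maximalIdeal_smul_top_lt M)).out 3 1).1 hex
  refine ((ModuleCat.exists_isRegular_tfae (maximalIdeal R) k (ModuleCat.of R (QuotSMulTop x M))
    (maximalIdeal_smul_top_lt _)).out 3 1).2 fun i hi => ?_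
  have zero1 := AddCommGrpCat.isZero_of_iff_subsingleton.mpr (h1 i (by omega))
  have zero2 := AddCommGrpCat.isZero_of_iff_subsingleton.mpr (h1 (i + 1) (by omega))
  have hxM' : IsSMulRegular (ModuleCat.of R M) x := hxM
  exact AddCommGrpCat.subsingleton_of_isZero <| ShortComplex.Exact.isZero_of_both_zeros
    ((Ext.covariant_sequence_exact₃' _ hxM'.smulShortComplex_shortExact) i (i + 1) rfl)
    (zero1.eq_zero_of_src _) (zero2.eq_zero_of_tgt _)

omit [IsLocalRing R] in
/-- If `x` is regular on `M` and `p` is associated to `M`, then some prime containing `p` and `x`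
is associated to `M / x M`: the submodule killed by `p` meets `x M` in `x` times itself. -/
lemma exists_associatedPrime_quotSMulTop {M : Type u} [AddCommGroup M] [Module R M]
    [Module.Finite R M] {x : R} (hxM : IsSMulRegular M x)
    (hx : x ∈ Ideal.jacobson (⊥ : Ideal R)) {p : Ideal R}
    (hp : IsAssociatedPrime p M) :
    ∃ q, IsAssociatedPrime q (QuotSMulTop x M) ∧ p ≤ q ∧ x ∈ q := by
  obtain ⟨hpp, m, hm⟩ := (isAssociatedPrime_iff).1 hp
  -- a submodule `U` killed by `p`, with an element outside `x M`
  let U : Submodule R M := ⨅ r : p, LinearMap.ker (LinearMap.lsmul R M r)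
  have hU : ∀ {u}, u ∈ U ↔ ∀ r ∈ p, r • u = 0 := by
    intro u; simp [U]
  have hmU : m ∈ U := hU.2 fun r hr => by
    rw [hm] at hr; simpa using hr
  have hm0 : m ≠ 0 := by
    rintro rfl
    exact hpp.ne_top (by rw [hm]; ext; simp)
  obtain ⟨u, huU, hux⟩ : ∃ u ∈ U, u ∉ x • (⊤ : Submodule R M) := by
    by_contra! hcon
    have hle : U ≤ Ideal.span {x} • U := by
      intro u hu
      obtain ⟨v, -, rfl⟩ := (Submodule.mem_smul_pointwise_iff_exists _ _ _).1 (hcon u hu)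
      refine Submodule.smul_mem_smul (Ideal.mem_span_singleton_self x) (hU.2 fun r hr => ?_)
      apply hxM
      have := hU.1 hu r hr
      simpa [smul_comm r x v] using this
    have : U = ⊥ := Submodule.eq_bot_of_le_smul_of_le_jacobson_bot _ _ (IsNoetherian.noetherian U)
      hle (by simpa [Ideal.span_le] using hx)
    exact hm0 (by simpa [this] using hmU)
  obtain ⟨q, hq, hle⟩ := exists_le_isAssociatedPrime_of_isNoetherianRing R
    (Submodule.Quotient.mk u : QuotSMulTop x M) (by
      simpa [Submodule.Quotient.mk_eq_zero] using hux)
  refine ⟨q, hq, fun r hr => hle ?_, hle ?_⟩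
  · have := hU.1 huU r hr
    simp [Submodule.mem_colon_singleton, ← Submodule.Quotient.mk_smul, this]
  · simp only [Submodule.mem_colon_singleton, ← Submodule.Quotient.mk_smul, Submodule.mem_bot,
      Submodule.Quotient.mk_eq_zero]
    exact Submodule.smul_mem_pointwise_smul _ _ _ trivial

/-- The depth of a module is at most the dimension of `R / p`, for every associated prime `p`. -/
lemma length_le_ringKrullDim_quotient {M : Type u} [AddCommGroup M] [Module R M]
    [Module.Finite R M] {rs : List R} (mem : ∀ r ∈ rs, r ∈ maximalIdeal R) (reg : IsRegular M rs)
    {p : Ideal R} (hp : IsAssociatedPrime p M) :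
    (rs.length : WithBot ℕ∞) ≤ ringKrullDim (R ⧸ p) := by
  induction rs generalizing M p with
  | nil =>
    have := hp.isPrime
    simpa using ringKrullDim_nonneg_of_nontrivial
  | cons x rs ih =>
    have hreg := (isRegular_cons_iff M x rs).1 reg
    obtain ⟨q, hq, hpq, hxq⟩ := exists_associatedPrime_quotSMulTop hreg.1
      (by rw [IsLocalRing.jacobson_eq_maximalIdeal _ bot_ne_top]; exact mem x (by simp)) hp
    have h1 := ih (fun r hr => mem r (by simp [hr])) hreg.2 hq
    have hxp : x ∉ p := by
      obtain ⟨hpp, m, hm⟩ := (isAssociatedPrime_iff).1 hp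
      intro hxp
      rw [hm] at hxp
      have hm0 : m = 0 := hreg.1 (by simpa using hxp)
      exact hpp.ne_top (by rw [hm, hm0]; ext; simp)
    have := hp.isPrime
    have h2 : ringKrullDim (R ⧸ q) ≤
        ringKrullDim ((R ⧸ p) ⧸ Ideal.span {Ideal.Quotient.mk p x}) := by
      refine ringKrullDim_le_of_surjective
        (Ideal.Quotient.lift _ (Ideal.Quotient.factor hpq) ?_) ?_
      · intro a ha
        rw [← RingHom.mem_ker]
        refine (Ideal.span_le.2 ?_ : Ideal.span _ ≤ _) ha
        simpa [RingHom.mem_ker, Ideal.Quotient.eq_zero_iff_mem] using hxq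
      · intro y
        obtain ⟨y, rfl⟩ := Ideal.Quotient.mk_surjective y
        exact ⟨Ideal.Quotient.mk _ (Ideal.Quotient.mk _ y), by simp⟩
    have h3 := ringKrullDim_quotient_succ_le_of_nonZeroDivisor (r := Ideal.Quotient.mk p x)
      (mem_nonZeroDivisors_of_ne_zero (by simpa [Ideal.Quotient.eq_zero_iff_mem] using hxp))
    calc ((x :: rs).length : WithBot ℕ∞) = (rs.length : WithBot ℕ∞) + 1 := by simp
      _ ≤ ringKrullDim (R ⧸ q) + 1 := by gcongr
      _ ≤ _ := by gcongr
      _ ≤ _ := h3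

/-- If the depth of `M` is at least the number of the elements `θ₁, …, θₖ`, and these cut the
support of `M` down to the closed point, then they form a weakly regular sequence on `M`. -/
lemma isWeaklyRegular_of_length_eq {M : Type u} [AddCommGroup M] [Module R M]
    [Module.Finite R M] [Nontrivial M] {rs : List R} (mem : ∀ r ∈ rs, r ∈ maximalIdeal R)
    (reg : IsRegular M rs) {θ : List R} (hθ : ∀ r ∈ θ, r ∈ maximalIdeal R)
    (len : rs.length = θ.length)
    (hsupp : ∀ q : Ideal R, q.IsPrime → Module.annihilator R M ≤ q → (∀ r ∈ θ, r ∈ q) →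
      q = maximalIdeal R) :
    IsWeaklyRegular M θ := by
  induction θ generalizing M rs with
  | nil => simp
  | cons x θ ih =>
    have hxm : x ∈ maximalIdeal R := hθ x (by simp)
    have hxM : IsSMulRegular M x := by
      by_contra hcon
      have : ∃ m : M, m ≠ 0 ∧ x • m = 0 := by
        by_contra! h
        refine hcon fun a b hab => ?_
        by_contra hne
        exact h (a - b) (sub_ne_zero.2 hne) (by simpa [smul_sub, sub_eq_zero] using hab)
      obtain ⟨m, hm0, hxm0⟩ := this
      obtain ⟨p, hp, hle⟩ := exists_le_isAssociatedPrime_of_isNoetherianRing R m hm0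
      have hxp : x ∈ p := hle (by simpa [Submodule.mem_colon_singleton] using hxm0)
      have hpp := hp.isPrime
      have h1 := length_le_ringKrullDim_quotient mem reg hp
      -- the remaining `k - 1` elements would cut `R / p` down to dimension zero
      classical
      let S : Finset (R ⧸ p) := (θ.map (Ideal.Quotient.mk p)).toFinset
      have hS : (S : Set (R ⧸ p)) ⊆ Ring.jacobson (R ⧸ p) := by
        intro s hs
        simp only [S, List.coe_toFinset, List.mem_map, Set.mem_ofPred_eq] at hs
        obtain ⟨t, ht, rfl⟩ := hs
        have hplocal : IsLocalRing (R ⧸ p) :=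
          IsLocalRing.of_surjective' (Ideal.Quotient.mk p) Ideal.Quotient.mk_surjective
        rw [SetLike.mem_coe, Ring.jacobson_eq_sInf_isMaximal, Ideal.mem_sInf]
        intro Q hQ
        rw [IsLocalRing.eq_maximalIdeal hQ, mem_maximalIdeal, mem_nonunits_iff]
        intro hu
        obtain ⟨y, hy⟩ := hu.exists_right_inv
        obtain ⟨y, rfl⟩ := Ideal.Quotient.mk_surjective y
        have h1 : t * y - 1 ∈ maximalIdeal R := le_maximalIdeal hpp.ne_top (by
          rw [← Ideal.Quotient.eq_zero_iff_mem]; simp [hy])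
        have h2 : t * y ∈ maximalIdeal R := Ideal.mul_mem_right _ _ (hθ t (by simp [ht]))
        exact (Ideal.ne_top_iff_one _).1 (maximalIdeal.isMaximal R).ne_top
          (by simpa using Ideal.sub_mem _ h2 h1)
      have h2 := ringKrullDim_le_ringKrullDim_quotient_add_card S hS
      have h3 : ringKrullDim ((R ⧸ p) ⧸ Ideal.span (S : Set (R ⧸ p))) ≤ 0 := by
        refine ringKrullDim_le_zero_of_surjective
          (f := (Ideal.Quotient.mk (Ideal.span (S : Set (R ⧸ p)))).comp (Ideal.Quotient.mk p))
          (Ideal.Quotient.mk_surjective.comp Ideal.Quotient.mk_surjective) fun Q hQ => ?_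
        refine hsupp _ inferInstance (fun r hr => ?_) fun r hr => ?_
        · have hann := hp.annihilator_le (by rwa [Submodule.annihilator_top])
          simp [Ideal.mem_comap, Ideal.Quotient.eq_zero_iff_mem.2 hann]
        · rcases List.mem_cons.1 hr with rfl | hr
          · simp [Ideal.mem_comap, Ideal.Quotient.eq_zero_iff_mem.2 hxp]
          · have : Ideal.Quotient.mk (Ideal.span (S : Set (R ⧸ p))) (Ideal.Quotient.mk p r) = 0 :=
              Ideal.Quotient.eq_zero_iff_mem.2 (Ideal.subset_span (by
                simpa [S] using ⟨r, hr, rfl⟩))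
            simp [Ideal.mem_comap, this]
      have hcard : S.card ≤ θ.length := (List.toFinset_card_le _).trans (by simp)
      have : ((x :: θ).length : WithBot ℕ∞) ≤ (θ.length : WithBot ℕ∞) := by
        rw [← len]
        refine h1.trans (h2.trans ?_)
        calc _ ≤ (0 : WithBot ℕ∞) + (S.card : WithBot ℕ∞) := by gcongr
          _ ≤ _ := by rw [zero_add]; exact_mod_cast hcard
      have : (x :: θ).length ≤ θ.length := by exact_mod_cast this
      simp at this
    obtain ⟨rs', len', mem', reg'⟩ := exists_isRegular_quotSMulTop M mem reg
      (k := θ.length) (by simpa using len) hxm hxM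
    have := nontrivial_quotSMulTop_of_mem_maximalIdeal M hxm
    refine (isWeaklyRegular_cons_iff M x θ).2 ⟨hxM, ih mem' reg'
      (fun r hr => hθ r (by simp [hr])) len' fun q hq hann hmem => hsupp q hq ?_ ?_⟩
    · refine le_trans (fun r hr => ?_) hann
      rw [Module.mem_annihilator] at hr ⊢
      intro m
      obtain ⟨m, rfl⟩ := Submodule.Quotient.mk_surjective _ m
      rw [← Submodule.Quotient.mk_smul, hr m, Submodule.Quotient.mk_zero]
    · intro r hr
      rcases List.mem_cons.1 hr with rfl | hr
      · refine hann ?_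
        rw [Module.mem_annihilator]
        intro m
        obtain ⟨m, rfl⟩ := Submodule.Quotient.mk_surjective _ m
        rw [← Submodule.Quotient.mk_smul, Submodule.Quotient.mk_eq_zero]
        exact Submodule.smul_mem_pointwise_smul _ _ _ trivial
      · exact hmem r hr

/-- In a Cohen–Macaulay local ring every system of parameters is a regular sequence. -/
theorem IsCohenMacaulayLocalRing.isWeaklyRegular (hR : IsCohenMacaulayLocalRing R) {θ : List R}
    (hθ : ∀ r ∈ θ, r ∈ maximalIdeal R) (hdim : (θ.length : WithBot ℕ∞) ≤ ringKrullDim R)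
    (hsupp : ∀ q : Ideal R, q.IsPrime → (∀ r ∈ θ, r ∈ q) → q = maximalIdeal R) :
    IsWeaklyRegular R θ := by
  have hle : (θ.length : ℕ∞) ≤ localDepth R := by
    rw [← hR.2] at hdim
    exact_mod_cast hdim
  obtain ⟨rs, mem, reg, len⟩ : ∃ rs : List R, (∀ r ∈ rs, r ∈ maximalIdeal R) ∧ IsRegular R rs ∧
      θ.length ≤ rs.length := by
    by_contra! hcon
    have hpos : 0 < θ.length := (hcon [] (by simp) (IsRegular.nil R R)).pos
    have : localDepth R ≤ ((θ.length - 1 : ℕ) : ℕ∞) := by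
      refine iSup_le fun rs => ?_
      have := hcon rs.1 rs.2.1 rs.2.2
      exact_mod_cast (by omega : rs.1.length ≤ θ.length - 1)
    have : θ.length ≤ θ.length - 1 := by exact_mod_cast hle.trans this
    omega
  have reg' : IsRegular R (rs.take θ.length) := by
    have h := reg.1
    rw [← List.take_append_drop θ.length rs, isWeaklyRegular_append_iff] at h
    exact IsRegular.of_isWeaklyRegular_of_mem_maximalIdeal R
      (fun r hr => mem r (List.mem_of_mem_take hr)) h.1
  exact isWeaklyRegular_of_length_eq (fun r hr => mem r (List.mem_of_mem_take hr)) reg' hθ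
    (by simpa using len) fun q hq _ h => hsupp q hq h

/-- A Noetherian local ring is Cohen–Macaulay if some weakly regular sequence in its maximal ideal
generates an ideal whose only prime is the maximal one. -/
theorem IsCohenMacaulayLocalRing.of_isWeaklyRegular {θ : List R}
    (hθ : ∀ r ∈ θ, r ∈ maximalIdeal R) (hreg : IsWeaklyRegular R θ)
    (hsupp : ∀ q : Ideal R, q.IsPrime → (∀ r ∈ θ, r ∈ q) → q = maximalIdeal R) :
    IsCohenMacaulayLocalRing R := by
  refine ⟨inferInstance, le_antisymm ?_ ?_⟩
  · have hle : ∀ rs : List R, IsRegular R rs → (rs.length : WithBot ℕ∞) ≤ ringKrullDim R := by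
      intro rs reg
      rw [← ringKrullDim_add_length_eq_ringKrullDim_of_isRegular rs reg]
      have : Nontrivial (R ⧸ Ideal.ofList rs) := Ideal.Quotient.nontrivial_iff.2 fun h =>
        reg.2 (by simp [h])
      calc (rs.length : WithBot ℕ∞) = 0 + rs.length := (zero_add _).symm
        _ ≤ _ := by gcongr; exact ringKrullDim_nonneg_of_nontrivial
    have hne : ringKrullDim R ≠ ⊥ := ringKrullDim_ne_bot
    obtain ⟨D, hD⟩ := WithBot.ne_bot_iff_exists.1 hne
    rw [← hD]
    refine WithBot.coe_le_coe.2 (iSup_le fun rs => ?_)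
    have := hle rs.1 rs.2.2
    rw [← hD] at this
    exact_mod_cast this
  · have reg := IsRegular.of_isWeaklyRegular_of_mem_maximalIdeal R hθ hreg
    rw [← ringKrullDim_add_length_eq_ringKrullDim_of_isRegular θ reg]
    have h0 : ringKrullDim (R ⧸ Ideal.ofList θ) ≤ 0 := by
      refine ringKrullDim_le_zero_of_surjective Ideal.Quotient.mk_surjective fun Q hQ => ?_
      refine hsupp _ inferInstance fun r hr => ?_
      have : Ideal.Quotient.mk (Ideal.ofList θ) r = 0 :=
        Ideal.Quotient.eq_zero_iff_mem.2 (Ideal.subset_span hr)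
      simp [Ideal.mem_comap, this]
    calc _ ≤ (0 : WithBot ℕ∞) + (θ.length : WithBot ℕ∞) := by gcongr
      _ = ((θ.length : ℕ∞) : WithBot ℕ∞) := by simp
      _ ≤ _ := WithBot.coe_le_coe.2 (le_iSup_of_le ⟨θ, hθ, reg⟩ le_rfl)

end CohenMacaulay

end ToricGr

namespace ToricGr

/-! ### Sequences of operators that are regular modulo a subspace -/

section RegularMod

variable {k V V' : Type*} [CommRing k] [AddCommGroup V] [Module k V] [AddCommGroup V'] [Module k V']

/-- The sequence `x₁, x₂, …` of operators on `V` is weakly regular on `V / U`: each `xᵢ` acts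
injectively on `V / (U + x₁ V + ⋯ + xᵢ₋₁ V)`. -/
def RegularMod : List (Module.End k V) → Submodule k V → Prop
  | [], _ => True
  | x :: l, U => (∀ v, x v ∈ U → v ∈ U) ∧ RegularMod l (U ⊔ LinearMap.range x)

lemma RegularMod.of_eq_top (l : List (Module.End k V)) : RegularMod l (⊤ : Submodule k V) := by
  induction l with
  | nil => trivial
  | cons x l ih => exact ⟨fun _ _ => trivial, by simpa using ih⟩

lemma stable_sup_range {x y : Module.End k V} (hc : Commute x y) {U : Submodule k V}
    (hU : ∀ u ∈ U, y u ∈ U) {u : V} (hu : u ∈ U ⊔ LinearMap.range x) :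
    y u ∈ U ⊔ LinearMap.range x := by
  obtain ⟨a, ha, _, ⟨b, rfl⟩, rfl⟩ := Submodule.mem_sup.1 hu
  rw [map_add]
  refine Submodule.add_mem_sup (hU a ha) ⟨y b, ?_⟩
  rw [← Module.End.mul_apply, ← Module.End.mul_apply, hc.eq]

/-- If `x` acts injectively modulo `U₁ + U₂`, then dividing by the image of `x` commutes with the
intersection of `U₁` and `U₂`. -/
lemma inf_sup_range {x : Module.End k V} {U₁ U₂ : Submodule k V} (h₁ : ∀ u ∈ U₁, x u ∈ U₁)
    (h₂ : ∀ u ∈ U₂, x u ∈ U₂) (h : ∀ v, x v ∈ U₁ ⊔ U₂ → v ∈ U₁ ⊔ U₂) :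
    (U₁ ⊓ U₂) ⊔ LinearMap.range x = (U₁ ⊔ LinearMap.range x) ⊓ (U₂ ⊔ LinearMap.range x) := by
  apply le_antisymm
  · exact le_inf (sup_le_sup_right inf_le_left _) (sup_le_sup_right inf_le_right _)
  · rintro r ⟨hr₁, hr₂⟩
    obtain ⟨a, ha, _, ⟨c, rfl⟩, rfl⟩ := Submodule.mem_sup.1 hr₁
    obtain ⟨b, hb, _, ⟨c', rfl⟩, hbc⟩ := Submodule.mem_sup.1 hr₂
    obtain ⟨i, hi, j, hj, hij⟩ := Submodule.mem_sup.1 (h (c - c') (by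
      have : x (c - c') = -a + b := by
        have h1 : x c = b + x c' - a := by rw [hbc]; abel
        rw [map_sub, h1]; abel
      rw [this]
      exact Submodule.add_mem_sup (neg_mem ha) hb))
    have key : a + x i = b - x j := by
      have h1 : x i + x j = x c - x c' := by rw [← map_add, hij, map_sub]
      have h2 : b + x c' = a + x c := hbc
      calc a + x i = a + (x c - x c' - x j) := by rw [← h1]; abel
        _ = (a + x c) - x c' - x j := by abel
        _ = _ := by rw [← h2]; abel
    refine Submodule.mem_sup.2 ⟨a + x i, ⟨add_mem ha (h₁ i hi), ?_⟩, x (c - i), ⟨_, rfl⟩, ?_⟩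
    · rw [key]
      exact sub_mem hb (h₂ j hj)
    · rw [map_sub]; abel

/-- A sequence `l` followed by `x` is regular modulo `U₁ ∩ U₂` if it is regular modulo `U₁` and
modulo `U₂`, while `l` is regular modulo `U₁ + U₂`. This is the behaviour of depth along the exact
sequence `0 → V / (U₁ ∩ U₂) → V / U₁ ⊕ V / U₂ → V / (U₁ + U₂) → 0`. -/
theorem RegularMod.inf {l : List (Module.End k V)} {x : Module.End k V} {U₁ U₂ : Submodule k V}
    (hc : ∀ y ∈ l ++ [x], ∀ z ∈ l ++ [x], Commute y z)
    (hs₁ : ∀ y ∈ l ++ [x], ∀ u ∈ U₁, y u ∈ U₁) (hs₂ : ∀ y ∈ l ++ [x], ∀ u ∈ U₂, y u ∈ U₂)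
    (h₁ : RegularMod (l ++ [x]) U₁) (h₂ : RegularMod (l ++ [x]) U₂)
    (h : RegularMod l (U₁ ⊔ U₂)) : RegularMod (l ++ [x]) (U₁ ⊓ U₂) := by
  induction l generalizing U₁ U₂ with
  | nil => exact ⟨fun v hv => ⟨h₁.1 v hv.1, h₂.1 v hv.2⟩, trivial⟩
  | cons y l ih =>
    refine ⟨fun v hv => ⟨h₁.1 v hv.1, h₂.1 v hv.2⟩, ?_⟩
    rw [inf_sup_range (hs₁ y (by simp)) (hs₂ y (by simp)) h.1]
    refine ih (fun a ha b hb => hc a (List.mem_cons_of_mem _ ha) b (List.mem_cons_of_mem _ hb))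
      (fun z hz u hu => ?_) (fun z hz u hu => ?_) h₁.2 h₂.2 ?_
    · exact stable_sup_range (hc y (by simp) z (List.mem_cons_of_mem _ hz))
        (hs₁ z (List.mem_cons_of_mem _ hz)) hu
    · exact stable_sup_range (hc y (by simp) z (List.mem_cons_of_mem _ hz))
        (hs₂ z (List.mem_cons_of_mem _ hz)) hu
    · convert h.2 using 1
      rw [sup_sup_sup_comm, sup_idem]

/-- Regularity may be tested after a surjection that intertwines the operators. -/
lemma regularMod_comap_iff {β : V →ₗ[k] V'} (hβ : Function.Surjective β)
    {l : List (Module.End k V)} {l' : List (Module.End k V')}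
    (h : List.Forall₂ (fun x y => ∀ v, β (x v) = y (β v)) l l') (J : Submodule k V') :
    RegularMod l (J.comap β) ↔ RegularMod l' J := by
  induction h generalizing J with
  | nil => exact Iff.rfl
  | @cons x y l l' hxy _ ih =>
    have hrange : J.comap β ⊔ LinearMap.range x = (J ⊔ LinearMap.range y).comap β := by
      apply le_antisymm
      · refine sup_le (Submodule.comap_mono le_sup_left) ?_
        rintro _ ⟨v, rfl⟩
        exact Submodule.mem_comap.2 (hxy v ▸ Submodule.mem_sup_right ⟨β v, rfl⟩)
      · intro v hv
        obtain ⟨j, hj, _, ⟨w, rfl⟩, hvw⟩ := Submodule.mem_sup.1 (Submodule.mem_comap.1 hv)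
        obtain ⟨w, rfl⟩ := hβ w
        refine Submodule.mem_sup.2 ⟨v - x w, ?_, x w, ⟨w, rfl⟩, by abel⟩
        rw [Submodule.mem_comap, map_sub, hxy, ← hvw]
        simpa using hj
    change (_ ∧ _) ↔ (_ ∧ _)
    rw [hrange, ih (J ⊔ LinearMap.range y)]
    refine and_congr_left fun _ => ⟨fun H v => ?_, fun H v => ?_⟩
    · obtain ⟨v, rfl⟩ := hβ v
      have := H v
      rwa [Submodule.mem_comap, Submodule.mem_comap, hxy] at this
    · rw [Submodule.mem_comap, Submodule.mem_comap, hxy]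
      exact H _

end RegularMod

/-! ### Comparison with weakly regular sequences -/

section Ideals

variable {k B : Type*} [CommRing k] [CommRing B] [Algebra k B]

lemma restrictScalars_sup_range_mulLeft (J : Ideal B) (x : B) :
    J.restrictScalars k ⊔ LinearMap.range (LinearMap.mulLeft k x) =
      (J ⊔ Ideal.span {x}).restrictScalars k := by
  ext r
  simp only [Submodule.mem_sup, Submodule.restrictScalars_mem, LinearMap.mem_range,
    LinearMap.mulLeft_apply, Ideal.mem_span_singleton']
  constructor
  · rintro ⟨a, ha, _, ⟨b, rfl⟩, rfl⟩
    exact ⟨a, ha, _, ⟨b, rfl⟩, by ring⟩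
  · rintro ⟨a, ha, _, ⟨b, rfl⟩, rfl⟩
    exact ⟨a, ha, _, ⟨b, rfl⟩, by ring⟩

open scoped Pointwise in
open RingTheory.Sequence in
/-- For multiplications by ring elements, modulo an ideal, the notion is that of a weakly regular
sequence on the quotient ring. -/
lemma regularMod_iff_isWeaklyRegular_quotient (l : List B) (J : Ideal B) :
    RegularMod (l.map (LinearMap.mulLeft k)) (J.restrictScalars k) ↔ IsWeaklyRegular (B ⧸ J) l := by
  induction l generalizing J with
  | nil => simp [RegularMod]
  | cons x l ih =>
    rw [List.map_cons, isWeaklyRegular_cons_iff]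
    change (_ ∧ RegularMod _ _) ↔ _
    rw [restrictScalars_sup_range_mulLeft, ih]
    have e : (B ⧸ (J ⊔ Ideal.span {x})) ≃ₗ[B] QuotSMulTop x (B ⧸ J) :=
      (Submodule.quotientQuotientEquivQuotientSup J (Ideal.span {x})).symm.trans
        (Submodule.quotEquivOfEq _ _ (by
          ext y
          constructor
          · rintro ⟨z, hz, rfl⟩
            obtain ⟨w, rfl⟩ := Ideal.mem_span_singleton'.1 hz
            refine (Submodule.mem_smul_pointwise_iff_exists _ _ _).2
              ⟨Submodule.Quotient.mk w, trivial, ?_⟩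
            rw [← Submodule.Quotient.mk_smul, smul_eq_mul, mul_comm]
            rfl
          · intro hy
            obtain ⟨w, -, rfl⟩ := (Submodule.mem_smul_pointwise_iff_exists _ _ _).1 hy
            obtain ⟨w, rfl⟩ := Submodule.Quotient.mk_surjective _ w
            exact ⟨x * w, Ideal.mul_mem_right _ _ (Ideal.mem_span_singleton_self x), rfl⟩))
    rw [e.isWeaklyRegular_congr]
    refine and_congr_left fun _ => ?_
    simp only [LinearMap.mulLeft_apply, Submodule.restrictScalars_mem]
    constructor
    · intro H a b hab
      obtain ⟨a, rfl⟩ := Submodule.Quotient.mk_surjective _ a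
      obtain ⟨b, rfl⟩ := Submodule.Quotient.mk_surjective _ b
      simp only [← Submodule.Quotient.mk_smul, Submodule.Quotient.eq, smul_eq_mul, ← mul_sub]
        at hab ⊢
      exact H _ hab
    · intro H v hv
      rw [← Submodule.Quotient.mk_eq_zero]
      apply H
      simp only [← Submodule.Quotient.mk_smul, smul_eq_mul, smul_zero]
      exact (Submodule.Quotient.mk_eq_zero _).2 hv

open RingTheory.Sequence in
lemma regularMod_bot_iff_isWeaklyRegular (l : List B) :
    RegularMod (l.map (LinearMap.mulLeft k)) (⊥ : Submodule k B) ↔ IsWeaklyRegular B l := by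
  rw [← Submodule.restrictScalars_bot k B B, regularMod_iff_isWeaklyRegular_quotient,
    (Submodule.quotEquivOfEqBot (⊥ : Ideal B) rfl).isWeaklyRegular_congr]

end Ideals

/-! ### Gradings and filtrations by the natural numbers -/

section Grading

variable {k V : Type*} [CommRing k] [AddCommGroup V] [Module k V]

/-- A grading of `V` by the natural numbers, given by the projections to the homogeneous
components. -/
structure Grading (k V : Type*) [CommRing k] [AddCommGroup V] [Module k V] where
  /-- the projection to a homogeneous component -/
  comp : ℕ → V →ₗ[k] V
  comp_comp : ∀ i j v, comp i (comp j v) = if i = j then comp j v else 0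
  eq_zero : ∀ v, (∀ i, comp i v = 0) → v = 0
  bounded : ∀ v, ∃ n, ∀ i ≥ n, comp i v = 0

namespace Grading

variable (G : Grading k V)

/-- The vectors whose components of degree at least `n` vanish. -/
def below (n : ℕ) : Submodule k V := ⨅ i : {i // n ≤ i}, LinearMap.ker (G.comp i)

variable {G}

lemma mem_below {n : ℕ} {v : V} : v ∈ G.below n ↔ ∀ i, n ≤ i → G.comp i v = 0 := by
  simp [below]

lemma below_mono {m n : ℕ} (h : m ≤ n) : G.below m ≤ G.below n := fun _ hv =>
  mem_below.2 fun i hi => mem_below.1 hv i (h.trans hi)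

lemma eq_zero_of_mem_below_zero {v : V} (hv : v ∈ G.below 0) : v = 0 :=
  G.eq_zero v fun i => mem_below.1 hv i (Nat.zero_le _)

lemma comp_mem_below (i : ℕ) (v : V) : G.comp i v ∈ G.below (i + 1) :=
  mem_below.2 fun j hj => by rw [G.comp_comp, if_neg (by omega)]

lemma sub_mem_below {n : ℕ} {u v : V} (hu : u ∈ G.below (n + 1)) (hv : v ∈ G.below (n + 1))
    (h : G.comp n u = G.comp n v) : u - v ∈ G.below n := by
  refine mem_below.2 fun i hi => ?_
  rcases hi.eq_or_lt with rfl | hi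
  · rw [map_sub, h, sub_self]
  · rw [map_sub, mem_below.1 hu i hi, mem_below.1 hv i hi, sub_self]

lemma sum_comp (v : V) {n : ℕ} (hn : ∀ i ≥ n, G.comp i v = 0) :
    v = ∑ i ∈ Finset.range n, G.comp i v := by
  rw [← sub_eq_zero]
  refine G.eq_zero _ fun i => ?_
  rw [map_sub, map_sum]
  simp only [G.comp_comp, Finset.sum_ite_eq, Finset.mem_range]
  split_ifs with h
  · exact sub_self _
  · rw [hn i (by omega), sub_zero]

lemma mem_of_comp_mem {U : Submodule k V} {v : V} (h : ∀ i, G.comp i v ∈ U) : v ∈ U := by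
  obtain ⟨n, hn⟩ := G.bounded v
  rw [sum_comp v hn]
  exact Submodule.sum_mem _ fun i _ => h i

variable (G)

/-- The operator `x` is homogeneous of degree `D`. -/
structure IsHomogeneousOp (D : ℕ) (x : Module.End k V) : Prop where
  comp_add : ∀ i v, G.comp (i + D) (x v) = x (G.comp i v)
  comp_lt : ∀ i v, i < D → G.comp i (x v) = 0

/-- The operator `x` raises degrees by `D` at most, and `θ` is its homogeneous part of
degree `D`. -/
structure IsLeadingOp (D : ℕ) (x θ : Module.End k V) : Prop where
  homogeneous : G.IsHomogeneousOp D θ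
  apply_mem_below : ∀ n v, v ∈ G.below n → x v ∈ G.below (n + D)
  comp_eq : ∀ n v, v ∈ G.below (n + 1) → G.comp (n + D) (x v) = θ (G.comp n v)

/-- `U'` is the graded subspace of the leading components of the elements of `U`. -/
structure IsLeadingSubspace (U U' : Submodule k V) : Prop where
  graded : ∀ n, ∀ v ∈ U', G.comp n v ∈ U'
  comp_mem : ∀ n, ∀ v ∈ U, v ∈ G.below (n + 1) → G.comp n v ∈ U'
  exists_lift : ∀ n, ∀ v' ∈ U', ∃ v ∈ U, v ∈ G.below (n + 1) ∧ G.comp n v = G.comp n v'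

variable {G}

lemma isLeadingSubspace_bot : G.IsLeadingSubspace ⊥ ⊥ where
  graded n v hv := by simp [(Submodule.mem_bot k).1 hv]
  comp_mem n v hv _ := by simp [(Submodule.mem_bot k).1 hv]
  exists_lift n v hv := ⟨0, zero_mem _, zero_mem _, by simp [(Submodule.mem_bot k).1 hv]⟩

lemma IsHomogeneousOp.comp_mem_sup_range {D : ℕ} {x : Module.End k V} (hx : G.IsHomogeneousOp D x)
    {U : Submodule k V} (hU : ∀ n, ∀ v ∈ U, G.comp n v ∈ U) (n : ℕ) :
    ∀ v ∈ U ⊔ LinearMap.range x, G.comp n v ∈ U ⊔ LinearMap.range x := by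
  intro v hv
  obtain ⟨u, hu, _, ⟨w, rfl⟩, rfl⟩ := Submodule.mem_sup.1 hv
  rw [map_add]
  refine Submodule.add_mem_sup (hU n u hu) ?_
  rcases lt_or_ge n D with h | h
  · rw [hx.comp_lt n w h]
    exact zero_mem _
  · obtain ⟨i, rfl⟩ := Nat.exists_eq_add_of_le' h
    rw [hx.comp_add]
    exact ⟨_, rfl⟩

lemma IsLeadingOp.mem_of_apply_mem {D : ℕ} {x θ : Module.End k V} (hx : G.IsLeadingOp D x θ)
    {U U' : Submodule k V} (hU : G.IsLeadingSubspace U U') (hs : ∀ u ∈ U, x u ∈ U)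
    (hθ : ∀ v, θ v ∈ U' → v ∈ U') (v : V) (hv : x v ∈ U) : v ∈ U := by
  obtain ⟨n, hn⟩ := G.bounded v
  replace hn : v ∈ G.below n := mem_below.2 hn
  induction n generalizing v with
  | zero => rw [eq_zero_of_mem_below_zero hn]; exact zero_mem _
  | succ n ih =>
    have h1 := hU.comp_mem (n + D) (x v) hv
      (by have := hx.apply_mem_below _ v hn; rwa [add_right_comm] at this)
    rw [hx.comp_eq n v hn] at h1
    obtain ⟨u, huU, hub, hu⟩ := hU.exists_lift n _ (hθ _ h1)
    rw [G.comp_comp, if_pos rfl] at hu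
    have h2 := ih (v - u) (by rw [map_sub]; exact sub_mem hv (hs u huU))
      (sub_mem_below hn hub hu.symm)
    simpa using add_mem h2 huU

/-- Leading subspaces are compatible with dividing by an operator, provided that its leading part is
injective modulo the leading subspace: a cancellation of top degree terms in `u + x v` can then be
absorbed into `u`. -/
lemma IsLeadingSubspace.sup_range {D : ℕ} {x θ : Module.End k V} (hx : G.IsLeadingOp D x θ)
    {U U' : Submodule k V} (hU : G.IsLeadingSubspace U U') (hs : ∀ u ∈ U, x u ∈ U)
    (hθ : ∀ v, θ v ∈ U' → v ∈ U') :
    G.IsLeadingSubspace (U ⊔ LinearMap.range x) (U' ⊔ LinearMap.range θ) where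
  graded := hx.homogeneous.comp_mem_sup_range hU.graded
  comp_mem := by
    intro n w hw hwn
    obtain ⟨u, hu, _, ⟨v, rfl⟩, rfl⟩ := Submodule.mem_sup.1 hw
    obtain ⟨j, hj⟩ := G.bounded v
    replace hj : v ∈ G.below j := mem_below.2 hj
    clear hw
    -- descend on a bound `j` for the degree of `v`
    induction j generalizing u v with
    | zero =>
      rw [eq_zero_of_mem_below_zero hj, map_zero, add_zero] at hwn ⊢
      exact Submodule.mem_sup_left (hU.comp_mem n u hu hwn)
    | succ j ih =>
      have hxv := hx.apply_mem_below _ v hj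
      rcases le_or_gt (j + D) n with h | h
      · have hu' : u ∈ G.below (n + 1) := by
          have := sub_mem hwn (below_mono (by omega : j + 1 + D ≤ n + 1) hxv)
          simpa using this
        rw [map_add]
        refine Submodule.add_mem_sup (hU.comp_mem n u hu hu') ?_
        rcases h.eq_or_lt with rfl | h
        · exact ⟨_, (hx.comp_eq j v hj).symm⟩
        · rw [mem_below.1 hxv n (by omega)]
          exact zero_mem _
      · have hu' : u ∈ G.below (j + D + 1) := by
          have := sub_mem (below_mono (by omega : n + 1 ≤ j + D + 1) hwn)
            (below_mono (by omega : j + 1 + D ≤ j + D + 1) hxv)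
          simpa using this
        have h0 := mem_below.1 hwn (j + D) (by omega)
        rw [map_add, hx.comp_eq j v hj] at h0
        have h1 := hU.comp_mem _ u hu hu'
        rw [eq_neg_of_add_eq_zero_left h0] at h1
        obtain ⟨w, hwU, hwb, hw⟩ := hU.exists_lift j _ (hθ _ (by simpa using h1))
        rw [G.comp_comp, if_pos rfl] at hw
        have hsum : (u + x w) + x (v - w) = u + x v := by rw [map_sub]; abel
        have := ih (u + x w) (add_mem hu (hs w hwU)) (v - w) (by rwa [hsum])
          (sub_mem_below hj hwb hw.symm)
        rwa [hsum] at this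
  exists_lift := by
    intro n w hw
    obtain ⟨u', hu', _, ⟨v, rfl⟩, rfl⟩ := Submodule.mem_sup.1 hw
    obtain ⟨u, hu, hub, huc⟩ := hU.exists_lift n u' hu'
    rcases lt_or_ge n D with h | h
    · refine ⟨u, Submodule.mem_sup_left hu, hub, ?_⟩
      rw [map_add, hx.homogeneous.comp_lt n v h, add_zero, huc]
    · obtain ⟨i, rfl⟩ := Nat.exists_eq_add_of_le' h
      have hb := comp_mem_below (G := G) i v
      refine ⟨u + x (G.comp i v), Submodule.add_mem_sup hu ⟨_, rfl⟩, add_mem hub ?_, ?_⟩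
      · exact below_mono (by omega) (hx.apply_mem_below _ _ hb)
      · rw [map_add, map_add, huc, hx.comp_eq i _ hb, hx.homogeneous.comp_add, G.comp_comp,
          if_pos rfl]

/-- If the leading parts of the operators are regular modulo the leading subspace of `U`, then the
operators themselves are regular modulo `U`. -/
theorem regularMod_of_leading {D : ℕ} {l l' : List (Module.End k V)}
    (h : List.Forall₂ (G.IsLeadingOp D) l l') (hc : ∀ x ∈ l, ∀ y ∈ l, Commute x y)
    {U U' : Submodule k V} (hU : G.IsLeadingSubspace U U') (hs : ∀ x ∈ l, ∀ u ∈ U, x u ∈ U)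
    (hreg : RegularMod l' U') : RegularMod l U := by
  induction h generalizing U U' with
  | nil => trivial
  | @cons x θ l l' hx _ ih =>
    have hsx := hs x (by simp)
    refine ⟨hx.mem_of_apply_mem hU hsx hreg.1, ih (fun a ha b hb => hc a (by simp [ha]) b
      (by simp [hb])) (hU.sup_range hx hsx hreg.1) (fun y hy u hu => ?_) hreg.2⟩
    exact stable_sup_range (hc x (by simp) y (by simp [hy])) (hs y (by simp [hy])) hu

end Grading

end Grading

end ToricGr

namespace ToricGr

/-! ### Polyhedral cones -/

section Cones

open Module Filter Topology

variable {E : Type*} [AddCommGroup E] [Module ℚ E]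

lemma eventually_pos_add_mul {a : ℚ} (b : ℚ) (ha : 0 < a) :
    ∀ᶠ ε in 𝓝[>] (0 : ℚ), 0 < a + ε * b := by
  have h : Tendsto (fun ε : ℚ => a + ε * b) (𝓝[>] 0) (𝓝 (a + 0 * b)) :=
    ((continuous_const.add (continuous_id.mul continuous_const)).tendsto 0).mono_left
      nhdsWithin_le_nhds
  rw [zero_mul, add_zero] at h
  exact h.eventually (lt_mem_nhds ha)

lemma eventually_ne_zero_add_mul {a : ℚ} (b : ℚ) (ha : a ≠ 0) :
    ∀ᶠ ε in 𝓝[>] (0 : ℚ), a + ε * b ≠ 0 := by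
  rcases ha.lt_or_gt with h | h
  · filter_upwards [eventually_pos_add_mul (-b) (neg_pos.2 h)] with ε hε
    intro h0
    linarith
  · filter_upwards [eventually_pos_add_mul b h] with ε hε
    exact hε.ne'

/-- One step of Fourier–Motzkin elimination: adding a generator to a cone that is cut out by
finitely many linear inequalities gives such a cone again. -/
lemma exists_finset_dual_add_ray (I : Finset (Dual ℚ E)) (g : E) :
    ∃ J : Finset (Dual ℚ E), ∀ x,
      (∃ t : ℚ, 0 ≤ t ∧ ∀ f ∈ I, 0 ≤ f (x - t • g)) ↔ ∀ f ∈ J, 0 ≤ f x := by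
  classical
  refine ⟨I.filter (fun f => 0 ≤ f g) ∪
    Finset.image₂ (fun f f' => f g • f' - f' g • f) (I.filter fun f => 0 < f g)
      (I.filter fun f => f g < 0), fun x => ⟨?_, ?_⟩⟩
  · rintro ⟨t, ht, h⟩ f hf
    rcases Finset.mem_union.1 hf with hf | hf
    · obtain ⟨hfI, hfg⟩ := Finset.mem_filter.1 hf
      have := h f hfI
      simp only [map_sub, map_smul, smul_eq_mul] at this
      nlinarith [mul_nonneg ht hfg]
    · obtain ⟨f₁, hf₁, f₂, hf₂, rfl⟩ := Finset.mem_image₂.1 hf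
      obtain ⟨hI₁, hg₁⟩ := Finset.mem_filter.1 hf₁
      obtain ⟨hI₂, hg₂⟩ := Finset.mem_filter.1 hf₂
      have h1 := h f₁ hI₁
      have h2 := h f₂ hI₂
      simp only [map_sub, map_smul, smul_eq_mul, LinearMap.sub_apply, LinearMap.smul_apply]
        at h1 h2 ⊢
      nlinarith [mul_nonneg hg₁.le h2, mul_nonneg (neg_nonneg.2 hg₂.le) h1]
  · intro h
    -- the least admissible multiple of the new generator
    let N := I.filter fun f => f g < 0
    let vals : Finset ℚ := insert 0 (N.image fun f => f x / f g)
    obtain ⟨t, htm, htmax⟩ := vals.exists_max_image id ⟨0, by simp [vals]⟩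
    simp only [id] at htmax
    refine ⟨t, htmax 0 (by simp [vals]), fun f hf => ?_⟩
    simp only [map_sub, map_smul, smul_eq_mul]
    rcases lt_trichotomy (f g) 0 with hg | hg | hg
    · have := htmax (f x / f g) (Finset.mem_insert_of_mem (Finset.mem_image_of_mem _
        (Finset.mem_filter.2 ⟨hf, hg⟩)))
      rw [div_le_iff_of_neg hg] at this
      linarith
    · have := h f (Finset.mem_union_left _ (Finset.mem_filter.2 ⟨hf, hg.ge⟩))
      rw [hg]; linarith
    · rcases Finset.mem_insert.1 htm with rfl | htm
      · have := h f (Finset.mem_union_left _ (Finset.mem_filter.2 ⟨hf, hg.le⟩))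
        linarith
      · obtain ⟨f', hf', rfl⟩ := Finset.mem_image.1 htm
        have hg' := (Finset.mem_filter.1 hf').2
        have := h _ (Finset.mem_union_right _ (Finset.mem_image₂_of_mem
          (Finset.mem_filter.2 ⟨hf, hg⟩) hf'))
        simp only [LinearMap.sub_apply, LinearMap.smul_apply, smul_eq_mul] at this
        have key : f x - f' x / f' g * f g = (f g * f' x - f' g * f x) / (-f' g) := by
          have := hg'.ne
          field_simp
          ring
        rw [key]
        exact div_nonneg this (by linarith)

/-- A finitely generated cone is cut out by finitely many linear inequalities. -/
theorem exists_finset_dual_hull [FiniteDimensional ℚ E] (s : Finset E) :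
    ∃ I : Finset (Dual ℚ E), ∀ x, x ∈ PointedCone.hull ℚ (s : Set E) ↔ ∀ f ∈ I, 0 ≤ f x := by
  classical
  induction s using Finset.induction_on with
  | empty =>
    let b := Module.finBasis ℚ E
    refine ⟨Finset.univ.image b.coord ∪ Finset.univ.image fun i => -b.coord i, fun x => ?_⟩
    simp only [Finset.coe_empty, PointedCone.hull, Submodule.span_empty, Submodule.mem_bot,
      Finset.mem_union, Finset.mem_image, Finset.mem_univ, true_and]
    constructor
    · rintro rfl f -
      simp
    · intro h
      refine b.ext_elem fun i => ?_
      have h1 := h (b.coord i) (Or.inl ⟨i, rfl⟩)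
      have h2 := h (-b.coord i) (Or.inr ⟨i, rfl⟩)
      simp only [Basis.coord_apply, LinearMap.neg_apply] at h1 h2
      simpa using le_antisymm (by linarith) h1
  | insert g s _ ih =>
    obtain ⟨I, hI⟩ := ih
    obtain ⟨J, hJ⟩ := exists_finset_dual_add_ray I g
    refine ⟨J, fun x => ?_⟩
    rw [← hJ, Finset.coe_insert, PointedCone.hull, Submodule.mem_span_insert]
    constructor
    · rintro ⟨a, z, hz, rfl⟩
      refine ⟨a, a.2, (hI _).1 ?_⟩
      simpa using! hz
    · rintro ⟨t, ht, h⟩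
      exact ⟨⟨t, ht⟩, x - t • g, (hI _).2 h, by simp [Nonneg.mk_smul]⟩

/-- A system of inequalities with a strict solution contains one with the same solutions in which
each inequality is, at some solution, the only one with equality. -/
lemma exists_irredundant {W : Submodule ℚ E} {I : Finset (Dual ℚ E)} {x₀ : E} (hx₀ : x₀ ∈ W)
    (hpos : ∀ f ∈ I, 0 < f x₀) :
    ∃ J ⊆ I, (∀ x ∈ W, (∀ f ∈ J, 0 ≤ f x) → ∀ f ∈ I, 0 ≤ f x) ∧
      ∀ f ∈ J, ∃ w ∈ W, f w = 0 ∧ ∀ f' ∈ J, f' ≠ f → 0 < f' w := by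
  classical
  let P : Finset (Dual ℚ E) → Prop := fun J =>
    J ⊆ I ∧ ∀ x ∈ W, (∀ f ∈ J, 0 ≤ f x) → ∀ f ∈ I, 0 ≤ f x
  obtain ⟨J, hJ, hmin⟩ := (I.powerset.filter P).exists_min_image Finset.card
    ⟨I, Finset.mem_filter.2 ⟨Finset.mem_powerset_self _, subset_rfl, fun _ _ h => h⟩⟩
  obtain ⟨-, hJI, hJP⟩ := Finset.mem_filter.1 hJ
  refine ⟨J, hJI, hJP, fun f hf => ?_⟩
  have hnot : ¬ P (J.erase f) := fun h => by
    have := hmin _ (Finset.mem_filter.2 ⟨Finset.mem_powerset.2 h.1, h⟩)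
    exact absurd (Finset.card_erase_lt_of_mem hf) (not_lt.2 this)
  simp only [P, not_and, not_forall] at hnot
  obtain ⟨y, hyW, hy, f₀, hf₀, hneg⟩ := hnot ((Finset.erase_subset _ _).trans hJI)
  have hfy : f y < 0 := by
    by_contra! h
    refine hneg (hJP y hyW (fun f' hf' => ?_) f₀ hf₀)
    by_cases hff : f' = f
    · exact hff ▸ h
    · exact hy f' (Finset.mem_erase.2 ⟨hff, hf'⟩)
  have hfx := hpos f (hJI hf)
  refine ⟨f x₀ • y - f y • x₀, sub_mem (W.smul_mem _ hyW) (W.smul_mem _ hx₀), ?_, ?_⟩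
  · simp [mul_comm]
  · intro f' hf' hne
    have h1 := hy f' (Finset.mem_erase.2 ⟨hne, hf'⟩)
    have h2 := hpos f' (hJI hf')
    simp only [map_sub, map_smul, smul_eq_mul]
    nlinarith [mul_nonneg hfx.le h1, mul_pos (neg_pos.2 hfy) h2]

/-- A strict solution of a system of inequalities can be moved off finitely many hyperplanes. -/
lemma exists_generic {W : Submodule ℚ E} (I N : Finset (Dual ℚ E)) {x₀ : E} (hx₀ : x₀ ∈ W)
    (hpos : ∀ f ∈ I, 0 < f x₀) (hN : ∀ k ∈ N, ∃ w ∈ W, k w ≠ 0) :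
    ∃ x ∈ W, (∀ f ∈ I, 0 < f x) ∧ ∀ k ∈ N, k x ≠ 0 := by
  classical
  induction N using Finset.induction_on with
  | empty => exact ⟨x₀, hx₀, hpos, by simp⟩
  | insert k N _ ih =>
    obtain ⟨x, hxW, hxI, hxN⟩ := ih fun k hk => hN k (Finset.mem_insert_of_mem hk)
    obtain ⟨w, hwW, hkw⟩ := hN k (Finset.mem_insert_self _ _)
    have h1 : ∀ᶠ ε in 𝓝[>] (0 : ℚ), ∀ f ∈ I, 0 < f x + ε * f w :=
      (Finset.eventually_all I).2 fun f hf => eventually_pos_add_mul _ (hxI f hf)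
    have h2 : ∀ᶠ ε in 𝓝[>] (0 : ℚ), ∀ k' ∈ N, k' x + ε * k' w ≠ 0 :=
      (Finset.eventually_all N).2 fun f hf => eventually_ne_zero_add_mul _ (hxN f hf)
    have h3 : ∀ᶠ ε in 𝓝[>] (0 : ℚ), k x + ε * k w ≠ 0 := by
      by_cases hk : k x = 0
      · filter_upwards [self_mem_nhdsWithin] with ε hε
        rw [hk, zero_add]
        exact mul_ne_zero (ne_of_gt hε) hkw
      · exact eventually_ne_zero_add_mul _ hk
    obtain ⟨ε, h1, h2, h3⟩ := (h1.and (h2.and h3)).exists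
    refine ⟨x + ε • w, add_mem hxW (W.smul_mem _ hwW), fun f hf => by simpa using h1 f hf, ?_⟩
    intro k' hk'
    rcases Finset.mem_insert.1 hk' with rfl | hk'
    · simpa using h3
    · simpa using h2 k' hk'

/-- A cone with a strict interior point in `W` spans `W`. -/
lemma span_eq_of_pos {W : Submodule ℚ E} {I : Finset (Dual ℚ E)} {x₀ : E} (hx₀ : x₀ ∈ W)
    (hpos : ∀ f ∈ I, 0 < f x₀) {F : Set E} (hF : ∀ x, x ∈ F ↔ x ∈ W ∧ ∀ f ∈ I, 0 ≤ f x) :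
    Submodule.span ℚ F = W := by
  apply le_antisymm
  · exact Submodule.span_le.2 fun x hx => ((hF x).1 hx).1
  · intro v hv
    have h1 : ∀ᶠ ε in 𝓝[>] (0 : ℚ), ∀ f ∈ I, 0 < f x₀ + ε * f v :=
      (Finset.eventually_all I).2 fun f hf => eventually_pos_add_mul _ (hpos f hf)
    obtain ⟨ε, h1, hε⟩ := (h1.and self_mem_nhdsWithin).exists
    have hε' : (ε : ℚ) ≠ 0 := ne_of_gt hε
    have hx₀F : x₀ ∈ F := (hF _).2 ⟨hx₀, fun f hf => (hpos f hf).le⟩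
    have h2 : x₀ + ε • v ∈ F := (hF _).2 ⟨add_mem hx₀ (W.smul_mem _ hv), fun f hf => by
      simpa using (h1 f hf).le⟩
    have : v = ε⁻¹ • ((x₀ + ε • v) - x₀) := by
      rw [add_sub_cancel_left, smul_smul, inv_mul_cancel₀ hε', one_smul]
    rw [this]
    exact Submodule.smul_mem _ _ (sub_mem (Submodule.subset_span h2) (Submodule.subset_span hx₀F))

/-- The part of the boundary of `F` that is seen when looking in the direction `p`: the points
from which a move by `-p` leaves `F` at once. -/
def visible (F : Set E) (p : E) : Set E := {x ∈ F | ∀ ε : ℚ, 0 < ε → x - ε • p ∉ F}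

lemma mem_visible_iff {W : Submodule ℚ E} {I : Finset (Dual ℚ E)} {F : Set E}
    (hF : ∀ x, x ∈ F ↔ x ∈ W ∧ ∀ f ∈ I, 0 ≤ f x) {p : E} (hp : p ∈ W) {x : E} :
    x ∈ visible F p ↔ x ∈ F ∧ ∃ f ∈ I, f x = 0 ∧ 0 < f p := by
  refine and_congr_right fun hx => ⟨fun h => ?_, ?_⟩
  · by_contra! hcon
    have h1 : ∀ᶠ ε in 𝓝[>] (0 : ℚ), ∀ f ∈ I, 0 ≤ f x + ε * -f p := by
      refine (Finset.eventually_all I).2 fun f hf => ?_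
      rcases (((hF x).1 hx).2 f hf).eq_or_lt with h0 | h0
      · filter_upwards [self_mem_nhdsWithin] with ε hε
        rw [← h0, zero_add]
        exact mul_nonneg (le_of_lt hε) (by linarith [hcon f hf h0.symm])
      · filter_upwards [eventually_pos_add_mul (-f p) h0] with ε hε using hε.le
    obtain ⟨ε, h1, hε⟩ := (h1.and self_mem_nhdsWithin).exists
    refine h ε hε ((hF _).2 ⟨sub_mem ((hF x).1 hx).1 (W.smul_mem _ hp), fun f hf => ?_⟩)
    have := h1 f hf
    simp only [map_sub, map_smul, smul_eq_mul]
    linarith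
  · rintro ⟨f, hf, hfx, hfp⟩ ε hε hmem
    have := ((hF _).1 hmem).2 f hf
    simp only [map_sub, map_smul, smul_eq_mul, hfx, zero_sub] at this
    nlinarith [mul_pos hε hfp]

lemma finrank_inf_ker [FiniteDimensional ℚ E] {W : Submodule ℚ E} {f : Dual ℚ E} {x : E}
    (hx : x ∈ W) (hfx : f x ≠ 0) :
    finrank ℚ (W ⊓ LinearMap.ker f : Submodule ℚ E) + 1 = finrank ℚ W := by
  have h : (f.domRestrict W) ≠ 0 := fun h => hfx (by
    simpa using LinearMap.congr_fun h ⟨x, hx⟩)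
  rw [← Module.Dual.finrank_ker_add_one_of_ne_zero (f := f.domRestrict W) h,
    ← Submodule.map_comap_subtype, Submodule.finrank_map_subtype_eq]
  rfl

/-- The induction that orders the visible facets of a polyhedral cone by sweeping a hyperplane
section along a line. `D k Z` stands for a property of "depth at least `k`" of a union `Z` of faces
that behaves well along Mayer–Vietoris sequences. If it holds, with `k = dim G`, for all visible
faces `G` not contained in the boundary of the visible part, then it holds for the whole visible
part. The faces are cut out of a fixed cone `K` by functionals `g` that are nonnegative on `K`. -/
theorem sweep [FiniteDimensional ℚ E] {K : Set E} {D : ℕ → Set E → Prop} {S : Set E → Prop}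
    (hD0 : ∀ Z, D 0 Z) (hDempty : ∀ k, D k ∅)
    (hDunion : ∀ k Z Z', S Z → S Z' → D (k + 1) Z → D (k + 1) Z' → D k (Z ∩ Z') →
      D (k + 1) (Z ∪ Z'))
    (hSempty : S ∅) (hSunion : ∀ Z Z', S Z → S Z' → S (Z ∪ Z'))
    (hSface : ∀ g : Dual ℚ E, (∀ x ∈ K, 0 ≤ g x) → S {x ∈ K | g x = 0})
    (r : ℕ) (W : Submodule ℚ E) (hW : finrank ℚ W = r + 1) (g : Dual ℚ E)
    (hg : ∀ x ∈ K, 0 ≤ g x) (I : Finset (Dual ℚ E)) (hI : ∀ f ∈ I, ∀ x ∈ K, 0 ≤ f x)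
    (hF : ∀ x, x ∈ {x ∈ K | g x = 0} ↔ x ∈ W ∧ ∀ f ∈ I, 0 ≤ f x)
    (x₀ : E) (hx₀ : x₀ ∈ W) (hpos : ∀ f ∈ I, 0 < f x₀) (p : E) (hp : p ∈ W)
    (H : ∀ g' : Dual ℚ E, (∀ x ∈ K, 0 ≤ g' x) → 0 < g' p → (∀ x ∈ K, g' x = 0 → g x = 0) →
      (∀ f : Dual ℚ E, (∀ x ∈ K, g x = 0 → 0 ≤ f x) → (∀ x ∈ K, g' x = 0 → f x = 0) →
        (∃ x ∈ W, f x ≠ 0) → 0 < f p) →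
      D (finrank ℚ (Submodule.span ℚ {x ∈ K | g' x = 0})) {x ∈ K | g' x = 0}) :
    D r (visible {x ∈ K | g x = 0} p) := by
  classical
  induction r generalizing W g I x₀ p with
  | zero => exact hD0 _
  | succ r ih =>
    obtain ⟨J, hJI, hJ, hirr⟩ := exists_irredundant hx₀ hpos
    replace hF : ∀ x, x ∈ {x ∈ K | g x = 0} ↔ x ∈ W ∧ ∀ f ∈ J, 0 ≤ f x := fun x =>
      (hF x).trans (and_congr_right fun hx => ⟨fun h f hf => h f (hJI hf), hJ x hx⟩)
    replace hI : ∀ f ∈ J, ∀ x ∈ K, 0 ≤ f x := fun f hf => hI f (hJI hf)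
    replace hpos : ∀ f ∈ J, 0 < f x₀ := fun f hf => hpos f (hJI hf)
    clear hJ hJI
    let vis := J.filter fun f => 0 < f p
    -- a generic line in the direction `p` meets the hyperplanes of the visible facets at
    -- pairwise different times `t f`
    obtain ⟨x₁, hx₁, hpos₁, hgen⟩ := exists_generic J
      (Finset.image₂ (fun f f' : Dual ℚ E => if f = f' then f else f' p • f - f p • f') vis vis)
      hx₀ hpos (by
        intro k hk
        obtain ⟨f, hf, f', hf', rfl⟩ := Finset.mem_image₂.1 hk
        obtain ⟨hfJ, hfp⟩ := Finset.mem_filter.1 hf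
        obtain ⟨hfJ', hfp'⟩ := Finset.mem_filter.1 hf'
        split_ifs with h
        · exact ⟨x₀, hx₀, (hpos f hfJ).ne'⟩
        · obtain ⟨w, hw, hfw, hw'⟩ := hirr f hfJ
          refine ⟨w, hw, ?_⟩
          simp only [LinearMap.sub_apply, LinearMap.smul_apply, smul_eq_mul, hfw, mul_zero,
            zero_sub, neg_ne_zero]
          exact (mul_pos hfp (hw' f' hfJ' (Ne.symm h))).ne')
    let t : Dual ℚ E → ℚ := fun f => f x₁ / f p
    have ht : ∀ f ∈ vis, ∀ f' ∈ vis, t f = t f' → f = f' := by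
      intro f hf f' hf' heq
      by_contra hne
      have h := hgen _ (Finset.mem_image₂_of_mem hf hf')
      rw [if_neg hne] at h
      have h1 := (Finset.mem_filter.1 hf).2.ne'
      have h2 := (Finset.mem_filter.1 hf').2.ne'
      rw [div_eq_div_iff h1 h2] at heq
      apply h
      simp only [LinearMap.sub_apply, LinearMap.smul_apply, smul_eq_mul]
      linarith
    let facet : Dual ℚ E → Set E := fun f => {x ∈ K | (g + f) x = 0}
    have hgf : ∀ f ∈ J, ∀ x ∈ K, 0 ≤ (g + f) x := fun f hf x hx => add_nonneg (hg x hx) (hI f hf x hx)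
    have hfacet : ∀ f ∈ J, ∀ x, x ∈ facet f ↔ x ∈ {x ∈ K | g x = 0} ∧ f x = 0 := by
      intro f hf x
      simp only [facet, Set.mem_ofPred_eq, LinearMap.add_apply, and_assoc]
      refine and_congr_right fun hx => ?_
      rw [add_eq_zero_iff_of_nonneg (hg x hx) (hI f hf x hx)]
    have hfacet' : ∀ f ∈ J, ∀ x, x ∈ facet f ↔
        x ∈ W ⊓ LinearMap.ker f ∧ ∀ f' ∈ J.erase f, 0 ≤ f' x := by
      intro f hf x
      rw [hfacet f hf, hF, Submodule.mem_inf, LinearMap.mem_ker]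
      constructor
      · rintro ⟨⟨h1, h2⟩, h3⟩
        exact ⟨⟨h1, h3⟩, fun f' hf' => h2 f' (Finset.mem_of_mem_erase hf')⟩
      · rintro ⟨⟨h1, h3⟩, h2⟩
        refine ⟨⟨h1, fun f' hf' => ?_⟩, h3⟩
        by_cases h : f' = f
        · rw [h, h3]
        · exact h2 f' (Finset.mem_erase.2 ⟨h, hf'⟩)
    -- a functional that vanishes on the facet of `f` is a multiple of `f`
    have hmult : ∀ f ∈ vis, ∀ f' : Dual ℚ E, (∀ x ∈ K, g x = 0 → 0 ≤ f' x) →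
        (∀ x ∈ W ⊓ LinearMap.ker f, f' x = 0) → (∃ x ∈ W, f' x ≠ 0) → 0 < f' p := by
      intro f hf f' hnn hker hne
      obtain ⟨hfJ, hfp⟩ := Finset.mem_filter.1 hf
      have hfx := hpos f hfJ
      have hscale : ∀ y ∈ W, f' y * f x₀ = f y * f' x₀ := by
        intro y hy
        have := hker (f x₀ • y - f y • x₀) ⟨sub_mem (W.smul_mem _ hy) (W.smul_mem _ hx₀), by
          simp [mul_comm]⟩
        simp only [map_sub, map_smul, smul_eq_mul] at this
        linarith
      have hx₀F := (hF x₀).2 ⟨hx₀, fun f hf => (hpos f hf).le⟩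
      have h0 : 0 < f' x₀ := by
        refine lt_of_le_of_ne (hnn x₀ hx₀F.1 hx₀F.2) fun h => ?_
        obtain ⟨y, hy, hfy⟩ := hne
        have := hscale y hy
        rw [← h, mul_zero] at this
        exact hfy ((mul_eq_zero.1 this).resolve_right hfx.ne')
      have := hscale p hp
      have h1 : 0 < f' p * f x₀ := this ▸ mul_pos hfp h0
      exact (pos_iff_pos_of_mul_pos h1).2 hfx
    have hspan : ∀ f ∈ J, Submodule.span ℚ (facet f) = W ⊓ LinearMap.ker f := by
      intro f hf
      obtain ⟨w, hw, hfw, hw'⟩ := hirr f hf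
      exact span_eq_of_pos (W := W ⊓ LinearMap.ker f) (x₀ := w) ⟨hw, hfw⟩
        (fun f' hf' => hw' f' (Finset.mem_of_mem_erase hf') (Finset.ne_of_mem_erase hf'))
        (hfacet' f hf)
    have hrank : ∀ f ∈ J, finrank ℚ (W ⊓ LinearMap.ker f : Submodule ℚ E) = r + 1 := by
      intro f hf
      have := finrank_inf_ker hx₀ (hpos f hf).ne'
      omega
    have hDfacet : ∀ f ∈ vis, D (r + 1) (facet f) := by
      intro f hf
      obtain ⟨hfJ, hfp⟩ := Finset.mem_filter.1 hf
      have hgp : g p = 0 := by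
        have : p ∈ Submodule.span ℚ {x ∈ K | g x = 0} := by
          rw [span_eq_of_pos hx₀ hpos hF]; exact hp
        have hle : Submodule.span ℚ {x ∈ K | g x = 0} ≤ LinearMap.ker g :=
          Submodule.span_le.2 fun x hx => hx.2
        exact hle this
      have := H (g + f) (hgf f hfJ) (by simpa [hgp] using hfp)
        (fun x hx h => ((hfacet f hfJ x).1 ⟨hx, h⟩).1.2)
        (fun f' hnn hz hne => hmult f hf f' hnn (fun x hx => ?_) hne)
      · rwa [hspan f hfJ, hrank f hfJ] at this
      · rw [← hspan f hfJ] at hx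
        exact (Submodule.span_le.2 fun x hx => hz x hx.1 hx.2 :
          Submodule.span ℚ (facet f) ≤ LinearMap.ker f') hx
    -- initial segments of the visible facets
    have key : ∀ s : Finset (Dual ℚ E), s ⊆ vis → (∀ f ∈ s, ∀ f' ∈ vis, t f' < t f → f' ∈ s) →
        S (⋃ f ∈ s, facet f) ∧ D (r + 1) (⋃ f ∈ s, facet f) := by
      intro s
      induction s using Finset.induction_on_max_value t with
      | empty => simpa using ⟨hSempty, hDempty _⟩
      | insert f s hfs hmax ihs =>
        intro hsub hinit
        have hfv : f ∈ vis := hsub (Finset.mem_insert_self _ _)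
        obtain ⟨hfJ, hfp⟩ := Finset.mem_filter.1 hfv
        obtain ⟨hS, hDs⟩ := ihs (fun f' hf' => hsub (Finset.mem_insert_of_mem hf')) (by
          intro f₁ hf₁ f₂ hf₂ hlt
          rcases Finset.mem_insert.1 (hinit f₁ (Finset.mem_insert_of_mem hf₁) f₂ hf₂ hlt) with h | h
          · exact absurd (hmax f₁ hf₁) (not_le.2 (h ▸ hlt))
          · exact h)
        have hs : ∀ f', f' ∈ s ↔ f' ∈ vis ∧ t f' < t f := by
          intro f'
          refine ⟨fun h => ⟨hsub (Finset.mem_insert_of_mem h), lt_of_le_of_ne (hmax f' h)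
            fun he => ?_⟩, fun ⟨h1, h2⟩ => ?_⟩
          · exact hfs (ht f' (hsub (Finset.mem_insert_of_mem h)) f hfv he ▸ h)
          · rcases Finset.mem_insert.1 (hinit f (Finset.mem_insert_self _ _) f' h1 h2) with h | h
            · exact absurd h2 (by rw [h]; exact lt_irrefl _)
            · exact h
        have htpos : 0 < t f := div_pos (hpos₁ f hfJ) hfp
        -- the point where the line crosses the hyperplane of `f`
        let z := x₁ - t f • p
        have hfz : f z = 0 := by
          simp only [z, t, map_sub, map_smul, smul_eq_mul]
          field_simp
          simp
        have hz : z ∈ W ⊓ LinearMap.ker f := ⟨sub_mem hx₁ (W.smul_mem _ hp), hfz⟩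
        have hinter : (⋃ f' ∈ s, facet f') ∩ facet f = visible (facet f) (-z) := by
          ext x
          rw [mem_visible_iff (hfacet' f hfJ) (neg_mem hz), Set.mem_inter_iff, and_comm]
          refine and_congr_right fun hx => ?_
          simp only [Set.mem_iUnion, exists_prop]
          refine exists_congr fun f' => ?_
          have hval : f' (-z) = t f * f' p - f' x₁ := by simp [z]
          constructor
          · rintro ⟨hf's, hx'⟩
            obtain ⟨hf'v, hlt⟩ := (hs f').1 hf's
            obtain ⟨hf'J, hf'p⟩ := Finset.mem_filter.1 hf'v
            refine ⟨Finset.mem_erase.2 ⟨fun h => hfs (h ▸ hf's), hf'J⟩,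
              ((hfacet f' hf'J x).1 hx').2, ?_⟩
            rw [hval]
            have := (div_lt_iff₀ hf'p).1 hlt
            linarith
          · rintro ⟨hf'e, hf'x, hf'z⟩
            have hf'J := Finset.mem_of_mem_erase hf'e
            have h1 := hpos₁ f' hf'J
            rw [hval] at hf'z
            have hf'p : 0 < f' p := by
              by_contra! hcon
              nlinarith [mul_nonneg htpos.le (neg_nonneg.2 hcon)]
            refine ⟨(hs f').2 ⟨Finset.mem_filter.2 ⟨hf'J, hf'p⟩, (div_lt_iff₀ hf'p).2
              (by linarith)⟩, (hfacet f' hf'J x).2 ⟨((hfacet f hfJ x).1 hx).1, hf'x⟩⟩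
        have hDinter : D r (visible (facet f) (-z)) := by
          obtain ⟨w, hw, hfw, hw'⟩ := hirr f hfJ
          refine ih (W ⊓ LinearMap.ker f) (hrank f hfJ) (g + f) (hgf f hfJ) (J.erase f)
            (fun f' hf' => hI f' (Finset.mem_of_mem_erase hf')) (hfacet' f hfJ) w ⟨hw, hfw⟩
            (fun f' hf' => hw' f' (Finset.mem_of_mem_erase hf') (Finset.ne_of_mem_erase hf')) (-z)
            (neg_mem hz) ?_
          intro g' hg' hg'z hle hint
          have hx₁F := (hF x₁).2 ⟨hx₁, fun f hf => (hpos₁ f hf).le⟩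
          -- positivity at `-z = t p - x₁` forces positivity at `p`
          have hpz : ∀ φ : Dual ℚ E, 0 ≤ φ x₁ → 0 < φ (-z) → 0 < φ p := by
            intro φ h1 h2
            have hval : φ (-z) = t f * φ p - φ x₁ := by simp [z]
            rw [hval] at h2
            by_contra! hcon
            nlinarith [mul_nonneg htpos.le (neg_nonneg.2 hcon)]
          refine H g' hg' (hpz g' (hg' x₁ hx₁F.1) hg'z)
            (fun x hx h => ((hfacet f hfJ x).1 ⟨hx, hle x hx h⟩).1.2) fun φ hnn hφ hne => ?_
          by_cases hW' : ∃ x ∈ W ⊓ LinearMap.ker f, φ x ≠ 0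
          · exact hpz φ (hnn x₁ hx₁F.1 hx₁F.2) (hint φ (fun x hx h =>
              hnn x hx ((hfacet f hfJ x).1 ⟨hx, h⟩).1.2) hφ hW')
          · push Not at hW'
            exact hmult f hfv φ hnn hW' hne
        have hunion : (⋃ f' ∈ insert f s, facet f') = (⋃ f' ∈ s, facet f') ∪ facet f := by
          rw [Finset.set_biUnion_insert, Set.union_comm]
        rw [hunion]
        have hSf := hSface (g + f) (hgf f hfJ)
        exact ⟨hSunion _ _ hS hSf, hDunion r _ _ hS hSf hDs (hDfacet f hfv) (hinter ▸ hDinter)⟩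
    have hvis : visible {x ∈ K | g x = 0} p = ⋃ f ∈ vis, facet f := by
      ext x
      rw [mem_visible_iff hF hp]
      simp only [Set.mem_iUnion, exists_prop]
      constructor
      · rintro ⟨hx, f, hf, hfx, hfp⟩
        exact ⟨f, Finset.mem_filter.2 ⟨hf, hfp⟩, (hfacet f hf x).2 ⟨hx, hfx⟩⟩
      · rintro ⟨f, hf, hx⟩
        obtain ⟨hfJ, hfp⟩ := Finset.mem_filter.1 hf
        obtain ⟨h1, h2⟩ := (hfacet f hfJ x).1 hx
        exact ⟨h1, f, hfJ, h2, hfp⟩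
    rw [hvis]
    exact (key vis subset_rfl fun _ _ _ h _ => h).2

end Cones

end ToricGr

namespace ToricGr

/-! ### The epigraph cone and its lower faces -/

noncomputable section Epigraph

open Module Filter Topology

variable {d n : ℕ} (A : Matrix (Fin d) (Fin n) ℤ) (w : Fin n → ℕ)

/-- The `j`-th column of `A`, lifted to the height given by its weight. -/
def gen (j : Fin n) : (Fin d → ℚ) × ℚ := (column A j, w j)

/-- The vertical direction. -/
def apex (d : ℕ) : (Fin d → ℚ) × ℚ := (0, 1)

/-- The cone spanned by the lifted columns and the vertical direction. It is the epigraph of the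
Newton function of `A` with weights `w`. -/
def epigraph : PointedCone ℚ ((Fin d → ℚ) × ℚ) :=
  PointedCone.hull ℚ (insert (apex d) (Set.range (gen A w)))

lemma exists_ineqs : ∃ I : Finset (Dual ℚ ((Fin d → ℚ) × ℚ)),
    ∀ x, x ∈ epigraph A w ↔ ∀ f ∈ I, 0 ≤ f x := by
  classical
  obtain ⟨I, hI⟩ := exists_finset_dual_hull (insert (apex d) (Finset.univ.image (gen A w)))
  exact ⟨I, fun x => by rw [← hI, epigraph]; simp⟩

/-- A finite system of linear inequalities for the epigraph cone. -/
def ineqs : Finset (Dual ℚ ((Fin d → ℚ) × ℚ)) := (exists_ineqs A w).choose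

variable {A w}

lemma mem_epigraph_iff {x : (Fin d → ℚ) × ℚ} : x ∈ epigraph A w ↔ ∀ f ∈ ineqs A w, 0 ≤ f x :=
  (exists_ineqs A w).choose_spec x

lemma apex_mem_epigraph : apex d ∈ epigraph A w :=
  PointedCone.subset_hull (Set.mem_insert _ _)

lemma gen_mem_epigraph (j : Fin n) : gen A w j ∈ epigraph A w :=
  PointedCone.subset_hull (Set.mem_insert_of_mem _ ⟨j, rfl⟩)

lemma smul_mem_epigraph {x : (Fin d → ℚ) × ℚ} {c : ℚ} (hc : 0 ≤ c) (hx : x ∈ epigraph A w) :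
    c • x ∈ epigraph A w :=
  (epigraph A w).smul_mem hc hx

lemma exists_eq_sum_of_mem_epigraph {x : (Fin d → ℚ) × ℚ} (hx : x ∈ epigraph A w) :
    ∃ (c : Fin n → ℚ) (t : ℚ), (∀ j, 0 ≤ c j) ∧ 0 ≤ t ∧
      x = ∑ j, c j • gen A w j + t • apex d := by
  induction hx using Submodule.span_induction with
  | mem x hx =>
    rcases hx with rfl | ⟨j, rfl⟩
    · exact ⟨0, 1, fun _ => le_rfl, zero_le_one, by simp⟩
    · refine ⟨Pi.single j 1, 0, fun i => ?_, le_rfl, by simp [Pi.single_apply]⟩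
      by_cases h : i = j
      · subst h; simp
      · simp [h]
  | zero => exact ⟨0, 0, fun _ => le_rfl, le_rfl, by simp⟩
  | add x y _ _ hx hy =>
    obtain ⟨c, t, hc, ht, rfl⟩ := hx
    obtain ⟨c', t', hc', ht', rfl⟩ := hy
    refine ⟨c + c', t + t', fun j => add_nonneg (hc j) (hc' j), add_nonneg ht ht', ?_⟩
    simp only [Pi.add_apply, add_smul, Finset.sum_add_distrib]
    abel
  | smul a x _ hx =>
    obtain ⟨c, t, hc, ht, rfl⟩ := hx
    refine ⟨fun j => a * c j, a * t, fun j => mul_nonneg a.2 (hc j), mul_nonneg a.2 ht, ?_⟩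
    rw [smul_add, Finset.smul_sum]
    simp only [mul_smul]
    rfl

lemma snd_nonneg_of_mem_epigraph {x : (Fin d → ℚ) × ℚ} (hx : x ∈ epigraph A w) : 0 ≤ x.2 := by
  obtain ⟨c, t, hc, ht, rfl⟩ := exists_eq_sum_of_mem_epigraph hx
  simp only [Prod.snd_add, Prod.snd_sum, Prod.smul_snd, gen, apex, smul_eq_mul, mul_one]
  exact add_nonneg (Finset.sum_nonneg fun j _ => mul_nonneg (hc j) (Nat.cast_nonneg _)) ht

variable (A) in
/-- The element of the semigroup with a given vector of multiplicities of the columns. -/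
def deg : (Fin n →₀ ℕ) →+ semigroup A :=
  (Finsupp.weight A.col).codRestrict (semigroup A) fun u => by
    simp only [Finsupp.weight_apply, Finsupp.sum]
    refine sum_mem fun j _ => nsmul_mem ?_ _
    exact AddSubmonoid.subset_closure (Set.mem_range_self j)

lemma coe_deg (u : Fin n →₀ ℕ) : (deg A u : Fin d → ℤ) = Finsupp.weight A.col u := rfl

lemma deg_surjective : Function.Surjective (deg A) := by
  rintro ⟨a, ha⟩
  induction ha using AddSubmonoid.closure_induction with
  | mem x hx =>
    obtain ⟨j, rfl⟩ := hx
    exact ⟨Finsupp.single j 1, Subtype.ext (by simp [coe_deg, Finsupp.weight_single])⟩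
  | zero => exact ⟨0, by ext; simp⟩
  | add x y hx hy ihx ihy =>
    obtain ⟨u, hu⟩ := ihx
    obtain ⟨v, hv⟩ := ihy
    exact ⟨u + v, by rw [map_add, hu, hv]; rfl⟩

variable (A w) in
/-- The filtration order of an element `a` of the semigroup: the least weight of a monomial of
degree `a`. -/
def ord (a : semigroup A) : ℕ := sInf {k | ∃ u, deg A u = a ∧ Finsupp.weight w u = k}

lemma exists_weight_eq_ord (a : semigroup A) : ∃ u, deg A u = a ∧ Finsupp.weight w u = ord A w a :=
  Nat.sInf_mem (s := {k | ∃ u, deg A u = a ∧ Finsupp.weight w u = k}) <| by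
    obtain ⟨u, hu⟩ := deg_surjective a
    exact ⟨_, u, hu, rfl⟩

lemma ord_deg_le (u : Fin n →₀ ℕ) : ord A w (deg A u) ≤ Finsupp.weight w u :=
  Nat.sInf_le ⟨u, rfl, rfl⟩

lemma ord_add_le (a b : semigroup A) : ord A w (a + b) ≤ ord A w a + ord A w b := by
  obtain ⟨u, rfl, hu⟩ := exists_weight_eq_ord (w := w) a
  obtain ⟨v, rfl, hv⟩ := exists_weight_eq_ord (w := w) b
  rw [← hu, ← hv, ← map_add, ← map_add]
  exact ord_deg_le _

lemma ord_zero : ord A w 0 = 0 := by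
  have := ord_deg_le (A := A) (w := w) 0
  simpa using this

lemma ord_pos (hw : ∀ j, 0 < w j) {a : semigroup A} (ha : a ≠ 0) : 0 < ord A w a := by
  obtain ⟨u, rfl, hu⟩ := exists_weight_eq_ord (w := w) a
  rw [← hu, Nat.pos_iff_ne_zero]
  intro h0
  apply ha
  have : u = 0 := by
    ext j
    rw [Finsupp.weight_apply, Finsupp.sum_fintype _ _ (by simp)] at h0
    have := (Finset.sum_eq_zero_iff.1 h0) j (Finset.mem_univ _)
    simpa [(hw j).ne'] using this
  rw [this, map_zero]

variable (A w) in
open Classical in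
/-- The Newton function: the least height of a point of the epigraph cone above `a`, computed from
the inequalities that are not vertical. -/
def newton (a : semigroup A) : ℚ :=
  if h : ((ineqs A w).filter fun f => 0 < f (apex d)).Nonempty then
    ((ineqs A w).filter fun f => 0 < f (apex d)).sup' h
      fun f => -f ((fun i => ((a : Fin d → ℤ) i : ℚ)), 0) / f (apex d)
  else 0

variable (A w) in
/-- The point above `a` on the graph of the Newton function. -/
def point (a : semigroup A) : (Fin d → ℚ) × ℚ :=
  ((fun i => ((a : Fin d → ℤ) i : ℚ)), newton A w a)

lemma weight_gen (u : Fin n →₀ ℕ) : Finsupp.weight (gen A w) u =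
    ((fun i => ((deg A u : Fin d → ℤ) i : ℚ)), (Finsupp.weight w u : ℚ)) := by
  simp only [coe_deg, Finsupp.weight_apply, Finsupp.sum_fintype, zero_smul, implies_true]
  ext i
  · simp [gen, column, Prod.fst_sum, Matrix.col]
  · simp [gen, Prod.snd_sum]

lemma weight_gen_mem_epigraph (u : Fin n →₀ ℕ) : Finsupp.weight (gen A w) u ∈ epigraph A w := by
  rw [Finsupp.weight_apply]
  exact sum_mem fun j _ => nsmul_mem (gen_mem_epigraph j) _

lemma eq_add_smul_apex (x : Fin d → ℚ) (s : ℚ) : (x, s) = (x, 0) + s • apex d := by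
  ext <;> simp [apex]

lemma exists_ineq_apex_pos : ∃ f ∈ ineqs A w, 0 < f (apex d) := by
  have h : -apex d ∉ epigraph A w := fun h => by
    have := snd_nonneg_of_mem_epigraph h
    simp [apex] at this
    linarith
  rw [mem_epigraph_iff] at h
  push Not at h
  obtain ⟨f, hf, h⟩ := h
  exact ⟨f, hf, by simpa using h⟩

lemma newton_le {a : semigroup A} {s : ℚ}
    (h : ((fun i => ((a : Fin d → ℤ) i : ℚ)), s) ∈ epigraph A w) : newton A w a ≤ s := by
  obtain ⟨f₀, hf₀, hpos₀⟩ := exists_ineq_apex_pos (A := A) (w := w)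
  rw [newton, dif_pos ⟨f₀, Finset.mem_filter.2 ⟨hf₀, hpos₀⟩⟩]
  refine Finset.sup'_le _ _ fun f hf => ?_
  obtain ⟨hf, hpos⟩ := Finset.mem_filter.1 hf
  have := mem_epigraph_iff.1 h f hf
  rw [eq_add_smul_apex, map_add, map_smul, smul_eq_mul] at this
  rw [div_le_iff₀ hpos]
  linarith

lemma le_newton {a : semigroup A} {f : Dual ℚ ((Fin d → ℚ) × ℚ)} (hf : f ∈ ineqs A w)
    (hpos : 0 < f (apex d)) :
    -f ((fun i => ((a : Fin d → ℤ) i : ℚ)), 0) / f (apex d) ≤ newton A w a := by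
  classical
  rw [newton, dif_pos ⟨f, Finset.mem_filter.2 ⟨hf, hpos⟩⟩]
  exact Finset.le_sup' (fun f : Dual ℚ ((Fin d → ℚ) × ℚ) =>
    -f ((fun i => ((a : Fin d → ℤ) i : ℚ)), 0) / f (apex d)) (Finset.mem_filter.2 ⟨hf, hpos⟩)

lemma exists_newton_eq (a : semigroup A) : ∃ f ∈ ineqs A w, 0 < f (apex d) ∧
    newton A w a = -f ((fun i => ((a : Fin d → ℤ) i : ℚ)), 0) / f (apex d) := by
  classical
  obtain ⟨f₀, hf₀, hpos₀⟩ := exists_ineq_apex_pos (A := A) (w := w)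
  have hne : ((ineqs A w).filter fun f => 0 < f (apex d)).Nonempty :=
    ⟨f₀, Finset.mem_filter.2 ⟨hf₀, hpos₀⟩⟩
  rw [newton, dif_pos hne]
  obtain ⟨f, hf, h⟩ := Finset.exists_mem_eq_sup' hne
    (fun f : Dual ℚ ((Fin d → ℚ) × ℚ) => -f ((fun i => ((a : Fin d → ℤ) i : ℚ)), 0) / f (apex d))
  obtain ⟨hf, hpos⟩ := Finset.mem_filter.1 hf
  exact ⟨f, hf, hpos, h⟩

lemma point_mem_epigraph (a : semigroup A) : point A w a ∈ epigraph A w := by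
  obtain ⟨u, rfl⟩ := deg_surjective a
  have hu := weight_gen_mem_epigraph (A := A) (w := w) u
  rw [weight_gen] at hu
  rw [mem_epigraph_iff] at hu ⊢
  intro f hf
  have h1 := hu f hf
  have h2 := mem_epigraph_iff.1 apex_mem_epigraph f hf
  rw [point, eq_add_smul_apex, map_add, map_smul, smul_eq_mul]
  rw [eq_add_smul_apex, map_add, map_smul, smul_eq_mul] at h1
  rcases h2.eq_or_lt with h0 | h0
  · rw [← h0] at h1 ⊢
    linarith
  · have := le_newton (a := deg A u) hf h0
    rw [div_le_iff₀ h0] at this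
    linarith

lemma exists_lower_point (a : semigroup A) :
    ∃ f ∈ ineqs A w, 0 < f (apex d) ∧ f (point A w a) = 0 := by
  obtain ⟨f, hf, hpos, h⟩ := exists_newton_eq (w := w) a
  refine ⟨f, hf, hpos, ?_⟩
  rw [point, eq_add_smul_apex, map_add, map_smul, smul_eq_mul, h]
  field_simp
  simp

lemma newton_nonneg (a : semigroup A) : 0 ≤ newton A w a := by
  have h := snd_nonneg_of_mem_epigraph (point_mem_epigraph (w := w) a)
  simpa only [point] using h

lemma newton_zero : newton A w 0 = 0 := by
  refine le_antisymm (newton_le ?_) (newton_nonneg 0)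
  convert zero_mem (epigraph A w) using 1
  ext <;> simp

lemma newton_add_le (a b : semigroup A) :
    newton A w (a + b) ≤ newton A w a + newton A w b := by
  refine newton_le ?_
  convert add_mem (point_mem_epigraph (w := w) a) (point_mem_epigraph (w := w) b) using 1
  ext <;> simp [point]

lemma newton_le_ord (a : semigroup A) : newton A w a ≤ ord A w a := by
  obtain ⟨u, rfl, hu⟩ := exists_weight_eq_ord (w := w) a
  refine newton_le ?_
  rw [← hu, ← weight_gen]
  exact weight_gen_mem_epigraph u

lemma point_add {a b : semigroup A} (h : newton A w a + newton A w b = newton A w (a + b)) :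
    point A w (a + b) = point A w a + point A w b := by
  ext <;> simp [point, h]

/-- The Newton function takes values in the multiples of a fixed unit fraction. -/
lemma exists_newton_scale (A : Matrix (Fin d) (Fin n) ℤ) (w : Fin n → ℕ) :
    ∃ M : ℕ, 0 < M ∧ ∀ a, ∃ k : ℕ, M * newton A w a = k := by
  classical
  let q : Dual ℚ ((Fin d → ℚ) × ℚ) → Fin d → ℚ := fun f i => -f (Pi.single i 1, 0) / f (apex d)
  let M := ∏ f ∈ ineqs A w, ∏ i, (q f i).den
  have hM : 0 < M := Finset.prod_pos fun f _ => Finset.prod_pos fun i _ => (q f i).den_pos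
  refine ⟨M, hM, fun a => ?_⟩
  obtain ⟨f, hf, hpos, h⟩ := exists_newton_eq (w := w) a
  have hint : ∀ i, ∃ z : ℤ, (M : ℚ) * q f i = z := by
    intro i
    obtain ⟨c, hc⟩ : (q f i).den ∣ M :=
      (Finset.dvd_prod_of_mem (fun i => (q f i).den) (Finset.mem_univ i)).trans
        (Finset.dvd_prod_of_mem (fun f => ∏ i, (q f i).den) hf)
    refine ⟨c * (q f i).num, ?_⟩
    rw [hc]
    push_cast
    have := Rat.mul_den_eq_num (q f i)
    linear_combination (c : ℚ) * this
  choose z hz using hint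
  have hval : newton A w a = ∑ i, ((a : Fin d → ℤ) i : ℚ) * q f i := by
    have hx : ((fun i => ((a : Fin d → ℤ) i : ℚ)), (0 : ℚ)) =
        ∑ i, ((a : Fin d → ℤ) i : ℚ) • ((Pi.single i 1, 0) : (Fin d → ℚ) × ℚ) := by
      ext i
      · simp [Prod.fst_sum, Finset.sum_apply, Pi.single_apply]
      · simp [Prod.snd_sum]
    rw [h, hx, map_sum, ← Finset.sum_neg_distrib, Finset.sum_div]
    refine Finset.sum_congr rfl fun i _ => ?_
    rw [map_smul, smul_eq_mul]
    simp only [q]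
    ring
  have hZ : (M : ℚ) * newton A w a = ((∑ i, (a : Fin d → ℤ) i * z i : ℤ) : ℚ) := by
    rw [hval, Finset.mul_sum]
    push_cast
    refine Finset.sum_congr rfl fun i _ => ?_
    rw [← hz]; ring
  have hnn : 0 ≤ ∑ i, (a : Fin d → ℤ) i * z i := by
    have : (0 : ℚ) ≤ M * newton A w a := mul_nonneg (Nat.cast_nonneg _) (newton_nonneg a)
    rw [hZ] at this
    exact_mod_cast this
  obtain ⟨k, hk⟩ := Int.eq_ofNat_of_zero_le hnn
  exact ⟨k, by rw [hZ, hk]; simp⟩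

variable (A w) in
/-- A functional that is nonnegative on the epigraph cone and positive on the vertical direction;
its zeros on the cone form a lower face. -/
structure IsLower (g : Dual ℚ ((Fin d → ℚ) × ℚ)) : Prop where
  nonneg : ∀ x ∈ epigraph A w, 0 ≤ g x
  apex_pos : 0 < g (apex d)

variable (A w) in
open Classical in
/-- The indices of the lifted columns on which a functional vanishes. -/
def zeros (g : Dual ℚ ((Fin d → ℚ) × ℚ)) : Finset (Fin n) :=
  Finset.univ.filter fun j => g (gen A w j) = 0

lemma mem_zeros {g : Dual ℚ ((Fin d → ℚ) × ℚ)} {j : Fin n} :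
    j ∈ zeros A w g ↔ g (gen A w j) = 0 := by simp [zeros]

variable (A w) in
open Classical in
/-- The lower faces of the epigraph cone, as sets of indices of the columns that they contain. -/
def lowerFaces : Finset (Finset (Fin n)) :=
  Finset.univ.filter fun σ => ∃ g, IsLower A w g ∧ zeros A w g = σ

lemma mem_lowerFaces {σ : Finset (Fin n)} :
    σ ∈ lowerFaces A w ↔ ∃ g, IsLower A w g ∧ zeros A w g = σ := by simp [lowerFaces]

variable (A w) in
/-- The dimension of the cone over a set of lifted columns. -/
def faceDim (σ : Finset (Fin n)) : ℕ := finrank ℚ (Submodule.span ℚ (gen A w '' σ))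

lemma faceDim_empty : faceDim A w ∅ = 0 := by
  unfold faceDim
  rw [Finset.coe_empty, Set.image_empty, Submodule.span_empty, finrank_bot]

lemma IsLower.add {g f : Dual ℚ ((Fin d → ℚ) × ℚ)} (hg : IsLower A w g)
    (hf : ∀ x ∈ epigraph A w, 0 ≤ f x) : IsLower A w (g + f) where
  nonneg x hx := add_nonneg (hg.nonneg x hx) (hf x hx)
  apex_pos := add_pos_of_pos_of_nonneg hg.apex_pos (hf _ apex_mem_epigraph)

lemma IsLower.of_mem_ineqs {f : Dual ℚ ((Fin d → ℚ) × ℚ)} (hf : f ∈ ineqs A w)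
    (hpos : 0 < f (apex d)) : IsLower A w f :=
  ⟨fun _ hx => mem_epigraph_iff.1 hx f hf, hpos⟩

lemma exists_isLower_point (a : semigroup A) : ∃ g, IsLower A w g ∧ g (point A w a) = 0 := by
  obtain ⟨f, hf, hpos, h⟩ := exists_lower_point (w := w) a
  exact ⟨f, .of_mem_ineqs hf hpos, h⟩

lemma exists_eq_sum_of_isLower {g : Dual ℚ ((Fin d → ℚ) × ℚ)} (hg : IsLower A w g)
    {x : (Fin d → ℚ) × ℚ} (hx : x ∈ epigraph A w) (hgx : g x = 0) :
    ∃ c : Fin n → ℚ, (∀ j, 0 ≤ c j) ∧ (∀ j, j ∉ zeros A w g → c j = 0) ∧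
      x = ∑ j, c j • gen A w j := by
  obtain ⟨c, t, hc, ht, rfl⟩ := exists_eq_sum_of_mem_epigraph hx
  simp only [map_add, map_sum, map_smul, smul_eq_mul] at hgx
  have hnn : ∀ j, 0 ≤ c j * g (gen A w j) := fun j =>
    mul_nonneg (hc j) (hg.nonneg _ (gen_mem_epigraph j))
  have hs := Finset.sum_nonneg fun j (_ : j ∈ Finset.univ) => hnn j
  have ht' := mul_nonneg ht hg.apex_pos.le
  have ht0 : t = 0 := by
    have : t * g (apex d) = 0 := by linarith
    exact (mul_eq_zero.1 this).resolve_right hg.apex_pos.ne'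
  refine ⟨c, hc, fun j hj => ?_, by simp [ht0]⟩
  have h0 : ∑ j, c j * g (gen A w j) = 0 := by linarith
  have := (Finset.sum_eq_zero_iff_of_nonneg fun j _ => hnn j).1 h0 j (Finset.mem_univ _)
  exact (mul_eq_zero.1 this).resolve_right fun h => hj (mem_zeros.2 h)

lemma span_zeros {g : Dual ℚ ((Fin d → ℚ) × ℚ)} (hg : IsLower A w g) :
    Submodule.span ℚ {x | x ∈ epigraph A w ∧ g x = 0} =
      Submodule.span ℚ (gen A w '' zeros A w g) := by
  apply le_antisymm
  · refine Submodule.span_le.2 ?_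
    rintro x ⟨hx, hgx⟩
    obtain ⟨c, -, hc0, rfl⟩ := exists_eq_sum_of_isLower hg hx hgx
    refine Submodule.sum_mem _ fun j _ => ?_
    by_cases hj : j ∈ zeros A w g
    · exact Submodule.smul_mem _ _ (Submodule.subset_span ⟨j, hj, rfl⟩)
    · rw [hc0 j hj, zero_smul]
      exact zero_mem _
  · refine Submodule.span_mono ?_
    rintro _ ⟨j, hj, rfl⟩
    exact ⟨gen_mem_epigraph j, mem_zeros.1 hj⟩

/-- On monomials supported on a lower face, the filtration order and the Newton function are both
the weight. -/
lemma newton_deg_of_isLower {g : Dual ℚ ((Fin d → ℚ) × ℚ)} (hg : IsLower A w g)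
    {u : Fin n →₀ ℕ} (hu : u.support ⊆ zeros A w g) :
    newton A w (deg A u) = Finsupp.weight w u ∧ ord A w (deg A u) = Finsupp.weight w u ∧
      point A w (deg A u) = Finsupp.weight (gen A w) u ∧ g (point A w (deg A u)) = 0 := by
  have h0 : g (Finsupp.weight (gen A w) u) = 0 := by
    rw [Finsupp.weight_apply, Finsupp.sum, map_sum]
    refine Finset.sum_eq_zero fun j hj => ?_
    rw [map_nsmul, mem_zeros.1 (hu hj), smul_zero]
  have h1 : newton A w (deg A u) = Finsupp.weight w u := by
    refine le_antisymm ((newton_le_ord _).trans (by exact_mod_cast ord_deg_le u)) ?_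
    have h2 := hg.nonneg _ (point_mem_epigraph (w := w) (deg A u))
    rw [weight_gen, eq_add_smul_apex, map_add, map_smul, smul_eq_mul] at h0
    rw [point, eq_add_smul_apex, map_add, map_smul, smul_eq_mul] at h2
    by_contra! h
    nlinarith [mul_lt_mul_of_pos_right h hg.apex_pos]
  have h3 : point A w (deg A u) = Finsupp.weight (gen A w) u := by
    rw [weight_gen, point, h1]
  refine ⟨h1, le_antisymm (ord_deg_le u) ?_, h3, h3 ▸ h0⟩
  have := newton_le_ord (w := w) (deg A u)
  rw [h1] at this
  exact_mod_cast this

variable (w) in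
/-- The exponent vector of the barycentre of a set of columns, scaled so that its weight does not
depend on the set. -/
def baryExp (σ : Finset (Fin n)) : Fin n →₀ ℕ :=
  Finsupp.indicator σ fun _ _ => ∏ ρ ∈ (Finset.univ.erase ∅).erase σ, ∑ j ∈ ρ, w j

variable (w) in
/-- The common weight of all barycentres. -/
def baryWeight : ℕ := ∏ ρ ∈ (Finset.univ : Finset (Finset (Fin n))).erase ∅, ∑ j ∈ ρ, w j

lemma weight_baryExp {σ : Finset (Fin n)} (hσ : σ.Nonempty) :
    Finsupp.weight w (baryExp w σ) = baryWeight w := by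
  classical
  rw [Finsupp.weight_apply, Finsupp.sum_fintype _ _ (by simp), baryWeight,
    ← Finset.mul_prod_erase _ _ (Finset.mem_erase.2 ⟨hσ.ne_empty, Finset.mem_univ σ⟩),
    Finset.sum_mul, ← Finset.sum_subset (Finset.subset_univ σ)]
  · refine Finset.sum_congr rfl fun j hj => ?_
    rw [baryExp, Finsupp.indicator_of_mem hj, smul_eq_mul, mul_comm]
  · intro j _ hj
    rw [baryExp, Finsupp.indicator_of_notMem hj, zero_smul]

lemma sum_weights_pos (hw : ∀ j, 0 < w j) {ρ : Finset (Fin n)} (hρ : ρ ≠ ∅) :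
    0 < ∑ j ∈ ρ, w j :=
  Finset.sum_pos (fun j _ => hw j) (Finset.nonempty_iff_ne_empty.2 hρ)

lemma baryWeight_pos (hw : ∀ j, 0 < w j) : 0 < baryWeight w :=
  Finset.prod_pos fun _ hρ => sum_weights_pos hw (Finset.ne_of_mem_erase hρ)

lemma baryExp_pos (hw : ∀ j, 0 < w j) {σ : Finset (Fin n)} {j : Fin n} (hj : j ∈ σ) :
    0 < baryExp w σ j := by
  rw [baryExp, Finsupp.indicator_of_mem hj]
  exact Finset.prod_pos fun _ hρ => sum_weights_pos hw
    (Finset.ne_of_mem_erase (Finset.mem_of_mem_erase hρ))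

lemma support_baryExp (σ : Finset (Fin n)) : (baryExp w σ).support ⊆ σ :=
  Finsupp.support_indicator_subset _ _

/-- If a nonnegative functional vanishes at the barycentre of `σ`, it vanishes on `σ`. -/
lemma subset_zeros_of_bary (hw : ∀ j, 0 < w j) {f : Dual ℚ ((Fin d → ℚ) × ℚ)}
    (hf : ∀ x ∈ epigraph A w, 0 ≤ f x) {σ : Finset (Fin n)}
    (h : f (Finsupp.weight (gen A w) (baryExp w σ)) ≤ 0) : σ ⊆ zeros A w f := by
  intro j hj
  rw [mem_zeros]
  rw [Finsupp.weight_apply, Finsupp.sum_fintype _ _ (by simp), map_sum] at h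
  have hnn : ∀ i ∈ Finset.univ, 0 ≤ f (baryExp w σ i • gen A w i) := fun i _ => by
    rw [map_nsmul]
    exact nsmul_nonneg (hf _ (gen_mem_epigraph i)) _
  have h0 := (Finset.sum_eq_zero_iff_of_nonneg hnn).1 (le_antisymm h (Finset.sum_nonneg hnn)) j
    (Finset.mem_univ _)
  rw [map_nsmul] at h0
  exact (smul_eq_zero.1 h0).resolve_left (baryExp_pos hw hj).ne'

/-- A multiple of each nonzero element `a` of the semigroup is a sum of columns in which the
barycentre of the smallest face containing `a` occurs. -/
lemma exists_minimal_face {a : semigroup A} (ha : a ≠ 0)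
    {g : Dual ℚ ((Fin d → ℚ) × ℚ)} (hg : IsLower A w g) (hga : g (point A w a) = 0) :
    ∃ g', IsLower A w g' ∧ g' (point A w a) = 0 ∧ (zeros A w g').Nonempty ∧
      ∃ (m : ℕ) (u : Fin n →₀ ℕ), 0 < m ∧ u.support ⊆ zeros A w g' ∧
        m • a = deg A (baryExp w (zeros A w g')) + deg A u := by
  classical
  let J := (ineqs A w).filter fun f => f (point A w a) = 0
  have hJ : ∀ f ∈ J, ∀ x ∈ epigraph A w, 0 ≤ f x := fun f hf x hx =>
    mem_epigraph_iff.1 hx f (Finset.mem_filter.1 hf).1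
  let g' := g + ∑ f ∈ J, f
  have hg' : IsLower A w g' := hg.add fun x hx => by
    rw [LinearMap.sum_apply]
    exact Finset.sum_nonneg fun f hf => hJ f hf x hx
  have hg'a : g' (point A w a) = 0 := by
    simp only [g', LinearMap.add_apply, LinearMap.sum_apply, hga, zero_add]
    exact Finset.sum_eq_zero fun f hf => (Finset.mem_filter.1 hf).2
  set ρ := zeros A w g' with hρ
  have hJρ : ∀ f ∈ J, ∀ j ∈ ρ, f (gen A w j) = 0 := by
    intro f hf j hj
    have h1 : g (gen A w j) + ∑ f ∈ J, f (gen A w j) = 0 := by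
      simpa [g'] using mem_zeros.1 hj
    have h2 : ∀ f ∈ J, 0 ≤ f (gen A w j) := fun f hf => hJ f hf _ (gen_mem_epigraph j)
    have h3 := hg.nonneg _ (gen_mem_epigraph j)
    have h4 := Finset.sum_nonneg h2
    exact (Finset.sum_eq_zero_iff_of_nonneg h2).1 (by linarith) f hf
  -- the point lies in the relative interior of the face
  set y := Finsupp.weight (gen A w) (baryExp w ρ) with hy
  have hJy : ∀ f ∈ J, f y = 0 := by
    intro f hf
    rw [hy, Finsupp.weight_apply, Finsupp.sum, map_sum]
    refine Finset.sum_eq_zero fun j hj => ?_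
    rw [map_nsmul, hJρ f hf j (support_baryExp ρ hj), smul_zero]
  have hev : ∀ᶠ ε in 𝓝[>] (0 : ℚ), ∀ f ∈ ineqs A w, 0 ≤ f (point A w a) + ε * -f y := by
    refine (Finset.eventually_all _).2 fun f hf => ?_
    rcases (mem_epigraph_iff.1 (point_mem_epigraph (w := w) a) f hf).eq_or_lt with h0 | h0
    · rw [hJy f (Finset.mem_filter.2 ⟨hf, h0.symm⟩), ← h0]
      simp
    · filter_upwards [eventually_pos_add_mul (-f y) h0] with ε hε using hε.le
  obtain ⟨ε, hε, hεpos⟩ := (hev.and self_mem_nhdsWithin).exists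
  replace hεpos : 0 < ε := hεpos
  have hmem : point A w a - ε • y ∈ epigraph A w := mem_epigraph_iff.2 fun f hf => by
    have := hε f hf
    simp only [map_sub, map_smul, smul_eq_mul]
    linarith
  have hg'y : g' y = 0 := by
    rw [hy, Finsupp.weight_apply, Finsupp.sum, map_sum]
    refine Finset.sum_eq_zero fun j hj => ?_
    rw [map_nsmul, mem_zeros.1 (support_baryExp ρ hj), smul_zero]
  obtain ⟨c, hc, hc0, hsum⟩ := exists_eq_sum_of_isLower hg' hmem (by simp [hg'a, hg'y])
  -- clear denominators
  let m := ε.den * ∏ j, (c j).den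
  have hm : 0 < m := Nat.mul_pos ε.den_pos (Finset.prod_pos fun j _ => (c j).den_pos)
  have hint : ∀ q : ℚ, 0 ≤ q → q.den ∣ m → ∃ k : ℕ, (m : ℚ) * q = k := by
    rintro q hq ⟨e, he⟩
    refine ⟨e * q.num.toNat, ?_⟩
    rw [he]
    have h1 := Rat.mul_den_eq_num q
    have h2 : ((q.num.toNat : ℤ) : ℚ) = q.num := by
      rw [Int.toNat_of_nonneg (Rat.num_nonneg.2 hq)]
    push_cast at h2 ⊢
    rw [h2]
    linear_combination (e : ℚ) * h1
  obtain ⟨N, hN⟩ := hint ε hεpos.le (Dvd.intro _ rfl)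
  have hc' := fun j => hint (c j) (hc j)
    ((Finset.dvd_prod_of_mem (fun j => (c j).den) (Finset.mem_univ j)).trans (Dvd.intro_left _ rfl))
  choose v hv using hc'
  have hNpos : 0 < N := by
    have : (0 : ℚ) < m * ε := mul_pos (by exact_mod_cast hm) hεpos
    rw [hN] at this
    exact_mod_cast this
  let v' : Fin n →₀ ℕ := Finsupp.equivFunOnFinite.symm v
  have hv' : v'.support ⊆ ρ := by
    intro j hj
    by_contra hjρ
    rw [Finsupp.mem_support_iff] at hj
    apply hj
    have := hv j
    rw [hc0 j hjρ, mul_zero] at this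
    exact_mod_cast this.symm
  have hpt : (m : ℚ) • point A w a = Finsupp.weight (gen A w) (N • baryExp w ρ + v') := by
    rw [map_add, map_nsmul, ← hy, Finsupp.weight_apply, Finsupp.sum_fintype _ _ (by simp),
      ← Nat.cast_smul_eq_nsmul ℚ, ← hN, mul_smul, ← sub_eq_iff_eq_add', ← smul_sub, hsum,
      Finset.smul_sum]
    refine Finset.sum_congr rfl fun j _ => ?_
    rw [smul_smul, hv j, ← Nat.cast_smul_eq_nsmul ℚ]
    rfl
  have hdeg : m • a = deg A (N • baryExp w ρ + v') := by
    apply Subtype.ext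
    funext i
    rw [weight_gen] at hpt
    have := congrFun (congrArg Prod.fst hpt) i
    simp only [point, Prod.smul_fst, Pi.smul_apply, smul_eq_mul] at this
    have h2 : ((m • a : semigroup A) : Fin d → ℤ) i = m * (a : Fin d → ℤ) i := by simp
    rw [h2]
    exact_mod_cast this
  refine ⟨g', hg', hg'a, ?_, m, (N - 1) • baryExp w ρ + v', hm, ?_, ?_⟩
  · rw [Finset.nonempty_iff_ne_empty]
    intro hempty
    have h1 : baryExp w ρ = 0 := by
      rw [← Finsupp.support_eq_empty, ← Finset.subset_empty, ← hempty]; exact support_baryExp ρ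
    have h2 : v' = 0 := by
      rw [← Finsupp.support_eq_empty, ← Finset.subset_empty, ← hempty]; exact hv'
    rw [h1, h2, smul_zero, add_zero, map_zero] at hdeg
    apply ha
    apply Subtype.ext
    have := congrArg Subtype.val hdeg
    exact (smul_eq_zero.1 (show m • (a : Fin d → ℤ) = 0 from this)).resolve_left hm.ne'
  · refine Finsupp.support_add.trans (Finset.union_subset ?_ hv')
    exact Finsupp.support_smul.trans (support_baryExp ρ)
  · rw [hdeg, ← map_add, ← add_assoc, ← succ_nsmul', Nat.sub_add_cancel hNpos]

lemma faceDim_lt (g : Dual ℚ ((Fin d → ℚ) × ℚ)) {σ ρ : Finset (Fin n)}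
    (hσ : σ = zeros A w g) (h : σ ⊂ ρ) : faceDim A w σ < faceDim A w ρ := by
  refine Submodule.finrank_lt_finrank_of_lt (lt_of_le_of_ne
    (Submodule.span_mono (Set.image_mono (Finset.coe_subset.2 h.1))) fun heq => h.2 fun j hj => ?_)
  have hj' : gen A w j ∈ Submodule.span ℚ (gen A w '' σ) :=
    heq ▸ Submodule.subset_span ⟨j, hj, rfl⟩
  have hle : Submodule.span ℚ (gen A w '' σ) ≤ LinearMap.ker g := by
    refine Submodule.span_le.2 ?_
    rintro _ ⟨i, hi, rfl⟩
    rw [hσ] at hi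
    exact mem_zeros.1 hi
  rw [hσ]
  exact mem_zeros.2 (hle hj')

lemma faceDim_pos (hw : ∀ j, 0 < w j) {σ : Finset (Fin n)} (hσ : σ.Nonempty) :
    0 < faceDim A w σ := by
  obtain ⟨j, hj⟩ := hσ
  have h : gen A w j ≠ 0 := fun h => (hw j).ne' (by simpa [gen] using congrArg Prod.snd h)
  rw [faceDim, Nat.pos_iff_ne_zero]
  intro h0
  have hbot := Submodule.finrank_eq_zero.1 h0
  have hmem : gen A w j ∈ Submodule.span ℚ (gen A w '' σ) := Submodule.subset_span ⟨j, hj, rfl⟩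
  rw [hbot] at hmem
  exact h hmem

lemma faceDim_le {σ : Finset (Fin n)} (hσ : σ ∈ lowerFaces A w) : faceDim A w σ ≤ d := by
  obtain ⟨g, hg, rfl⟩ := mem_lowerFaces.1 hσ
  have hle : Submodule.span ℚ (gen A w '' zeros A w g) ≤ LinearMap.ker g := by
    refine Submodule.span_le.2 ?_
    rintro _ ⟨i, hi, rfl⟩
    exact mem_zeros.1 hi
  have h1 := Submodule.finrank_mono hle
  have h2 := Module.Dual.finrank_ker_add_one_of_ne_zero (f := g)
    (fun h => hg.apex_pos.ne' (by simp [h]))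
  have h3 : finrank ℚ ((Fin d → ℚ) × ℚ) = d + 1 := by simp
  unfold faceDim
  omega

/-- A lower face of positive dimension contains a lower face of dimension one less. -/
lemma exists_facet (hw : ∀ j, 0 < w j) {ρ : Finset (Fin n)} (hρ : ρ ∈ lowerFaces A w) {k : ℕ}
    (hk : faceDim A w ρ = k + 1) : ∃ ρ' ∈ lowerFaces A w, ρ' ⊂ ρ ∧ faceDim A w ρ' = k := by
  classical
  obtain ⟨g, hg, rfl⟩ := mem_lowerFaces.1 hρ
  set ρ := zeros A w g with hρdef
  let W := Submodule.span ℚ (gen A w '' ρ)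
  let I := (ineqs A w).filter fun f => ∃ j ∈ ρ, f (gen A w j) ≠ 0
  let x₀ := ∑ j ∈ ρ, gen A w j
  have hx₀ : x₀ ∈ W := Submodule.sum_mem _ fun j hj => Submodule.subset_span ⟨j, hj, rfl⟩
  have hnn : ∀ f ∈ ineqs A w, ∀ x ∈ epigraph A w, 0 ≤ f x := fun f hf x hx =>
    mem_epigraph_iff.1 hx f hf
  have hpos : ∀ f ∈ I, 0 < f x₀ := by
    intro f hf
    obtain ⟨hf, j, hj, hne⟩ := Finset.mem_filter.1 hf
    simp only [x₀, map_sum]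
    refine Finset.sum_pos' (fun i _ => hnn f hf _ (gen_mem_epigraph i)) ⟨j, hj, ?_⟩
    exact lt_of_le_of_ne (hnn f hf _ (gen_mem_epigraph j)) (Ne.symm hne)
  have hgW : ∀ x ∈ W, g x = 0 := fun x hx => by
    have hle : W ≤ LinearMap.ker g := by
      refine Submodule.span_le.2 ?_
      rintro _ ⟨i, hi, rfl⟩
      exact mem_zeros.1 hi
    exact hle hx
  have hF : ∀ x, x ∈ {x | x ∈ epigraph A w ∧ g x = 0} ↔ x ∈ W ∧ ∀ f ∈ I, 0 ≤ f x := by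
    intro x
    constructor
    · intro hx
      refine ⟨?_, fun f hf => hnn f (Finset.mem_filter.1 hf).1 x hx.1⟩
      have : x ∈ Submodule.span ℚ {x | x ∈ epigraph A w ∧ g x = 0} := Submodule.subset_span hx
      rwa [span_zeros hg] at this
    · rintro ⟨hxW, hx⟩
      refine ⟨mem_epigraph_iff.2 fun f hf => ?_, hgW x hxW⟩
      by_cases hfI : f ∈ I
      · exact hx f hfI
      · have hle : W ≤ LinearMap.ker f := by
          refine Submodule.span_le.2 ?_
          rintro _ ⟨i, hi, rfl⟩
          by_contra hne
          exact hfI (Finset.mem_filter.2 ⟨hf, i, hi, hne⟩)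
        exact le_of_eq (hle hxW).symm
  -- every inequality `f` of an irredundant system cuts out a facet; there is at least one since
  -- the face contains no line
  obtain ⟨J, hJI, hJ, hirr⟩ := exists_irredundant hx₀ hpos
  have hne : J.Nonempty := by
    rw [Finset.nonempty_iff_ne_empty]
    rintro rfl
    have hmem := ((hF (-x₀)).2 ⟨neg_mem hx₀, hJ _ (neg_mem hx₀) (by simp)⟩).1
    have h1 := snd_nonneg_of_mem_epigraph hmem
    have h2 : ρ.Nonempty := by
      rw [Finset.nonempty_iff_ne_empty]
      intro h0
      have hk' : faceDim A w ρ = k + 1 := hk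
      rw [h0, faceDim_empty] at hk'
      omega
    have h3 : 0 < x₀.2 := by
      simp only [x₀, Prod.snd_sum, gen]
      exact Finset.sum_pos (fun j _ => by exact_mod_cast hw j) h2
    rw [Prod.snd_neg] at h1
    linarith
  obtain ⟨f, hfJ⟩ := hne
  obtain ⟨y, hyW, hfy, hy⟩ := hirr f hfJ
  have hfI := hJI hfJ
  have hfin := (Finset.mem_filter.1 hfI).1
  have hg' : IsLower A w (g + f) := hg.add (hnn f hfin)
  have hF' : ∀ x, x ∈ {x | x ∈ epigraph A w ∧ (g + f) x = 0} ↔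
      x ∈ W ⊓ LinearMap.ker f ∧ ∀ f' ∈ J.erase f, 0 ≤ f' x := by
    intro x
    have h1 : x ∈ {x | x ∈ epigraph A w ∧ (g + f) x = 0} ↔
        x ∈ {x | x ∈ epigraph A w ∧ g x = 0} ∧ f x = 0 := by
      simp only [Set.mem_ofPred_eq, LinearMap.add_apply, and_assoc]
      refine and_congr_right fun hx => ?_
      rw [add_eq_zero_iff_of_nonneg (hg.nonneg x hx) (hnn f hfin x hx)]
    rw [h1, hF, Submodule.mem_inf, LinearMap.mem_ker]
    constructor
    · rintro ⟨⟨h1, h2⟩, h3⟩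
      exact ⟨⟨h1, h3⟩, fun f' hf' => h2 f' (hJI (Finset.mem_of_mem_erase hf'))⟩
    · rintro ⟨⟨h1, h3⟩, h2⟩
      refine ⟨⟨h1, hJ x h1 fun f' hf' => ?_⟩, h3⟩
      by_cases h : f' = f
      · rw [h, h3]
      · exact h2 f' (Finset.mem_erase.2 ⟨h, hf'⟩)
  have hspan := span_eq_of_pos (W := W ⊓ LinearMap.ker f) (x₀ := y) ⟨hyW, hfy⟩
    (fun f' hf' => hy f' (Finset.mem_of_mem_erase hf') (Finset.ne_of_mem_erase hf')) hF'
  rw [span_zeros hg'] at hspan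
  have hrank := finrank_inf_ker hx₀ (hpos f hfI).ne'
  have hdim : faceDim A w (zeros A w (g + f)) = k := by
    unfold faceDim at hk ⊢
    rw [hspan]
    have : finrank ℚ W = k + 1 := hk
    omega
  refine ⟨zeros A w (g + f), mem_lowerFaces.2 ⟨_, hg', rfl⟩, ⟨fun j hj => ?_, fun h => ?_⟩, hdim⟩
  · have := mem_zeros.1 hj
    rw [LinearMap.add_apply] at this
    have h1 := hg.nonneg _ (gen_mem_epigraph j)
    have h2 := hnn f hfin _ (gen_mem_epigraph j)
    exact mem_zeros.2 (by linarith)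
  · have := Submodule.finrank_mono (Submodule.span_mono (R := ℚ)
      (Set.image_mono (f := gen A w) (Finset.coe_subset.2 h)))
    unfold faceDim at hk hdim
    omega

end Epigraph

end ToricGr

namespace ToricGr

/-! ### Gradings defined by a basis -/

section GradingOfBasis

open Module

variable {k V ι : Type*} [CommRing k] [AddCommGroup V] [Module k V]

open Classical in
/-- The grading of `V` in which the members of a basis are homogeneous of prescribed degrees. -/
noncomputable def Grading.ofBasis (b : Basis ι k V) (h : ι → ℕ) : Grading k V where
  comp i := b.constr k fun a => if h a = i then b a else 0
  comp_comp i j v := by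
    have H : (b.constr k fun a => if h a = i then b a else 0) ∘ₗ
        (b.constr k fun a => if h a = j then b a else 0) =
        if i = j then b.constr k fun a => if h a = j then b a else 0 else 0 := by
      refine b.ext fun a => ?_
      rw [LinearMap.comp_apply, Basis.constr_basis]
      by_cases h1 : h a = j
      · rw [if_pos h1, Basis.constr_basis]
        by_cases h2 : i = j
        · rw [if_pos h2, if_pos (h1.trans h2.symm), Basis.constr_basis, if_pos h1]
        · rw [if_neg h2, if_neg (fun h' => h2 (h'.symm.trans h1))]; rfl
      · rw [if_neg h1, map_zero]
        split_ifs
        · rw [Basis.constr_basis, if_neg h1]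
        · rfl
    have := LinearMap.congr_fun H v
    rw [LinearMap.comp_apply] at this
    rw [this]
    split_ifs <;> rfl
  eq_zero v hv := by
    refine b.ext_elem fun a => ?_
    have H : b.coord a ∘ₗ (b.constr k fun a' => if h a' = h a then b a' else 0) = b.coord a := by
      refine b.ext fun a' => ?_
      rw [LinearMap.comp_apply, Basis.constr_basis]
      split_ifs with h1
      · rfl
      · rw [map_zero, Basis.coord_apply, Basis.repr_self, Finsupp.single_eq_of_ne]
        rintro rfl
        exact h1 rfl
    have := LinearMap.congr_fun H v
    rw [LinearMap.comp_apply, hv, map_zero] at this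
    simpa using this.symm
  bounded v := by
    induction b.mem_span v using Submodule.span_induction with
    | mem x hx =>
      obtain ⟨a, rfl⟩ := hx
      refine ⟨h a + 1, fun i hi => ?_⟩
      rw [Basis.constr_basis, if_neg (by omega)]
    | zero => exact ⟨0, fun i _ => map_zero _⟩
    | add x y _ _ hx hy =>
      obtain ⟨m, hm⟩ := hx
      obtain ⟨m', hm'⟩ := hy
      refine ⟨max m m', fun i hi => ?_⟩
      rw [map_add, hm i (le_of_max_le_left hi), hm' i (le_of_max_le_right hi), add_zero]
    | smul c x _ hx =>
      obtain ⟨m, hm⟩ := hx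
      exact ⟨m, fun i hi => by rw [map_smul, hm i hi, smul_zero]⟩

variable (b : Basis ι k V) (h : ι → ℕ)

open Classical in
lemma Grading.ofBasis_comp (i : ℕ) (a : ι) :
    (Grading.ofBasis b h).comp i (b a) = if h a = i then b a else 0 :=
  Basis.constr_basis b k (fun a => if h a = i then b a else 0) a

lemma Grading.comp_mem_span (i : ℕ) (v : V) :
    (Grading.ofBasis b h).comp i v ∈ Submodule.span k (b '' {a | h a = i}) := by
  classical
  induction b.mem_span v using Submodule.span_induction with
  | mem x hx =>
    obtain ⟨a, rfl⟩ := hx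
    rw [Grading.ofBasis_comp]
    split_ifs with h1
    · exact Submodule.subset_span ⟨a, h1, rfl⟩
    · exact zero_mem _
  | zero => rw [map_zero]; exact zero_mem _
  | add x y _ _ hx hy => rw [map_add]; exact add_mem hx hy
  | smul c x _ hx => rw [map_smul]; exact Submodule.smul_mem _ _ hx

lemma Grading.mem_below_ofBasis {n : ℕ} {v : V} (hv : v ∈ (Grading.ofBasis b h).below n) :
    v ∈ Submodule.span k (b '' {a | h a < n}) := by
  obtain ⟨m, hm⟩ := (Grading.ofBasis b h).bounded v
  rw [Grading.sum_comp v hm]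
  refine Submodule.sum_mem _ fun i _ => ?_
  rcases lt_or_ge i n with hi | hi
  · refine Submodule.span_mono (Set.image_mono ?_) (Grading.comp_mem_span b h i v)
    intro a ha
    exact lt_of_eq_of_lt ha hi
  · rw [Grading.mem_below.1 hv i hi]
    exact zero_mem _

lemma Grading.basis_mem_below {n : ℕ} {a : ι} (ha : h a < n) :
    b a ∈ (Grading.ofBasis b h).below n :=
  Grading.mem_below.2 fun i hi => by
    classical
    rw [Grading.ofBasis_comp, if_neg (by omega)]

lemma Grading.isHomogeneousOp_ofBasis {D : ℕ} {x : Module.End k V}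
    (hx : ∀ a, x (b a) ∈ Submodule.span k (b '' {a' | h a' = h a + D})) :
    (Grading.ofBasis b h).IsHomogeneousOp D x := by
  classical
  have key : ∀ a i, (Grading.ofBasis b h).comp i (x (b a)) =
      if i = h a + D then x (b a) else 0 := by
    intro a i
    have hxa := hx a
    generalize x (b a) = y at hxa ⊢
    induction hxa using Submodule.span_induction with
    | mem y hy =>
      obtain ⟨a', ha', rfl⟩ := hy
      rw [Grading.ofBasis_comp, show h a' = h a + D from ha']
      exact if_congr eq_comm rfl rfl
    | zero => simp
    | add y z _ _ hy hz => rw [map_add, hy, hz]; split_ifs <;> simp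
    | smul c y _ hy => rw [map_smul, hy]; split_ifs <;> simp
  constructor
  · intro i v
    have H : (Grading.ofBasis b h).comp (i + D) ∘ₗ x = x ∘ₗ (Grading.ofBasis b h).comp i := by
      refine b.ext fun a => ?_
      rw [LinearMap.comp_apply, LinearMap.comp_apply, key, Grading.ofBasis_comp]
      by_cases h1 : h a = i
      · rw [if_pos (by omega), if_pos h1]
      · rw [if_neg (by omega), if_neg h1, map_zero]
    exact LinearMap.congr_fun H v
  · intro i v hi
    have H : (Grading.ofBasis b h).comp i ∘ₗ x = 0 := by
      refine b.ext fun a => ?_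
      rw [LinearMap.comp_apply, key, if_neg (by omega)]
      rfl
    exact LinearMap.congr_fun H v

lemma Grading.isLeadingOp_ofBasis {D : ℕ} {x θ : Module.End k V}
    (hθ : ∀ a, θ (b a) ∈ Submodule.span k (b '' {a' | h a' = h a + D}))
    (hx : ∀ a, x (b a) - θ (b a) ∈ Submodule.span k (b '' {a' | h a' < h a + D})) :
    (Grading.ofBasis b h).IsLeadingOp D x θ := by
  have hhom := Grading.isHomogeneousOp_ofBasis b h hθ
  have hθb : ∀ n v, v ∈ (Grading.ofBasis b h).below n →
      θ v ∈ (Grading.ofBasis b h).below (n + D) := by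
    intro n v hv
    refine Grading.mem_below.2 fun i hi => ?_
    obtain ⟨j, rfl⟩ := Nat.exists_eq_add_of_le' (show D ≤ i by omega)
    rw [hhom.comp_add, Grading.mem_below.1 hv j (by omega), map_zero]
  have hdiff : ∀ n v, v ∈ (Grading.ofBasis b h).below (n + 1) →
      x v - θ v ∈ (Grading.ofBasis b h).below (n + D) := by
    intro n v hv
    induction Grading.mem_below_ofBasis b h hv using Submodule.span_induction with
    | mem y hy =>
      obtain ⟨a, ha, rfl⟩ := hy
      refine (Submodule.span_le.2 ?_ : Submodule.span k (b '' {a' | h a' < h a + D}) ≤ _) (hx a)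
      rintro _ ⟨a', ha', rfl⟩
      have h1 : h a < n + 1 := ha
      have h2 : h a' < h a + D := ha'
      exact Grading.basis_mem_below b h (by omega)
    | zero => simp
    | add y z hy hz ihy ihz =>
      have hsub : Submodule.span k (b '' {a | h a < n + 1}) ≤
          (Grading.ofBasis b h).below (n + 1) := by
        refine Submodule.span_le.2 ?_
        rintro _ ⟨a, ha, rfl⟩
        exact Grading.basis_mem_below b h ha
      have := add_mem (ihy (hsub hy)) (ihz (hsub hz))
      rw [map_add, map_add]
      convert this using 1
      abel
    | smul c y hy ihy =>
      have hsub : Submodule.span k (b '' {a | h a < n + 1}) ≤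
          (Grading.ofBasis b h).below (n + 1) := by
        refine Submodule.span_le.2 ?_
        rintro _ ⟨a, ha, rfl⟩
        exact Grading.basis_mem_below b h ha
      rw [map_smul, map_smul, ← smul_sub]
      exact Submodule.smul_mem _ _ (ihy (hsub hy))
  refine ⟨hhom, fun n v hv => ?_, fun n v hv => ?_⟩
  · have h1 := hdiff n v (Grading.below_mono (by omega) hv)
    have := add_mem h1 (hθb n v hv)
    simpa using this
  · have h1 := Grading.mem_below.1 (hdiff n v hv) (n + D) le_rfl
    rw [map_sub, sub_eq_zero] at h1
    rw [h1, hhom.comp_add]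

end GradingOfBasis

/-! ### The operators on the space of formal sums of semigroup elements -/

noncomputable section Operators

open Module

variable {d n : ℕ} (A : Matrix (Fin d) (Fin n) ℤ) (w : Fin n → ℕ)

/-- The sum of the filtration order and the Newton function. Both are subadditive, so that this sum
is additive on a pair exactly if both of them are. -/
def total (a : semigroup A) : ℚ := ord A w a + newton A w a

variable {A w}

lemma total_add_le (a b : semigroup A) : total A w (a + b) ≤ total A w a + total A w b := by
  have h1 : (ord A w (a + b) : ℚ) ≤ ord A w a + ord A w b := by exact_mod_cast ord_add_le a b
  have h2 := newton_add_le (w := w) a b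
  unfold total
  linarith

lemma total_add_iff {a b : semigroup A} : total A w a + total A w b = total A w (a + b) ↔
    ord A w a + ord A w b = ord A w (a + b) ∧ newton A w a + newton A w b = newton A w (a + b) := by
  have h1 : (ord A w (a + b) : ℚ) ≤ ord A w a + ord A w b := by exact_mod_cast ord_add_le a b
  have h2 := newton_add_le (w := w) a b
  unfold total
  constructor
  · intro h
    exact ⟨by exact_mod_cast (by linarith : (ord A w a : ℚ) + ord A w b = ord A w (a + b)),
      by linarith⟩
  · rintro ⟨h3, h4⟩
    have h3' : (ord A w a : ℚ) + ord A w b = ord A w (a + b) := by exact_mod_cast h3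
    linarith

variable (w) in
open Classical in
/-- Multiplication by the basis element of `b` in the common refinement of the associated graded
rings of the two filtrations: it sends the basis element of `a` to that of `a + b`, or to zero if
one of the filtrations is not additive on this pair. -/
def shift (b : semigroup A) : Module.End ℂ (semigroup A →₀ ℂ) :=
  Finsupp.lsum ℂ fun a =>
    if total A w a + total A w b = total A w (a + b) then Finsupp.lsingle (a + b) else 0

open Classical in
lemma shift_single (a b : semigroup A) (c : ℂ) : shift w b (Finsupp.single a c) =
    if total A w a + total A w b = total A w (a + b) then Finsupp.single (a + b) c else 0 := by
  rw [shift, Finsupp.lsum_single]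
  split_ifs <;> rfl

open Classical in
lemma shift_shift_single (a b b' : semigroup A) (c : ℂ) :
    shift w b' (shift w b (Finsupp.single a c)) =
      if total A w a + total A w b + total A w b' = total A w (a + b + b') then
        Finsupp.single (a + b + b') c else 0 := by
  have h1 := total_add_le (w := w) a b
  have h2 := total_add_le (w := w) (a + b) b'
  rw [shift_single]
  split_ifs with h h' h'
  · rw [shift_single, if_pos (by rw [← h', h])]
  · rw [shift_single, if_neg (by rw [← h]; exact h')]
  · exact absurd (le_antisymm (by linarith) h1) h
  · rw [map_zero]

lemma shift_commute (b b' : semigroup A) : Commute (shift w b) (shift w b') := by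
  refine Finsupp.lhom_ext fun a c => ?_
  rw [Module.End.mul_apply, Module.End.mul_apply, shift_shift_single, shift_shift_single,
    add_right_comm a b' b]
  congr 1
  rw [add_right_comm (total A w a)]

variable (w) in
/-- The barycentre of a set of columns. -/
def bary (σ : Finset (Fin n)) : semigroup A := deg A (baryExp w σ)

variable (A w) in
/-- The lower faces of a given dimension. -/
def facesOfDim (i : ℕ) : Finset (Finset (Fin n)) :=
  (lowerFaces A w).filter fun σ => faceDim A w σ = i

lemma mem_facesOfDim {i : ℕ} {σ : Finset (Fin n)} :
    σ ∈ facesOfDim A w i ↔ σ ∈ lowerFaces A w ∧ faceDim A w σ = i := Finset.mem_filter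

variable (A w) in
/-- The sum of the shifts by the barycentres of the lower faces of dimension `i`. -/
def theta (i : ℕ) : Module.End ℂ (semigroup A →₀ ℂ) :=
  ∑ σ ∈ facesOfDim A w i, shift w (bary w σ)

lemma theta_commute (i j : ℕ) : Commute (theta A w i) (theta A w j) :=
  Commute.sum_left _ _ _ fun _ _ => Commute.sum_right _ _ _ fun _ _ => shift_commute _ _

variable (A w) in
/-- The operators attached to the dimensions `1, …, r`. -/
def thetas (r : ℕ) : List (Module.End ℂ (semigroup A →₀ ℂ)) :=
  (List.range r).map fun i => theta A w (i + 1)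

variable (w) in
/-- The formal sums of semigroup elements whose points on the Newton graph avoid `Z`. -/
def avoiding (Z : Set ((Fin d → ℚ) × ℚ)) : Submodule ℂ (semigroup A →₀ ℂ) :=
  Finsupp.supported ℂ ℂ {a | point A w a ∉ Z}

lemma avoiding_union (Z Z' : Set ((Fin d → ℚ) × ℚ)) :
    avoiding (A := A) w (Z ∪ Z') = avoiding w Z ⊓ avoiding w Z' := by
  rw [avoiding, avoiding, avoiding, ← Finsupp.supported_inter]
  congr 1
  ext a
  simp

lemma avoiding_inter (Z Z' : Set ((Fin d → ℚ) × ℚ)) :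
    avoiding (A := A) w (Z ∩ Z') = avoiding w Z ⊔ avoiding w Z' := by
  rw [avoiding, avoiding, avoiding, ← Finsupp.supported_union]
  congr 1
  ext a
  simp only [Set.mem_inter_iff, not_and_or, Set.mem_union, Set.mem_ofPred_eq]

lemma shift_mem_avoiding {g : Dual ℚ ((Fin d → ℚ) × ℚ)} (hg : ∀ x ∈ epigraph A w, 0 ≤ g x)
    (b : semigroup A) {v : semigroup A →₀ ℂ}
    (hv : v ∈ avoiding w {x | x ∈ epigraph A w ∧ g x = 0}) :
    shift w b v ∈ avoiding w {x | x ∈ epigraph A w ∧ g x = 0} := by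
  classical
  rw [avoiding, Finsupp.supported_eq_span_single] at hv
  induction hv using Submodule.span_induction with
  | mem x hx =>
    obtain ⟨a, ha, rfl⟩ := hx
    rw [shift_single]
    split_ifs with h
    · refine Finsupp.single_mem_supported ℂ _ fun hab => ha ⟨point_mem_epigraph a, ?_⟩
      have h1 := hab.2
      rw [point_add (total_add_iff.1 h).2, map_add] at h1
      have h2 := hg _ (point_mem_epigraph (w := w) a)
      have h3 := hg _ (point_mem_epigraph (w := w) b)
      linarith
    · exact zero_mem _
  | zero => rw [map_zero]; exact zero_mem _
  | add x y _ _ hx hy => rw [map_add]; exact add_mem hx hy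
  | smul c x _ hx => rw [map_smul]; exact Submodule.smul_mem _ _ hx

lemma theta_mem_avoiding {g : Dual ℚ ((Fin d → ℚ) × ℚ)} (hg : ∀ x ∈ epigraph A w, 0 ≤ g x)
    (i : ℕ) {v : semigroup A →₀ ℂ} (hv : v ∈ avoiding w {x | x ∈ epigraph A w ∧ g x = 0}) :
    theta A w i v ∈ avoiding w {x | x ∈ epigraph A w ∧ g x = 0} := by
  rw [theta, LinearMap.sum_apply]
  exact Submodule.sum_mem _ fun σ _ => shift_mem_avoiding hg _ hv

lemma bary_spec {g : Dual ℚ ((Fin d → ℚ) × ℚ)} (hg : IsLower A w g)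
    (hne : (zeros A w g).Nonempty) : newton A w (bary w (zeros A w g)) = baryWeight w ∧
      ord A w (bary w (zeros A w g)) = baryWeight w ∧
      point A w (bary w (zeros A w g)) = Finsupp.weight (gen A w) (baryExp w (zeros A w g)) ∧
      g (point A w (bary w (zeros A w g))) = 0 := by
  have h := newton_deg_of_isLower hg (support_baryExp (w := w) (zeros A w g))
  rw [weight_baryExp hne] at h
  exact h

/-- The regularity of the operators on the lower part of the boundary, where all the points of the
Newton graph lie, follows from the regularity on the faces that meet its interior. -/
theorem regularMod_thetas_bot (hspan : Submodule.span ℚ (Set.range (column A)) = ⊤)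
    (H : ∀ g, IsLower A w g → (∀ f : Dual ℚ ((Fin d → ℚ) × ℚ), (∀ x ∈ epigraph A w, 0 ≤ f x) →
        zeros A w g ⊆ zeros A w f → f ≠ 0 → 0 < f (apex d)) →
      RegularMod (thetas A w (faceDim A w (zeros A w g)))
        (avoiding w {x | x ∈ epigraph A w ∧ g x = 0})) :
    RegularMod (thetas A w d) (⊥ : Submodule ℂ (semigroup A →₀ ℂ)) := by
  classical
  set K : Set ((Fin d → ℚ) × ℚ) := {x | x ∈ epigraph A w} with hK
  have hspan' : ∀ f : Dual ℚ ((Fin d → ℚ) × ℚ), (∀ j, f (gen A w j) = 0) → f (apex d) = 0 →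
      f = 0 := by
    intro f hf hp
    have h1 : f ∘ₗ LinearMap.inl ℚ (Fin d → ℚ) ℚ = 0 := by
      refine LinearMap.ext_on hspan ?_
      rintro _ ⟨j, rfl⟩
      have := hf j
      rw [gen, eq_add_smul_apex, map_add, map_smul, hp, smul_zero, add_zero] at this
      simpa using this
    refine LinearMap.ext fun x => ?_
    have h2 := LinearMap.congr_fun h1 x.1
    rw [LinearMap.comp_apply, LinearMap.inl_apply, LinearMap.zero_apply] at h2
    rw [← Prod.mk.eta (p := x), eq_add_smul_apex, map_add, map_smul, hp, h2]
    simp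
  let I := (ineqs A w).filter fun f => f ≠ 0
  have hI : ∀ f ∈ I, ∀ x ∈ K, 0 ≤ f x := fun f hf x hx =>
    mem_epigraph_iff.1 hx f (Finset.mem_filter.1 hf).1
  let x₀ := ∑ j, gen A w j + apex d
  have hpos : ∀ f ∈ I, 0 < f x₀ := by
    intro f hf
    simp only [x₀, map_add, map_sum]
    have h1 : ∀ j ∈ Finset.univ, 0 ≤ f (gen A w j) := fun j _ => hI f hf _ (gen_mem_epigraph j)
    have h2 : 0 ≤ f (apex d) := hI f hf _ apex_mem_epigraph
    have h3 := Finset.sum_nonneg h1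
    by_contra! hcon
    refine (Finset.mem_filter.1 hf).2 (hspan' f (fun j => ?_) (by linarith))
    exact (Finset.sum_eq_zero_iff_of_nonneg h1).1 (by linarith) j (Finset.mem_univ j)
  have key := sweep (K := K) (D := fun k Z => RegularMod (thetas A w k) (avoiding w Z))
    (S := fun Z => ∀ i, ∀ v ∈ avoiding (A := A) w Z, theta A w i v ∈ avoiding w Z)
    (fun Z => trivial)
    (fun k => by
      have : avoiding (A := A) w ∅ = ⊤ := by simp [avoiding]
      rw [this]
      exact RegularMod.of_eq_top _)
    (fun k Z Z' hZ hZ' h h' hinter => by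
      have hlist : thetas A w (k + 1) = thetas A w k ++ [theta A w (k + 1)] := by
        simp [thetas, List.range_succ]
      have hmem : ∀ y ∈ thetas A w k ++ [theta A w (k + 1)], ∃ i, y = theta A w i := by
        rw [← hlist]
        intro y hy
        obtain ⟨i, -, rfl⟩ := List.mem_map.1 hy
        exact ⟨_, rfl⟩
      rw [hlist] at h h' ⊢
      rw [avoiding_union]
      refine RegularMod.inf ?_ ?_ ?_ h h' (by rwa [← avoiding_inter])
      · intro y hy z hz
        obtain ⟨i, rfl⟩ := hmem y hy
        obtain ⟨j, rfl⟩ := hmem z hz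
        exact theta_commute i j
      · intro y hy
        obtain ⟨i, rfl⟩ := hmem y hy
        exact hZ i
      · intro y hy
        obtain ⟨i, rfl⟩ := hmem y hy
        exact hZ' i)
    (fun i v _ => by
      have : avoiding (A := A) w ∅ = ⊤ := by simp [avoiding]
      rw [this]
      trivial)
    (fun Z Z' h h' i v hv => by
      rw [avoiding_union] at hv ⊢
      exact ⟨h i v hv.1, h' i v hv.2⟩)
    (fun g hg i v hv => theta_mem_avoiding hg i hv)
    d ⊤ (by rw [finrank_top]; simp) 0 (fun _ _ => le_rfl) I hI
    (fun x => by
      simp only [Set.mem_ofPred_eq, LinearMap.zero_apply, and_true, Submodule.mem_top, true_and,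
        hK, mem_epigraph_iff]
      refine ⟨fun h f hf => h f (Finset.mem_filter.1 hf).1, fun h f hf => ?_⟩
      by_cases h0 : f = 0
      · simp [h0]
      · exact h f (Finset.mem_filter.2 ⟨hf, h0⟩))
    x₀ trivial hpos (apex d) trivial
    (fun g hg hgp _ hint => by
      have hlow : IsLower A w g := ⟨hg, hgp⟩
      have h1 := span_zeros hlow
      have h2 : finrank ℚ (Submodule.span ℚ {x | x ∈ K ∧ g x = 0}) =
          faceDim A w (zeros A w g) := by
        rw [faceDim, ← h1]
        rfl
      rw [h2]
      refine H g hlow fun f hf hz hne => hint f (fun x hx _ => hf x hx) (fun x hx hgx => ?_) ?_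
      · obtain ⟨c, -, hc0, rfl⟩ := exists_eq_sum_of_isLower hlow hx hgx
        rw [map_sum]
        refine Finset.sum_eq_zero fun j _ => ?_
        by_cases hj : j ∈ zeros A w g
        · rw [map_smul, mem_zeros.1 (hz hj), smul_zero]
        · rw [hc0 j hj, zero_smul, map_zero]
      · by_contra! hcon
        exact hne (LinearMap.ext fun x => hcon x trivial))
  convert key using 1
  symm
  have hempty : {a : semigroup A | point A w a ∉
      visible {x | x ∈ K ∧ (0 : Dual ℚ ((Fin d → ℚ) × ℚ)) x = 0} (apex d)} = ∅ := by
    refine Set.eq_empty_of_forall_notMem fun a ha => ha ⟨⟨point_mem_epigraph a, rfl⟩, ?_⟩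
    intro ε hε hmem
    obtain ⟨f, hf, hpos, h0⟩ := exists_lower_point (w := w) a
    have h1 := mem_epigraph_iff.1 hmem.1 f hf
    rw [map_sub, map_smul, h0, zero_sub, smul_eq_mul] at h1
    nlinarith
  rw [avoiding, hempty, Finsupp.supported_empty]

end Operators

end ToricGr

/-! ### Algebras with a monomial basis -/

namespace ToricGr

open Module

variable {d n : ℕ} {A : Matrix (Fin d) (Fin n) ℤ} {w : Fin n → ℕ}
  {g : Dual ℚ ((Fin d → ℚ) × ℚ)}

lemma face_add_mem (hg : ∀ x ∈ epigraph A w, 0 ≤ g x) {a b : semigroup A}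
    (ha : g (point A w a) = 0) (hb : g (point A w b) = 0) : g (point A w (a + b)) = 0 := by
  have h1 : point A w a + point A w b = point A w (a + b) +
      (newton A w a + newton A w b - newton A w (a + b)) • apex d := by
    ext <;> simp [point, apex]
  have h2 := congrArg g h1
  rw [map_add, map_add, map_smul, ha, hb, smul_eq_mul] at h2
  have h3 := hg _ (point_mem_epigraph (w := w) (a + b))
  have h4 := mul_nonneg (sub_nonneg.2 (newton_add_le (w := w) a b)) (hg _ apex_mem_epigraph)
  linarith

lemma face_of_add_mem (hg : ∀ x ∈ epigraph A w, 0 ≤ g x) {a b : semigroup A}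
    (h : newton A w a + newton A w b = newton A w (a + b)) (hab : g (point A w (a + b)) = 0) :
    g (point A w a) = 0 ∧ g (point A w b) = 0 := by
  rw [point_add h, map_add] at hab
  have h1 := hg _ (point_mem_epigraph (w := w) a)
  have h2 := hg _ (point_mem_epigraph (w := w) b)
  constructor <;> linarith

/-- On a lower face the Newton function is additive. -/
lemma newton_add_of_face (hg : IsLower A w g) {a b : semigroup A}
    (ha : g (point A w a) = 0) (hb : g (point A w b) = 0) :
    newton A w a + newton A w b = newton A w (a + b) := by
  have h1 : point A w a + point A w b = point A w (a + b) +
      (newton A w a + newton A w b - newton A w (a + b)) • apex d := by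
    ext <;> simp [point, apex]
  have h2 := congrArg g h1
  rw [map_add, map_add, map_smul, ha, hb, smul_eq_mul, face_add_mem hg.nonneg ha hb] at h2
  have h3 := hg.apex_pos
  have h4 : newton A w a + newton A w b - newton A w (a + b) = 0 := by
    rcases mul_eq_zero.1 (show (newton A w a + newton A w b - newton A w (a + b)) * g (apex d) = 0
      by linarith) with h | h
    · exact h
    · exact absurd h h3.ne'
  linarith

variable (A w) in
open Classical in
/-- `e` exhibits `B` as the algebra with a basis indexed by the semigroup elements above the face
`g = 0` of the epigraph, in which the product of the basis elements of `a` and `b` is that of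
`a + b` if the filtration order is additive on `a` and `b`, and zero otherwise. For `g = 0` this is
the associated graded ring of the semigroup ring. The elements off the face are sent to zero. -/
structure IsFaceAlgebra (g : Dual ℚ ((Fin d → ℚ) × ℚ)) {B : Type*} [CommRing B] [Algebra ℂ B]
    (e : semigroup A → B) : Prop where
  nonneg : ∀ x ∈ epigraph A w, 0 ≤ g x
  e_zero : e 0 = 1
  eq_zero : ∀ a, g (point A w a) ≠ 0 → e a = 0
  mul : ∀ a b, g (point A w a) = 0 → g (point A w b) = 0 →
    e a * e b = if ord A w a + ord A w b = ord A w (a + b) then e (a + b) else 0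
  linearIndependent : LinearIndependent ℂ fun a : {a // g (point A w a) = 0} => e a
  span_range : Submodule.span ℂ (Set.range e) = ⊤

variable (A w) in
/-- The sum of the basis elements of the barycentres of the lower faces of dimension `i`. -/
noncomputable def parameter {B : Type*} [CommRing B] (e : semigroup A → B) (i : ℕ) : B :=
  ∑ σ ∈ facesOfDim A w i, e (bary w σ)

variable (A w) in
/-- The parameters attached to the dimensions `1, …, r`. -/
noncomputable def parameters {B : Type*} [CommRing B] (e : semigroup A → B) (r : ℕ) : List B :=
  (List.range r).map fun i => parameter A w e (i + 1)

lemma ord_bary {σ : Finset (Fin n)} (hσ : σ ∈ lowerFaces A w) (hne : σ.Nonempty) :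
    newton A w (bary w σ) = baryWeight w ∧ ord A w (bary w σ) = baryWeight w ∧
      point A w (bary w σ) = Finsupp.weight (gen A w) (baryExp w σ) := by
  obtain ⟨f, hf, rfl⟩ := mem_lowerFaces.1 hσ
  exact ⟨(bary_spec hf hne).1, (bary_spec hf hne).2.1, (bary_spec hf hne).2.2.1⟩

lemma nonempty_of_mem_facesOfDim {i : ℕ} {σ : Finset (Fin n)} (h : σ ∈ facesOfDim A w (i + 1)) :
    σ.Nonempty := by
  rw [Finset.nonempty_iff_ne_empty]
  rintro rfl
  have := (mem_facesOfDim.1 h).2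
  rw [faceDim_empty] at this
  omega

lemma newton_nsmul_le (m : ℕ) (a : semigroup A) : newton A w (m • a) ≤ m * newton A w a := by
  induction m with
  | zero => simp [newton_zero]
  | succ m ih =>
    rw [succ_nsmul]
    have := newton_add_le (w := w) (m • a) a
    push_cast
    linarith

namespace IsFaceAlgebra

variable {B : Type*} [CommRing B] [Algebra ℂ B] {e : semigroup A → B}

lemma mul_eq_zero_or (h : IsFaceAlgebra A w g e) (a b : semigroup A) :
    e a * e b = 0 ∨ (g (point A w a) = 0 ∧ g (point A w b) = 0 ∧
      ord A w a + ord A w b = ord A w (a + b) ∧ e a * e b = e (a + b)) := by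
  by_cases ha : g (point A w a) = 0
  · by_cases hb : g (point A w b) = 0
    · rw [h.mul a b ha hb]
      split_ifs with hab
      · exact Or.inr ⟨ha, hb, hab, rfl⟩
      · exact Or.inl rfl
    · rw [h.eq_zero b hb, mul_zero]
      exact Or.inl rfl
  · rw [h.eq_zero a ha, zero_mul]
    exact Or.inl rfl

lemma pow_eq_zero_or (h : IsFaceAlgebra A w g e) (a : semigroup A) (m : ℕ) :
    e a ^ m = 0 ∨ (m * ord A w a = ord A w (m • a) ∧ e a ^ m = e (m • a)) := by
  induction m with
  | zero => simp [h.e_zero, ord_zero]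
  | succ m ih =>
    rcases ih with ih | ⟨h1, h2⟩
    · left
      rw [pow_succ, ih, zero_mul]
    · rw [pow_succ, h2, succ_nsmul]
      rcases h.mul_eq_zero_or (m • a) a with h3 | ⟨-, -, h3, h4⟩
      · exact Or.inl h3
      · right
        exact ⟨by rw [← h3, ← h1]; ring, h4⟩

/-- A nonzero power of a basis element other than `1` is divisible by the basis element of the
barycentre of the minimal lower face below it. -/
lemma exists_pow_eq (h : IsFaceAlgebra A w g e) {a : semigroup A} (ha : a ≠ 0) :
    ∃ f, IsLower A w f ∧ f (point A w a) = 0 ∧ (zeros A w f).Nonempty ∧ ∃ m ≠ 0,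
      e a ^ m = 0 ∨ (newton A w a = ord A w a ∧ e (bary w (zeros A w f)) ∣ e a ^ m) := by
  obtain ⟨g₁, hg₁, hg₁a⟩ := exists_isLower_point (w := w) a
  obtain ⟨f, hf, hfa, hne, m, u, hm, hu, hmu⟩ := exists_minimal_face ha hg₁ hg₁a
  refine ⟨f, hf, hfa, hne, m, hm.ne', ?_⟩
  refine (h.pow_eq_zero_or a m).imp_right fun hpow => ?_
  have h1 := bary_spec hf hne
  have h2 := newton_deg_of_isLower hf hu
  have h3 := newton_deg_of_isLower hf (u := baryExp w (zeros A w f) + u)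
    (Finsupp.support_add.trans (Finset.union_subset (support_baryExp _) hu))
  rw [map_add, map_add, ← hmu] at h3
  have hord : ord A w (bary w (zeros A w f)) + ord A w (deg A u) = ord A w (m • a) := by
    rw [h3.2.1, h2.2.1, bary, (newton_deg_of_isLower hf (support_baryExp _)).2.1]
  have hnewton : newton A w (bary w (zeros A w f)) + newton A w (deg A u) =
      newton A w (m • a) := by
    rw [h3.1, h2.1, bary, (newton_deg_of_isLower hf (support_baryExp _)).1]
    push_cast
    rfl
  have hmu' : m • a = bary w (zeros A w f) + deg A u := hmu
  constructor
  · have h4 := newton_nsmul_le (w := w) m a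
    have h5 : newton A w (m • a) = ord A w (m • a) := by rw [h3.1, h3.2.1]
    have h6 := newton_le_ord (w := w) a
    rw [h5, ← hpow.1] at h4
    push_cast at h4
    exact le_antisymm h6 (le_of_mul_le_mul_left h4 (by exact_mod_cast hm))
  · rw [hpow.2]
    by_cases hga : g (point A w (m • a)) = 0
    · rw [hmu'] at hga hord hnewton
      obtain ⟨h7, h8⟩ := face_of_add_mem h.nonneg hnewton hga
      have h9 := h.mul _ _ h7 h8
      rw [if_pos hord, ← hmu'] at h9
      exact ⟨_, h9.symm⟩
    · rw [h.eq_zero _ hga]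
      exact dvd_zero _

/-- A prime ideal that contains the parameters contains the basis elements of all barycentres: it
suffices to multiply a parameter by the basis element of one of its barycentres, since the mixed
products are nilpotent modulo the barycentres of larger faces. -/
lemma bary_mem_of_parameter_mem (h : IsFaceAlgebra A w g e) (hw : ∀ j, 0 < w j) {r : ℕ}
    (hr : ∀ σ ∈ lowerFaces A w, σ.Nonempty → g (point A w (bary w σ)) = 0 → faceDim A w σ ≤ r)
    {q : Ideal B} [q.IsPrime] (hq : ∀ i < r, parameter A w e (i + 1) ∈ q)
    {σ : Finset (Fin n)} (hσ : σ ∈ lowerFaces A w) (hne : σ.Nonempty) : e (bary w σ) ∈ q := by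
  classical
  induction hk : r - faceDim A w σ using Nat.strong_induction_on generalizing σ with
  | _ k ih =>
    by_cases hgσ : g (point A w (bary w σ)) = 0
    swap
    · rw [h.eq_zero _ hgσ]
      exact zero_mem _
    have hle := hr σ hσ hne hgσ
    obtain ⟨i, hi⟩ := Nat.exists_eq_succ_of_ne_zero (faceDim_pos (A := A) hw hne).ne'
    have hσi : σ ∈ facesOfDim A w (i + 1) := mem_facesOfDim.2 ⟨hσ, hi⟩
    have hmem := q.mul_mem_right (e (bary w σ)) (hq i (by omega))
    have hcross : ∀ σ' ∈ (facesOfDim A w (i + 1)).erase σ,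
        e (bary w σ') * e (bary w σ) ∈ q := by
      intro σ' hσ'
      obtain ⟨hne', hσ'i⟩ := Finset.mem_erase.1 hσ'
      have hnonempty' := nonempty_of_mem_facesOfDim hσ'i
      have hb := ord_bary hσ hne
      have hb' := ord_bary (mem_facesOfDim.1 hσ'i).1 hnonempty'
      rcases h.mul_eq_zero_or (bary w σ') (bary w σ) with h0 | ⟨h1, h2, h3, h4⟩
      · rw [h0]
        exact zero_mem _
      rw [h4]
      have ha : bary (A := A) w σ' + bary w σ ≠ 0 := by
        intro h0
        rw [h0, ord_zero, hb.2.1] at h3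
        have := baryWeight_pos hw
        omega
      obtain ⟨f, hf, hfa, hfne, m, hm, hpow⟩ := h.exists_pow_eq ha
      refine Ideal.IsPrime.mem_of_pow_mem ‹_› m ?_
      rcases hpow with h0 | ⟨hord, hdvd⟩
      · rw [h0]
        exact zero_mem _
      refine Ideal.mem_of_dvd _ hdvd ?_
      by_cases hgf : g (point A w (bary w (zeros A w f))) = 0
      swap
      · rw [h.eq_zero _ hgf]
        exact zero_mem _
      have hle' := hr _ (mem_lowerFaces.2 ⟨f, hf, rfl⟩) hfne hgf
      refine ih _ ?_ (mem_lowerFaces.2 ⟨f, hf, rfl⟩) hfne rfl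
      have hadd : newton A w (bary w σ') + newton A w (bary w σ) =
          newton A w (bary w σ' + bary w σ) := by
        rw [hord, ← h3, hb.1, hb'.1, hb.2.1, hb'.2.1]
        push_cast
        rfl
      obtain ⟨h5, h6⟩ := face_of_add_mem hf.nonneg hadd hfa
      have hsub := subset_zeros_of_bary hw hf.nonneg (by rw [← hb.2.2, h6])
      have hsub' := subset_zeros_of_bary hw hf.nonneg (by rw [← hb'.2.2, h5])
      have hlt : faceDim A w σ < faceDim A w (zeros A w f) := by
        obtain ⟨f₁, -, hf₁⟩ := mem_lowerFaces.1 hσ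
        refine faceDim_lt f₁ hf₁.symm (Finset.ssubset_iff_subset_ne.2 ⟨hsub, fun heq => ?_⟩)
        obtain ⟨f₂, -, hf₂⟩ := mem_lowerFaces.1 (mem_facesOfDim.1 hσ'i).1
        have := faceDim_lt (A := A) (w := w) f₂ hf₂.symm
          (Finset.ssubset_iff_subset_ne.2 ⟨heq ▸ hsub', hne'⟩)
        rw [(mem_facesOfDim.1 hσ'i).2, hi] at this
        exact lt_irrefl _ this
      omega
    rw [parameter, Finset.sum_mul, ← Finset.add_sum_erase _ _ hσi] at hmem
    have hsq := (q.add_mem_iff_left (Submodule.sum_mem q hcross)).1 hmem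
    exact (Ideal.IsPrime.mem_or_mem ‹_› hsq).elim id id

/-- A prime ideal that contains the parameters contains all the basis elements except `1`. -/
theorem mem_of_parameter_mem (h : IsFaceAlgebra A w g e) (hw : ∀ j, 0 < w j) {r : ℕ}
    (hr : ∀ σ ∈ lowerFaces A w, σ.Nonempty → g (point A w (bary w σ)) = 0 → faceDim A w σ ≤ r)
    {q : Ideal B} [q.IsPrime] (hq : ∀ i < r, parameter A w e (i + 1) ∈ q)
    {a : semigroup A} (ha : a ≠ 0) : e a ∈ q := by
  obtain ⟨f, hf, -, hne, m, hm, hpow⟩ := h.exists_pow_eq ha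
  refine Ideal.IsPrime.mem_of_pow_mem ‹_› m ?_
  rcases hpow with h0 | ⟨-, hdvd⟩
  · rw [h0]
    exact zero_mem _
  · exact Ideal.mem_of_dvd _ hdvd
      (h.bary_mem_of_parameter_mem hw hr hq (mem_lowerFaces.2 ⟨f, hf, rfl⟩) hne)

end IsFaceAlgebra

end ToricGr

namespace ToricGr

open Module IsLocalRing RingTheory.Sequence

/-! ### Regularity of the parameters on the algebra of a face -/

namespace IsFaceAlgebra

variable {d n : ℕ} {A : Matrix (Fin d) (Fin n) ℤ} {w : Fin n → ℕ}
  {g : Dual ℚ ((Fin d → ℚ) × ℚ)} {B : Type*} [CommRing B] [Algebra ℂ B] {e : semigroup A → B}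

/-- The monomial basis. -/
noncomputable def basis (h : IsFaceAlgebra A w g e) : Basis {a // g (point A w a) = 0} ℂ B :=
  Basis.mk h.linearIndependent <| by
    rw [← h.span_range, Submodule.span_le]
    rintro _ ⟨a, rfl⟩
    by_cases ha : g (point A w a) = 0
    · exact Submodule.subset_span ⟨⟨a, ha⟩, rfl⟩
    · rw [h.eq_zero a ha]
      exact zero_mem _

lemma basis_apply (h : IsFaceAlgebra A w g e) (a : {a // g (point A w a) = 0}) :
    h.basis a = e a := Basis.mk_apply _ _ _

lemma point_zero_mem (g : Dual ℚ ((Fin d → ℚ) × ℚ)) : g (point A w 0) = 0 := by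
  have : point A w 0 = 0 := by ext <;> simp [point, newton_zero]
  rw [this, map_zero]

lemma basis_zero (h : IsFaceAlgebra A w g e) : h.basis ⟨0, point_zero_mem g⟩ = 1 := by
  rw [basis_apply, h.e_zero]

/-- The grading by the filtration order. -/
noncomputable def grading (h : IsFaceAlgebra A w g e) : Grading ℂ B :=
  Grading.ofBasis h.basis fun a => ord A w a

open Classical in
lemma grading_comp (h : IsFaceAlgebra A w g e) (i : ℕ) (a : semigroup A) :
    h.grading.comp i (e a) = if ord A w a = i then e a else 0 := by
  by_cases ha : g (point A w a) = 0
  · have := Grading.ofBasis_comp h.basis (fun a => ord A w a) i ⟨a, ha⟩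
    rwa [basis_apply] at this
  · rw [h.eq_zero a ha, map_zero, ite_self]

/-- The filtration order defines a grading of the ring. -/
lemma grading_comp_mul (h : IsFaceAlgebra A w g e) (i : ℕ) (x y : B) : h.grading.comp i (x * y) =
    ∑ p ∈ Finset.HasAntidiagonal.antidiagonal i, h.grading.comp p.1 x * h.grading.comp p.2 y := by
  classical
  have hspan : ∀ z : B, z ∈ Submodule.span ℂ (Set.range e) := fun z => by
    rw [h.span_range]
    trivial
  induction hspan x using Submodule.span_induction with
  | zero => simp
  | add x₁ x₂ _ _ h₁ h₂ => simp only [add_mul, map_add, h₁, h₂, Finset.sum_add_distrib]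
  | smul c x _ hx => simp only [smul_mul_assoc, map_smul, hx, Finset.smul_sum]
  | mem x hx =>
    obtain ⟨a, rfl⟩ := hx
    induction hspan y using Submodule.span_induction with
    | zero => simp
    | add x₁ x₂ _ _ h₁ h₂ => simp only [mul_add, map_add, h₁, h₂, Finset.sum_add_distrib]
    | smul c x _ hx => simp only [mul_smul_comm, map_smul, hx, Finset.smul_sum]
    | mem x hx =>
      obtain ⟨b, rfl⟩ := hx
      have hr : ∑ p ∈ Finset.HasAntidiagonal.antidiagonal i,
          h.grading.comp p.1 (e a) * h.grading.comp p.2 (e b) =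
          if ord A w a + ord A w b = i then e a * e b else 0 := by
        simp only [grading_comp]
        split_ifs with hi
        · rw [Finset.sum_eq_single (ord A w a, ord A w b)]
          · simp
          · rintro ⟨p, q⟩ - hpq
            by_cases hp : ord A w a = p
            · rw [if_neg (c := ord A w b = q), mul_zero]
              rintro rfl
              exact hpq (by rw [hp])
            · rw [if_neg hp, zero_mul]
          · intro hmem
            exact absurd (Finset.HasAntidiagonal.mem_antidiagonal.2 hi) hmem
        · refine Finset.sum_eq_zero fun p hp => ?_
          have := Finset.HasAntidiagonal.mem_antidiagonal.1 hp
          by_cases h1 : ord A w a = p.1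
          · rw [if_neg (c := ord A w b = p.2) (by omega), mul_zero]
          · rw [if_neg h1, zero_mul]
      rw [hr]
      rcases h.mul_eq_zero_or a b with h0 | ⟨-, -, h1, h2⟩
      · rw [h0, map_zero, ite_self]
      · rw [h2, grading_comp, h1]

lemma grading_comp_zero (h : IsFaceAlgebra A w g e) (hw : ∀ j, 0 < w j) (x : B) :
    h.grading.comp 0 x = h.basis.repr x ⟨0, point_zero_mem g⟩ • 1 := by
  classical
  have H : h.grading.comp 0 =
      (LinearMap.toSpanSingleton ℂ B 1) ∘ₗ h.basis.coord ⟨0, point_zero_mem g⟩ := by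
    refine h.basis.ext fun a => ?_
    rw [LinearMap.comp_apply, Basis.coord_apply, Basis.repr_self, basis_apply, grading_comp]
    by_cases ha : a = ⟨0, point_zero_mem g⟩
    · subst ha
      simp [ord_zero, h.e_zero]
    · rw [Finsupp.single_eq_of_ne (Ne.symm ha), map_zero, if_neg]
      exact (ord_pos hw fun h0 => ha (Subtype.ext h0)).ne'
  exact LinearMap.congr_fun H x

/-- A homogeneous ideal is saturated with respect to the elements with nonzero constant
coefficient. -/
lemma mem_of_mul_mem (h : IsFaceAlgebra A w g e) (hw : ∀ j, 0 < w j) {J : Submodule ℂ B}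
    (hJ : ∀ i, ∀ v ∈ J, h.grading.comp i v ∈ J) (hJmul : ∀ x, ∀ v ∈ J, x * v ∈ J) {s r : B}
    (hs : h.basis.repr s ⟨0, point_zero_mem g⟩ ≠ 0) (hr : s * r ∈ J) : r ∈ J := by
  refine h.grading.mem_of_comp_mem fun i => ?_
  induction i using Nat.strong_induction_on with
  | _ i ih =>
    have h1 := hJ i _ hr
    rw [grading_comp_mul, ← Finset.add_sum_erase _ _
      (show (0, i) ∈ Finset.HasAntidiagonal.antidiagonal i by simp)] at h1
    have h2 := (Submodule.add_mem_iff_left J (Submodule.sum_mem J fun p hp => ?_)).1 h1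
    · rw [h.grading_comp_zero hw, smul_mul_assoc, one_mul] at h2
      exact (Submodule.smul_mem_iff J hs).1 h2
    · obtain ⟨hne, hp⟩ := Finset.mem_erase.1 hp
      have hp' := Finset.HasAntidiagonal.mem_antidiagonal.1 hp
      refine hJmul _ _ (ih _ ?_)
      have : p.1 ≠ 0 := fun h0 => hne (Prod.ext h0 (by simp; omega))
      omega

/-- The prime ideals attached to the faces. Sending the basis element of `a` to the monomial of `a`
if `a` lies above the face `f = 0` and its order agrees with the Newton function, and to zero
otherwise, defines a homomorphism into a Laurent polynomial ring. -/
lemma exists_prime (h : IsFaceAlgebra A w g e) (hg : IsLower A w g)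
    {f : Dual ℚ ((Fin d → ℚ) × ℚ)} (hf : ∀ x ∈ epigraph A w, 0 ≤ f x) :
    ∃ p : Ideal B, p.IsPrime ∧ ∀ x, x ∈ p ↔ ∀ a : {a // g (point A w a) = 0},
      newton A w a = ord A w a → f (point A w a) = 0 → h.basis.repr x a = 0 := by
  classical
  -- the Newton function is additive on the face `g = 0`; hence the order is additive on elements
  -- with `P`, whose sum has `P` again, and conversely `P` passes to summands on which it is additive
  let P : semigroup A → Prop := fun a => newton A w a = ord A w a ∧ f (point A w a) = 0
  have hP : ∀ a b, g (point A w a) = 0 → g (point A w b) = 0 →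
      ((ord A w a + ord A w b = ord A w (a + b) ∧ P (a + b)) ↔ P a ∧ P b) := by
    intro a b ha hb
    have hadd := newton_add_of_face hg ha hb
    have h1 := newton_le_ord (w := w) a
    have h2 := newton_le_ord (w := w) b
    constructor
    · rintro ⟨ho, hn, hfab⟩
      have ho' : (ord A w a : ℚ) + ord A w b = ord A w (a + b) := by exact_mod_cast ho
      obtain ⟨h3, h4⟩ := face_of_add_mem hf hadd hfab
      exact ⟨⟨by linarith, h3⟩, ⟨by linarith, h4⟩⟩
    · rintro ⟨⟨h3, h4⟩, ⟨h5, h6⟩⟩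
      have h7 := newton_le_ord (w := w) (a + b)
      have h8 : (ord A w (a + b) : ℚ) ≤ ord A w a + ord A w b := by exact_mod_cast ord_add_le a b
      refine ⟨?_, by linarith, face_add_mem hf h4 h6⟩
      exact_mod_cast (by linarith : (ord A w a : ℚ) + ord A w b = ord A w (a + b))
  let φ : B →ₗ[ℂ] AddMonoidAlgebra ℂ (Fin d → ℤ) := h.basis.constr ℂ fun a =>
    if P a then AddMonoidAlgebra.single (a : Fin d → ℤ) 1 else 0
  have hφ : ∀ a, g (point A w a) = 0 → φ (e a) =
      if P a then AddMonoidAlgebra.single (a : Fin d → ℤ) 1 else 0 := by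
    intro a ha
    rw [← h.basis_apply ⟨a, ha⟩, Basis.constr_basis]
  have hone : φ 1 = 1 := by
    rw [← h.e_zero, hφ 0 (point_zero_mem g), if_pos ⟨by simp [newton_zero, ord_zero],
      point_zero_mem f⟩]
    rfl
  have hmul : ∀ x y, φ (x * y) = φ x * φ y := by
    have H : (LinearMap.mul ℂ B).compr₂ φ =
        (LinearMap.mul ℂ (AddMonoidAlgebra ℂ (Fin d → ℤ))).compl₁₂ φ φ := by
      refine h.basis.ext fun a => h.basis.ext fun b => ?_
      simp only [LinearMap.compr₂_apply, LinearMap.mul_apply', LinearMap.compl₁₂_apply,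
        basis_apply]
      rw [h.mul _ _ a.2 b.2, hφ _ a.2, hφ _ b.2]
      have hab := hP _ _ a.2 b.2
      by_cases h1 : P a ∧ P b
      · obtain ⟨h2, h3⟩ := hab.2 h1
        rw [if_pos h2, hφ _ (face_add_mem h.nonneg a.2 b.2), if_pos h3, if_pos h1.1, if_pos h1.2,
          AddMonoidAlgebra.single_mul_single, mul_one]
        rfl
      · have h2 : (if P a then (AddMonoidAlgebra.single ((a : semigroup A) : Fin d → ℤ) 1 :
            AddMonoidAlgebra ℂ (Fin d → ℤ)) else 0) *
            (if P b then AddMonoidAlgebra.single ((b : semigroup A) : Fin d → ℤ) 1 else 0) = 0 := by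
          by_cases h3 : P a
          · rw [if_neg (c := P b) (fun h4 => h1 ⟨h3, h4⟩), mul_zero]
          · rw [if_neg h3, zero_mul]
        rw [h2]
        by_cases h3 : ord A w a + ord A w b = ord A w (a + b)
        · rw [if_pos h3, hφ _ (face_add_mem h.nonneg a.2 b.2), if_neg fun h4 => h1 (hab.1 ⟨h3, h4⟩)]
        · rw [if_neg h3, map_zero]
    intro x y
    exact LinearMap.congr_fun (LinearMap.congr_fun H x) y
  let ψ : B →ₐ[ℂ] AddMonoidAlgebra ℂ (Fin d → ℤ) := AlgHom.ofLinearMap φ hone hmul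
  refine ⟨RingHom.ker ψ, RingHom.ker_isPrime _, fun x => ?_⟩
  have hcoeff : ∀ a : {a // g (point A w a) = 0}, P a →
      ∀ x, (φ x).coeff (a : Fin d → ℤ) = h.basis.repr x a := by
    intro a ha x
    have H : Finsupp.lapply ((a : semigroup A) : Fin d → ℤ) ∘ₗ
        (AddMonoidAlgebra.coeffLinearEquiv ℂ).toLinearMap ∘ₗ φ = h.basis.coord a := by
      refine h.basis.ext fun b => ?_
      rw [LinearMap.comp_apply, LinearMap.comp_apply, Basis.coord_apply, Basis.repr_self,
        basis_apply, hφ _ b.2]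
      by_cases hab : b = a
      · subst hab
        rw [if_pos ha, Finsupp.single_eq_same]
        exact Finsupp.single_eq_same
      · rw [Finsupp.single_eq_of_ne (Ne.symm hab)]
        split_ifs
        · exact Finsupp.single_eq_of_ne fun h' => hab (Subtype.ext (Subtype.ext h'.symm))
        · rfl
    exact LinearMap.congr_fun H x
  rw [RingHom.mem_ker]
  constructor
  · intro hx a h1 h2
    rw [← hcoeff a ⟨h1, h2⟩, show φ x = 0 from hx]
    rfl
  · intro hx
    refine (Basis.constr_apply h.basis ℂ _ x).trans (Finset.sum_eq_zero fun a _ => ?_)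
    beta_reduce
    split_ifs with ha
    · rw [hx a ha.1 ha.2, zero_smul]
    · exact smul_zero _

/-- A flag of faces yields a chain of prime ideals. -/
lemma exists_prime_le_height (h : IsFaceAlgebra A w g e) (hw : ∀ j, 0 < w j) (hg : IsLower A w g)
    {j : ℕ} (hj : j ≤ faceDim A w (zeros A w g)) :
    ∃ (f : Dual ℚ ((Fin d → ℚ) × ℚ)) (p : Ideal B), IsLower A w f ∧ zeros A w f ⊆ zeros A w g ∧
      faceDim A w (zeros A w f) + j = faceDim A w (zeros A w g) ∧ p.IsPrime ∧
      (∀ x, x ∈ p ↔ ∀ a : {a // g (point A w a) = 0},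
        newton A w a = ord A w a → f (point A w a) = 0 → h.basis.repr x a = 0) ∧
      (j : ℕ∞) ≤ p.height := by
  induction j with
  | zero =>
    obtain ⟨p, hp, hpx⟩ := h.exists_prime hg hg.nonneg
    exact ⟨g, p, hg, subset_rfl, rfl, hp, hpx, by simp⟩
  | succ j ih =>
    obtain ⟨f, p, hf, hfg, hdim, hp, hpx, hle⟩ := ih (by omega)
    obtain ⟨i, hi⟩ : ∃ i, faceDim A w (zeros A w f) = i + 1 :=
      Nat.exists_eq_succ_of_ne_zero (by omega)
    obtain ⟨ρ, hρ, hlt, hρi⟩ := exists_facet hw (mem_lowerFaces.2 ⟨f, hf, rfl⟩) hi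
    obtain ⟨f', hf', rfl⟩ := mem_lowerFaces.1 hρ
    obtain ⟨p', hp', hpx'⟩ := h.exists_prime hg hf'.nonneg
    refine ⟨f', p', hf', hlt.1.trans hfg, by omega, hp', hpx', ?_⟩
    have hne : (zeros A w f).Nonempty := by
      rw [Finset.nonempty_iff_ne_empty]
      intro h0
      rw [h0, faceDim_empty] at hi
      omega
    have hb := bary_spec hf hne
    have hbg : g (point A w (bary w (zeros A w f))) = 0 :=
      (newton_deg_of_isLower hg ((support_baryExp (w := w) _).trans hfg)).2.2.2
    have hlt' : p < p' := by
      refine lt_of_le_of_ne (fun x hx => (hpx' x).2 fun a ha hfa => ?_) fun heq => ?_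
      · refine (hpx x).1 hx a ha ?_
        obtain ⟨c, -, hc0, hc⟩ := exists_eq_sum_of_isLower hf' (point_mem_epigraph _) hfa
        rw [hc, map_sum]
        refine Finset.sum_eq_zero fun k _ => ?_
        by_cases hk : k ∈ zeros A w f'
        · rw [map_smul, mem_zeros.1 (hlt.1 hk), smul_zero]
        · rw [hc0 k hk, zero_smul, map_zero]
      · have hmem : e (bary w (zeros A w f)) ∈ p' := by
          rw [hpx', ← h.basis_apply ⟨_, hbg⟩]
          intro a _ hfa
          rw [Basis.repr_self, Finsupp.single_eq_of_ne]
          rintro rfl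
          refine hlt.2 (subset_zeros_of_bary hw hf'.nonneg ?_)
          rw [← hb.2.2.1]
          exact hfa.le
        rw [← heq, hpx, ← h.basis_apply ⟨_, hbg⟩] at hmem
        have := hmem ⟨_, hbg⟩ (by rw [hb.1, hb.2.1]) hb.2.2.2
        rw [Basis.repr_self, Finsupp.single_eq_same] at this
        exact one_ne_zero this
    have := Ideal.height_add_one_le_of_lt_of_isPrime hlt'
    push_cast
    exact (add_le_add_left hle 1).trans this

/-- The ideal spanned by the basis elements other than `1`. -/
lemma exists_augmentation (h : IsFaceAlgebra A w g e) (hw : ∀ j, 0 < w j) (hg : IsLower A w g) :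
    ∃ M : Ideal B, M.IsMaximal ∧ (∀ x, x ∈ M ↔ h.basis.repr x ⟨0, point_zero_mem g⟩ = 0) ∧
      (faceDim A w (zeros A w g) : ℕ∞) ≤ M.height := by
  obtain ⟨f, M, hf, -, hdim, hM, hMx, hle⟩ := h.exists_prime_le_height hw hg le_rfl
  have hempty : zeros A w f = ∅ := by
    by_contra h0
    have := faceDim_pos (A := A) hw (Finset.nonempty_iff_ne_empty.2 h0)
    omega
  have hMx' : ∀ x, x ∈ M ↔ h.basis.repr x ⟨0, point_zero_mem g⟩ = 0 := by
    intro x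
    rw [hMx]
    constructor
    · intro hx
      exact hx _ (by simp [newton_zero, ord_zero]) (point_zero_mem f)
    · rintro hx ⟨a, ha⟩ - hfa
      obtain ⟨c, -, hc0, hc⟩ := exists_eq_sum_of_isLower hf (point_mem_epigraph _) hfa
      have hz : point A w a = 0 := by
        rw [hc]
        refine Finset.sum_eq_zero fun k _ => ?_
        rw [hc0 k (by rw [hempty]; exact Finset.notMem_empty k), zero_smul]
      have ha0 : a = 0 := by
        refine Subtype.ext (funext fun i => ?_)
        have := congrFun (congrArg Prod.fst hz) i
        simpa [point] using this
      subst ha0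
      exact hx
  refine ⟨M, Ideal.isMaximal_iff.2 ⟨(Ideal.ne_top_iff_one M).1 hM.ne_top, fun J x hJ hx hxJ => ?_⟩,
    hMx', hle⟩
  have h0 : h.basis.repr x ⟨0, point_zero_mem g⟩ ≠ 0 := fun h0 => hx ((hMx' x).2 h0)
  have h1 : x - h.basis.repr x ⟨0, point_zero_mem g⟩ • 1 ∈ M := by
    rw [hMx', map_sub, map_smul, ← h.basis_zero, Basis.repr_self]
    simp
  have h2 := J.sub_mem hxJ (hJ h1)
  rw [sub_sub_cancel] at h2
  exact (Submodule.smul_mem_iff (J.restrictScalars ℂ) h0).1 h2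

lemma repr_parameter_zero (h : IsFaceAlgebra A w g e) (hw : ∀ j, 0 < w j) (i : ℕ) :
    h.basis.repr (parameter A w e (i + 1)) ⟨0, point_zero_mem g⟩ = 0 := by
  rw [parameter, map_sum, Finsupp.finsetSum_apply]
  refine Finset.sum_eq_zero fun σ hσ => ?_
  have hb := ord_bary (mem_facesOfDim.1 hσ).1 (nonempty_of_mem_facesOfDim hσ)
  by_cases hgσ : g (point A w (bary w σ)) = 0
  · rw [← h.basis_apply ⟨_, hgσ⟩, Basis.repr_self, Finsupp.single_eq_of_ne]
    intro h0
    have h1 : bary w σ = 0 := (congrArg Subtype.val h0).symm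
    have := baryWeight_pos hw
    rw [← hb.2.1, h1, ord_zero] at this
    exact lt_irrefl _ this
  · rw [h.eq_zero _ hgσ, map_zero]
    rfl

lemma isHomogeneousOp_parameter (h : IsFaceAlgebra A w g e) (i : ℕ) :
    h.grading.IsHomogeneousOp (baryWeight w) (LinearMap.mulLeft ℂ (parameter A w e (i + 1))) := by
  refine Grading.isHomogeneousOp_ofBasis _ _ fun a => ?_
  rw [LinearMap.mulLeft_apply, parameter, Finset.sum_mul]
  refine Submodule.sum_mem _ fun σ hσ => ?_
  have hb := ord_bary (mem_facesOfDim.1 hσ).1 (nonempty_of_mem_facesOfDim hσ)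
  rw [basis_apply]
  rcases h.mul_eq_zero_or (bary w σ) a with h0 | ⟨h1, h2, h3, h4⟩
  · rw [h0]
    exact zero_mem _
  · rw [h4, ← h.basis_apply ⟨_, face_add_mem h.nonneg h1 h2⟩]
    refine Submodule.subset_span ⟨_, ?_, rfl⟩
    show ord A w (bary w σ + (a : semigroup A)) = _
    rw [← h3, hb.2.1, add_comm]

/-- Regularity of homogeneous elements may be tested at the augmentation ideal. -/
lemma regularMod_of_localization (h : IsFaceAlgebra A w g e) (hw : ∀ j, 0 < w j)
    {M : Ideal B} [M.IsPrime] (hM : ∀ x, x ∈ M ↔ h.basis.repr x ⟨0, point_zero_mem g⟩ = 0)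
    {l : List B} (hl : ∀ x ∈ l, ∃ D, h.grading.IsHomogeneousOp D (LinearMap.mulLeft ℂ x))
    {J : Ideal B} (hJ : ∀ i, ∀ v ∈ J, h.grading.comp i v ∈ J)
    (hreg : RegularMod ((l.map (algebraMap B (Localization.AtPrime M))).map (LinearMap.mulLeft ℂ))
      ((J.map (algebraMap B (Localization.AtPrime M))).restrictScalars ℂ)) :
    RegularMod (l.map (LinearMap.mulLeft ℂ)) (J.restrictScalars ℂ) := by
  induction l generalizing J with
  | nil => trivial
  | cons x l ih =>
    obtain ⟨h1, h2⟩ := hreg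
    refine ⟨fun v hv => ?_, ?_⟩
    · have hv' : x * v ∈ J := hv
      have h3 := h1 (algebraMap _ _ v) (by
        have := Ideal.mem_map_of_mem (algebraMap B (Localization.AtPrime M)) hv'
        rwa [map_mul] at this)
      obtain ⟨s, hs, hsv⟩ :=
        (IsLocalization.algebraMap_mem_map_algebraMap_iff M.primeCompl _ J v).1 h3
      exact h.mem_of_mul_mem hw (J := J.restrictScalars ℂ) hJ (fun x v hv => J.mul_mem_left x hv)
        (fun h0 => hs ((hM s).2 h0)) hsv
    · rw [restrictScalars_sup_range_mulLeft] at h2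
      rw [restrictScalars_sup_range_mulLeft]
      obtain ⟨D, hD⟩ := hl x List.mem_cons_self
      refine ih (fun y hy => hl y (List.mem_cons_of_mem _ hy)) (fun i v hv => ?_) ?_
      · have := hD.comp_mem_sup_range (U := J.restrictScalars ℂ) hJ i v
        rw [restrictScalars_sup_range_mulLeft] at this
        exact this hv
      · rwa [Ideal.map_sup, Ideal.map_span, Set.image_singleton]

/-- If a prime ideal of the localization at `M` contains the parameters, it is the maximal one. -/
lemma eq_maximalIdeal_of_parameter_mem (h : IsFaceAlgebra A w g e) (hw : ∀ j, 0 < w j)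
    {M : Ideal B} [M.IsPrime] (hM : ∀ x, x ∈ M ↔ h.basis.repr x ⟨0, point_zero_mem g⟩ = 0) {r : ℕ}
    (hr : ∀ σ ∈ lowerFaces A w, σ.Nonempty → g (point A w (bary w σ)) = 0 → faceDim A w σ ≤ r)
    {Q : Ideal (Localization.AtPrime M)} (hQ : Q.IsPrime)
    (hmem : ∀ i < r, algebraMap B (Localization.AtPrime M) (parameter A w e (i + 1)) ∈ Q) :
    Q = maximalIdeal (Localization.AtPrime M) := by
  refine le_antisymm (le_maximalIdeal hQ.ne_top) ?_
  refine Localization.AtPrime.map_eq_maximalIdeal (I := M) ▸ Ideal.map_le_iff_le_comap.2 ?_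
  have : (Q.comap (algebraMap B (Localization.AtPrime M))).IsPrime := Ideal.comap_isPrime _ _
  intro x hx
  rw [hM] at hx
  rw [← h.basis.linearCombination_repr x, Finsupp.linearCombination_apply]
  refine Submodule.sum_mem _ fun a _ => ?_
  beta_reduce
  by_cases ha : a = ⟨0, point_zero_mem g⟩
  · rw [ha, hx, zero_smul]
    exact zero_mem _
  · refine Submodule.smul_of_tower_mem _ _ ?_
    rw [basis_apply]
    exact h.mem_of_parameter_mem hw hr hmem fun h0 => ha (Subtype.ext h0)

lemma faceDim_le_of_bary_mem (hg : IsLower A w g) (hw : ∀ j, 0 < w j) {σ : Finset (Fin n)}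
    (hσ : σ ∈ lowerFaces A w) (hne : σ.Nonempty) (h : g (point A w (bary w σ)) = 0) :
    faceDim A w σ ≤ faceDim A w (zeros A w g) := by
  rw [(ord_bary hσ hne).2.2] at h
  exact Submodule.finrank_mono (Submodule.span_mono (Set.image_mono (Finset.coe_subset.2
    (subset_zeros_of_bary hw hg.nonneg h.le))))

/-- If the algebra of a lower face is Cohen–Macaulay, then the parameters form a regular sequence
on it. -/
theorem regularMod_parameters (h : IsFaceAlgebra A w g e) (hw : ∀ j, 0 < w j)
    (hg : IsLower A w g) (hB : IsCohenMacaulayRing B) :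
    RegularMod ((parameters A w e (faceDim A w (zeros A w g))).map (LinearMap.mulLeft ℂ))
      (⊥ : Submodule ℂ B) := by
  obtain ⟨M, hMmax, hM, hle⟩ := h.exists_augmentation hw hg
  have := hB.1
  have hnoeth : IsNoetherianRing (Localization.AtPrime M) :=
    IsLocalization.isNoetherianRing M.primeCompl _ hB.1
  have hmem : ∀ i, parameter A w e (i + 1) ∈ M := fun i =>
    (hM _).2 (h.repr_parameter_zero hw i)
  have hreg : IsWeaklyRegular (Localization.AtPrime M)
      ((parameters A w e (faceDim A w (zeros A w g))).map
        (algebraMap B (Localization.AtPrime M))) := by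
    refine (hB.2 M).isWeaklyRegular ?_ ?_ ?_
    · intro x hx
      simp only [parameters, List.map_map, List.mem_map, List.mem_range] at hx
      obtain ⟨i, -, rfl⟩ := hx
      rw [← Localization.AtPrime.map_eq_maximalIdeal]
      exact Ideal.mem_map_of_mem _ (hmem i)
    · rw [IsLocalization.AtPrime.ringKrullDim_eq_height M]
      simp only [parameters, List.length_map, List.length_range]
      exact_mod_cast hle
    · intro Q hQ hQmem
      refine h.eq_maximalIdeal_of_parameter_mem hw hM
        (fun σ => faceDim_le_of_bary_mem hg hw) hQ fun i hi => hQmem _ ?_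
      exact List.mem_map_of_mem (List.mem_map.2 ⟨i, List.mem_range.2 hi, rfl⟩)
  have hfin := h.regularMod_of_localization hw hM
    (l := parameters A w e (faceDim A w (zeros A w g))) (J := ⊥) ?_ ?_ ?_
  · simpa using hfin
  · intro x hx
    obtain ⟨i, -, rfl⟩ := List.mem_map.1 hx
    exact ⟨_, h.isHomogeneousOp_parameter i⟩
  · intro i v hv
    rw [Ideal.mem_bot] at hv
    rw [hv, map_zero]
    exact zero_mem _
  · rw [Ideal.map_bot]
    simpa using (regularMod_bot_iff_isWeaklyRegular (k := ℂ) _).2 hreg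

/-- The regularity of the parameters on the algebra of a lower face, in terms of the operators on
the formal sums of semigroup elements. -/
theorem regularMod_thetas (h : IsFaceAlgebra A w g e) (hw : ∀ j, 0 < w j)
    (hg : IsLower A w g) (hB : IsCohenMacaulayRing B) :
    RegularMod (thetas A w (faceDim A w (zeros A w g)))
      (avoiding w {x | x ∈ epigraph A w ∧ g x = 0}) := by
  let β : (semigroup A →₀ ℂ) →ₗ[ℂ] B := Finsupp.linearCombination ℂ e
  have hβ : Function.Surjective β := by
    rw [← LinearMap.range_eq_top, Finsupp.range_linearCombination, h.span_range]
  have hshift : ∀ b v, β (shift w b v) = e b * β v := by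
    intro b v
    have H : β ∘ₗ shift w b = LinearMap.mulLeft ℂ (e b) ∘ₗ β := by
      refine Finsupp.lhom_ext fun a c => ?_
      rw [LinearMap.comp_apply, LinearMap.comp_apply, shift_single, LinearMap.mulLeft_apply,
        Finsupp.linearCombination_single, mul_smul_comm, mul_comm]
      have hsum := total_add_iff (w := w) (a := a) (b := b)
      split_ifs with h1
      · rw [Finsupp.linearCombination_single]
        congr 1
        obtain ⟨h2, h3⟩ := hsum.1 h1
        by_cases hab : g (point A w (a + b)) = 0
        · obtain ⟨h4, h5⟩ := face_of_add_mem h.nonneg h3 hab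
          rw [h.mul a b h4 h5, if_pos h2]
        · rcases h.mul_eq_zero_or a b with h0 | ⟨-, -, -, h0⟩
          · rw [h0, h.eq_zero _ hab]
          · exact h0.symm
      · rw [map_zero]
        rcases h.mul_eq_zero_or a b with h0 | ⟨h2, h3, h4, -⟩
        · rw [h0, smul_zero]
        · exact absurd (hsum.2 ⟨h4, newton_add_of_face hg h2 h3⟩) h1
    exact LinearMap.congr_fun H v
  have hker : avoiding w {x | x ∈ epigraph A w ∧ g x = 0} = (⊥ : Submodule ℂ B).comap β := by
    have hrepr : ∀ (a : {a // g (point A w a) = 0}) v, h.basis.repr (β v) a = v a := by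
      intro a v
      have H : h.basis.coord a ∘ₗ β = Finsupp.lapply (a : semigroup A) := by
        refine Finsupp.lhom_ext fun b c => ?_
        rw [LinearMap.comp_apply, Finsupp.linearCombination_single, map_smul, Basis.coord_apply,
          Finsupp.lapply_apply]
        by_cases hb : g (point A w b) = 0
        · rw [← h.basis_apply ⟨b, hb⟩, Basis.repr_self]
          by_cases hab : b = a
          · subst hab
            simp
          · rw [Finsupp.single_eq_of_ne fun h' => hab (congrArg Subtype.val h').symm,
              Finsupp.single_eq_of_ne (Ne.symm hab), smul_zero]
        · rw [h.eq_zero b hb, map_zero, Finsupp.single_eq_of_ne]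
          · exact smul_zero _
          · rintro rfl
            exact hb a.2
      exact LinearMap.congr_fun H v
    ext v
    rw [Submodule.mem_comap, Submodule.mem_bot, avoiding, Finsupp.mem_supported']
    constructor
    · intro hv
      refine h.basis.ext_elem fun a => ?_
      rw [hrepr, map_zero]
      exact hv _ fun hmem => hmem ⟨point_mem_epigraph _, a.2⟩
    · intro hv a ha
      have ha' : g (point A w a) = 0 := by
        by_contra h0
        exact ha fun hmem => h0 hmem.2
      rw [← hrepr ⟨a, ha'⟩, hv, map_zero]
      rfl
  rw [hker, regularMod_comap_iff hβ (l' := (parameters A w e _).map (LinearMap.mulLeft ℂ)) ?_]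
  · exact h.regularMod_parameters hw hg hB
  · rw [parameters, List.map_map, thetas, List.forall₂_map_left_iff, List.forall₂_map_right_iff,
      List.forall₂_same]
    intro i _ v
    simp only [Function.comp_apply, LinearMap.mulLeft_apply, theta, parameter, LinearMap.sum_apply,
      map_sum, hshift, Finset.sum_mul]

end IsFaceAlgebra

end ToricGr

/-! ### The monomial basis of the graded toric ring -/

namespace ToricGr

open Module MvPolynomial

variable {d n : ℕ} {A : Matrix (Fin d) (Fin n) ℤ} {w : Fin n → ℕ}

open Classical in
variable (A w) in
/-- The linear map that sends a monomial to the semigroup element that is its degree, if its weight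
is minimal among the monomials of this degree, and to zero otherwise. -/
noncomputable def symbol : MvPolynomial (Fin n) ℂ →ₗ[ℂ] (semigroup A →₀ ℂ) :=
  (basisMonomials (Fin n) ℂ).constr ℂ fun u =>
    if Finsupp.weight w u = ord A w (deg A u) then Finsupp.single (deg A u) 1 else 0

open Classical in
lemma symbol_monomial (u : Fin n →₀ ℕ) : symbol A w (monomial u 1) =
    if Finsupp.weight w u = ord A w (deg A u) then Finsupp.single (deg A u) 1 else 0 := by
  have := (basisMonomials (Fin n) ℂ).constr_basis ℂ (fun u =>
    if Finsupp.weight w u = ord A w (deg A u) then Finsupp.single (deg A u) (1 : ℂ) else 0) u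
  rwa [coe_basisMonomials] at this

/-- The kernel of `symbol` is an ideal. -/
lemma symbol_mul_eq_zero {f : MvPolynomial (Fin n) ℂ} (hf : symbol A w f = 0)
    (p : MvPolynomial (Fin n) ℂ) : symbol A w (p * f) = 0 := by
  classical
  induction p using MvPolynomial.induction_on' with
  | add p q hp hq => rw [add_mul, map_add, hp, hq, add_zero]
  | monomial v c =>
    let T : (semigroup A →₀ ℂ) →ₗ[ℂ] (semigroup A →₀ ℂ) := Finsupp.lsum ℂ fun a =>
      if ord A w a + Finsupp.weight w v = ord A w (a + deg A v) then
        Finsupp.lsingle (a + deg A v) else 0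
    have H : symbol A w ∘ₗ LinearMap.mulLeft ℂ (monomial v 1) = T ∘ₗ symbol A w := by
      refine (basisMonomials (Fin n) ℂ).ext fun u => ?_
      rw [coe_basisMonomials, LinearMap.comp_apply, LinearMap.comp_apply, LinearMap.mulLeft_apply,
        monomial_mul, one_mul, symbol_monomial, symbol_monomial, map_add, map_add]
      have h1 := ord_deg_le (A := A) (w := w) u
      have h2 := ord_deg_le (A := A) (w := w) v
      have h3 := ord_add_le (w := w) (deg A v) (deg A u)
      by_cases hu : Finsupp.weight w u = ord A w (deg A u)
      · rw [if_pos hu, Finsupp.lsum_single, add_comm (deg A v), add_comm (Finsupp.weight w v), hu]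
        split_ifs <;> rfl
      · rw [if_neg hu, map_zero, if_neg (by omega)]
    have h1 := LinearMap.congr_fun H f
    rw [LinearMap.comp_apply, LinearMap.comp_apply, hf, map_zero, LinearMap.mulLeft_apply] at h1
    have h2 : monomial v c = c • monomial v (1 : ℂ) := by rw [smul_monomial, smul_eq_mul, mul_one]
    rw [h2, smul_mul_assoc, map_smul, h1, smul_zero]

variable (A) in
/-- The homomorphism to the Laurent polynomial ring that defines the toric ideal. -/
noncomputable def toLaurent : MvPolynomial (Fin n) ℂ →ₐ[ℂ] AddMonoidAlgebra ℂ (Fin d → ℤ) :=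
  aeval fun j => AddMonoidAlgebra.single (A.col j) 1

lemma toLaurent_monomial (u : Fin n →₀ ℕ) :
    toLaurent A (monomial u 1) = AddMonoidAlgebra.single (deg A u : Fin d → ℤ) 1 := by
  rw [toLaurent, aeval_monomial, map_one, one_mul, coe_deg, Finsupp.weight_apply]
  simp only [AddMonoidAlgebra.single_pow, one_pow]
  rw [Finsupp.prod, Finsupp.sum]
  induction u.support using Finset.induction_on with
  | empty => rfl
  | insert j s hj ih =>
    rw [Finset.prod_insert hj, ih, Finset.sum_insert hj, AddMonoidAlgebra.single_mul_single, mul_one]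

lemma weight_col_toNat (u : Fin n → ℤ) : Finsupp.weight A.col
      (Finsupp.equivFunOnFinite.symm fun j => (u j).toNat) - Finsupp.weight A.col
      (Finsupp.equivFunOnFinite.symm fun j => (-u j).toNat) = A.mulVec u := by
  rw [Finsupp.weight_apply, Finsupp.weight_apply, Finsupp.sum_fintype _ _ (by simp),
    Finsupp.sum_fintype _ _ (by simp), ← Finset.sum_sub_distrib]
  ext i
  rw [Finset.sum_apply]
  refine Finset.sum_congr rfl fun j _ => ?_
  rw [Pi.sub_apply, Pi.smul_apply, Pi.smul_apply, Finsupp.equivFunOnFinite_symm_apply_apply,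
    Finsupp.equivFunOnFinite_symm_apply_apply, nsmul_eq_mul, nsmul_eq_mul, ← sub_mul,
    Int.toNat_sub_toNat_neg, mul_comm]
  rfl

lemma toLaurent_eq_zero {f : MvPolynomial (Fin n) ℂ} (hf : f ∈ toricIdeal A) :
    toLaurent A f = 0 := by
  rw [← RingHom.mem_ker]
  refine (Ideal.span_le.2 ?_ : toricIdeal A ≤ RingHom.ker (toLaurent A)) hf
  rintro _ ⟨u, hu, rfl⟩
  have h := weight_col_toNat (A := A) u
  rw [hu, sub_eq_zero] at h
  rw [SetLike.mem_coe, RingHom.mem_ker, binomial, map_sub, toLaurent_monomial, toLaurent_monomial,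
    coe_deg, coe_deg, h, sub_self]

/-- Two monomials of the same degree are congruent modulo the toric ideal. -/
lemma monomial_sub_monomial_mem {u v : Fin n →₀ ℕ} (h : deg A u = deg A v) :
    monomial u (1 : ℂ) - monomial v 1 ∈ toricIdeal A := by
  let z : Fin n → ℤ := fun j => (u j : ℤ) - v j
  let c : Fin n →₀ ℕ := u ⊓ v
  have hu : u = c + Finsupp.equivFunOnFinite.symm fun j => (z j).toNat := by
    ext j
    simp only [c, z, Finsupp.add_apply, Finsupp.inf_apply,
      Finsupp.equivFunOnFinite_symm_apply_apply]
    omega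
  have hv : v = c + Finsupp.equivFunOnFinite.symm fun j => (-z j).toNat := by
    ext j
    simp only [c, z, Finsupp.add_apply, Finsupp.inf_apply,
      Finsupp.equivFunOnFinite_symm_apply_apply]
    omega
  have hz : A.mulVec z = 0 := by
    have h1 : Finsupp.weight A.col u = Finsupp.weight A.col v := congrArg Subtype.val h
    rw [hu, hv, map_add, map_add, add_right_inj] at h1
    rw [← weight_col_toNat, h1, sub_self]
  have h2 : monomial u (1 : ℂ) - monomial v 1 = monomial c 1 * binomial z := by
    rw [binomial, mul_sub, monomial_mul, monomial_mul, mul_one, ← hu, ← hv]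
  rw [h2]
  exact Ideal.mul_mem_left _ _ (Ideal.subset_span ⟨z, hz, rfl⟩)

section Weights

variable {L : Fin n → ℚ} {N : ℕ}

lemma weight_eq_div (hL : ∀ j, L j = w j / N) (u : Fin n →₀ ℕ) :
    Finsupp.weight L u = (Finsupp.weight w u : ℚ) / N := by
  rw [Finsupp.weight_apply, Finsupp.weight_apply, Finsupp.sum_fintype _ _ (by simp),
    Finsupp.sum_fintype _ _ (by simp), Nat.cast_sum, Finset.sum_div]
  refine Finset.sum_congr rfl fun j _ => ?_
  rw [hL]
  simp [mul_div_assoc]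

/-- The map `symbol` factors through the graded toric ring; this is what makes the monomial classes
linearly independent. -/
lemma symbol_eq_zero_of_mem (hN : 0 < N) (hL : ∀ j, L j = w j / N) {f : MvPolynomial (Fin n) ℂ}
    (hf : f ∈ gradedIdeal L (toricIdeal A)) : symbol A w f = 0 := by
  classical
  have hN' : (0 : ℚ) < N := by exact_mod_cast hN
  let K : Ideal (MvPolynomial (Fin n) ℂ) :=
    { (LinearMap.ker (symbol A w)).toAddSubmonoid with
      smul_mem' := fun p f hf => symbol_mul_eq_zero hf p }
  refine (Ideal.span_le.2 ?_ : gradedIdeal L (toricIdeal A) ≤ K) hf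
  rintro _ ⟨k, f, hfI, hfk, rfl⟩
  show symbol A w _ = 0
  -- in weight `k` the symbol of an element of filtration order at most `k` is its image in the
  -- Laurent polynomial ring
  have key : ∀ f ∈ weightFiltration (n := n) L k, ∀ a : semigroup A,
      symbol A w (weightedHomogeneousComponent L k f) a =
        if (ord A w a : ℚ) / N = k then (toLaurent A f).coeff (a : Fin d → ℤ) else 0 := by
    intro f hf a
    rw [weightFiltration, restrictSupport_eq_span] at hf
    induction hf using Submodule.span_induction with
    | zero => simp
    | add x y _ _ hx hy =>
      rw [map_add, map_add, Finsupp.add_apply, hx, hy, map_add, AddMonoidAlgebra.coeff_add]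
      split_ifs
      · rfl
      · rw [add_zero]
    | smul c x _ hx =>
      rw [map_smul, map_smul, Finsupp.smul_apply, hx, map_smul, AddMonoidAlgebra.coeff_smul]
      split_ifs
      · rfl
      · rw [smul_zero]
    | mem x hx =>
      obtain ⟨u, hu, rfl⟩ := hx
      have hu' : (Finsupp.weight w u : ℚ) / N ≤ k := by
        rw [← weight_eq_div hL]
        exact hu
      have hcomp : weightedHomogeneousComponent L k (monomial u (1 : ℂ)) =
          if (Finsupp.weight w u : ℚ) / N = k then monomial u 1 else 0 := by
        rw [← weight_eq_div hL]
        rw [weightedHomogeneousComponent_of_mem (isWeightedHomogeneous_monomial _ _ _ rfl)]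
        exact if_congr eq_comm rfl rfl
      beta_reduce
      rw [hcomp, toLaurent_monomial, AddMonoidAlgebra.coeff_single]
      by_cases hua : deg A u = a
      · subst hua
        rw [Finsupp.single_eq_same]
        have hle : (ord A w (deg A u) : ℚ) / N ≤ (Finsupp.weight w u : ℚ) / N := by
          have : (ord A w (deg A u) : ℚ) ≤ Finsupp.weight w u := by exact_mod_cast ord_deg_le u
          gcongr
        by_cases hk : (ord A w (deg A u) : ℚ) / N = k
        · have hk' : (Finsupp.weight w u : ℚ) / N = k := by linarith
          have hou : Finsupp.weight w u = ord A w (deg A u) := by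
            rw [← hk, div_left_inj' hN'.ne'] at hk'
            exact_mod_cast hk'
          rw [if_pos hk', if_pos hk, symbol_monomial, if_pos hou, Finsupp.single_eq_same]
        · rw [if_neg hk]
          split_ifs with hk'
          · rw [symbol_monomial, if_neg, Finsupp.zero_apply]
            intro hou
            rw [hou] at hk'
            exact hk hk'
          · rw [map_zero, Finsupp.zero_apply]
      · rw [Finsupp.single_eq_of_ne fun h' => hua (Subtype.ext h'.symm), ite_self]
        split_ifs
        · rw [symbol_monomial]
          split_ifs
          · rw [Finsupp.single_eq_of_ne (Ne.symm hua)]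
          · rfl
        · rw [map_zero, Finsupp.zero_apply]
  ext a
  rw [key f hfk a, toLaurent_eq_zero hfI]
  simp

/-- The initial forms of the binomials in the toric ideal: of two monomials of the same degree, the
heavier one lies in the graded ideal, and so does the difference if their weights agree. -/
lemma monomial_mem_gradedIdeal (hN : 0 < N) (hL : ∀ j, L j = w j / N) {u v : Fin n →₀ ℕ}
    (h : deg A u = deg A v) :
    (Finsupp.weight w v < Finsupp.weight w u → monomial u (1 : ℂ) ∈
      gradedIdeal L (toricIdeal A)) ∧
    (Finsupp.weight w u = Finsupp.weight w v → monomial u (1 : ℂ) - monomial v 1 ∈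
      gradedIdeal L (toricIdeal A)) := by
  classical
  have hN' : (0 : ℚ) < N := by exact_mod_cast hN
  have hmem : Finsupp.weight w v ≤ Finsupp.weight w u →
      weightedHomogeneousComponent L (Finsupp.weight L u) (monomial u (1 : ℂ) - monomial v 1) ∈
        gradedIdeal L (toricIdeal A) := by
    intro hle
    refine Ideal.subset_span ⟨_, _, monomial_sub_monomial_mem h, ?_, rfl⟩
    refine sub_mem ?_ ?_
    · exact (monomial_mem_restrictSupport ℂ).2 (Or.inl (le_refl (Finsupp.weight L u)))
    · refine (monomial_mem_restrictSupport ℂ).2 (Or.inl ?_)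
      show Finsupp.weight L v ≤ Finsupp.weight L u
      rw [weight_eq_div hL, weight_eq_div hL]
      have : (Finsupp.weight w v : ℚ) ≤ Finsupp.weight w u := by exact_mod_cast hle
      gcongr
  have hcomp : ∀ v : Fin n →₀ ℕ, Finsupp.weight L v = Finsupp.weight L u →
      weightedHomogeneousComponent L (Finsupp.weight L u) (monomial v (1 : ℂ)) = monomial v 1 :=
    fun v hv => weightedHomogeneousComponent_eq_self
      (isWeightedHomogeneous_monomial _ _ _ hv)
  constructor
  · intro hlt
    have h1 := hmem hlt.le
    have h2 : Finsupp.weight L u ≠ Finsupp.weight L v := by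
      rw [weight_eq_div hL, weight_eq_div hL, Ne, div_left_inj' hN'.ne']
      exact_mod_cast hlt.ne'
    rwa [map_sub, hcomp u rfl, weightedHomogeneousComponent_of_mem
      (isWeightedHomogeneous_monomial _ _ _ rfl), if_neg h2, sub_zero] at h1
  · intro heq
    have h1 := hmem heq.ge
    rwa [map_sub, hcomp u rfl, hcomp v (by rw [weight_eq_div hL, weight_eq_div hL, heq])]
      at h1

variable (w) in
/-- The exponent vector of a monomial of minimal weight of a given degree. -/
noncomputable def minExp (a : semigroup A) : Fin n →₀ ℕ := (exists_weight_eq_ord (w := w) a).choose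

lemma deg_minExp (a : semigroup A) : deg A (minExp w a) = a :=
  (exists_weight_eq_ord a).choose_spec.1

lemma weight_minExp (a : semigroup A) : Finsupp.weight w (minExp w a) = ord A w a :=
  (exists_weight_eq_ord a).choose_spec.2

variable (A L w) in
/-- The class of a monomial of minimal weight of a given degree in the graded toric ring. -/
noncomputable def monomialClass (a : semigroup A) : GradedToricRing A L :=
  Ideal.Quotient.mkₐ ℂ (gradedIdeal L (toricIdeal A)) (monomial (minExp w a) 1)

/-- The class of a polynomial is determined by its symbol. -/
lemma mk_eq_linearCombination (hN : 0 < N) (hL : ∀ j, L j = w j / N)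
    (f : MvPolynomial (Fin n) ℂ) : Ideal.Quotient.mkₐ ℂ (gradedIdeal L (toricIdeal A)) f =
      Finsupp.linearCombination ℂ (monomialClass A w L) (symbol A w f) := by
  classical
  have H : (Ideal.Quotient.mkₐ ℂ (gradedIdeal L (toricIdeal A))).toLinearMap =
      Finsupp.linearCombination ℂ (monomialClass A w L) ∘ₗ symbol A w := by
    refine (basisMonomials (Fin n) ℂ).ext fun u => ?_
    rw [coe_basisMonomials, LinearMap.comp_apply, symbol_monomial, AlgHom.toLinearMap_apply]
    have h := monomial_mem_gradedIdeal hN hL (deg_minExp (w := w) (deg A u)).symm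
    rw [weight_minExp] at h
    split_ifs with hu
    · rw [Finsupp.linearCombination_single, one_smul, monomialClass, ← sub_eq_zero, ← map_sub]
      exact Ideal.Quotient.eq_zero_iff_mem.2 (h.2 hu)
    · rw [map_zero]
      exact Ideal.Quotient.eq_zero_iff_mem.2 (h.1 (lt_of_le_of_ne (ord_deg_le u) (Ne.symm hu)))
  exact LinearMap.congr_fun H f

lemma linearIndependent_monomialClass (hN : 0 < N) (hL : ∀ j, L j = w j / N) :
    LinearIndependent ℂ (monomialClass A w L) := by
  classical
  let Λ : GradedToricRing A L →ₗ[ℂ] (semigroup A →₀ ℂ) :=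
    Submodule.liftQ ((gradedIdeal L (toricIdeal A)).restrictScalars ℂ) (symbol A w)
      fun f hf => symbol_eq_zero_of_mem hN hL hf
  refine LinearIndependent.of_comp Λ ?_
  have : Λ ∘ monomialClass A w L = fun a => Finsupp.single a 1 := by
    funext a
    show symbol A w (monomial (minExp w a) 1) = _
    rw [symbol_monomial, deg_minExp, weight_minExp, if_pos rfl]
  rw [this]
  exact Finsupp.linearIndependent_single_one ℂ _

lemma mk_monomial (hN : 0 < N) (hL : ∀ j, L j = w j / N) (u : Fin n →₀ ℕ) :
    Ideal.Quotient.mkₐ ℂ (gradedIdeal L (toricIdeal A)) (monomial u 1) =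
      if Finsupp.weight w u = ord A w (deg A u) then monomialClass A w L (deg A u) else 0 := by
  classical
  rw [mk_eq_linearCombination hN hL, symbol_monomial]
  split_ifs
  · rw [Finsupp.linearCombination_single, one_smul]
  · rw [map_zero]

/-- The monomial basis of the graded toric ring. -/
theorem isFaceAlgebra_monomialClass (hN : 0 < N) (hL : ∀ j, L j = w j / N) :
    IsFaceAlgebra A w 0 (monomialClass A w L) where
  nonneg _ _ := le_rfl
  e_zero := by
    have h := mk_monomial (A := A) hN hL 0
    rw [map_zero, map_zero, ord_zero, if_pos rfl] at h
    rw [← h]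
    exact map_one (Ideal.Quotient.mkₐ ℂ (gradedIdeal L (toricIdeal A)))
  eq_zero _ h := absurd rfl h
  mul a b _ _ := by
    classical
    rw [monomialClass, monomialClass, ← map_mul, monomial_mul, one_mul, mk_monomial hN hL, map_add,
      map_add, deg_minExp, deg_minExp, weight_minExp, weight_minExp]
  linearIndependent := (linearIndependent_monomialClass hN hL).comp _ Subtype.val_injective
  span_range := by
    rw [eq_top_iff]
    intro x _
    obtain ⟨f, rfl⟩ := Ideal.Quotient.mkₐ_surjective ℂ (gradedIdeal L (toricIdeal A)) x
    rw [mk_eq_linearCombination hN hL, ← Finsupp.range_linearCombination]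
    exact LinearMap.mem_range_self _ _

open Classical in
lemma mem_span_of_mem_degreePart (hN : 0 < N) (hL : ∀ j, L j = w j / N) {a : Fin d → ℤ}
    {x : GradedToricRing A L} (hx : x ∈ degreePart A L a) :
    x ∈ Submodule.span ℂ (monomialClass A w L '' {b | (b : Fin d → ℤ) = a}) := by
  obtain ⟨f, hf, rfl⟩ := hx
  have hf' : f ∈ restrictSupport ℂ {u | Finsupp.weight A.col u = a} := by
    rw [restrictSupport, ← weightedHomogeneousSubmodule_eq_finsupp_supported]
    exact hf
  rw [restrictSupport_eq_span] at hf'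
  clear hf
  induction hf' using Submodule.span_induction with
  | zero => rw [map_zero]; exact zero_mem _
  | add f g _ _ ihf ihg => rw [map_add]; exact add_mem ihf ihg
  | smul c f _ ihf => rw [map_smul]; exact Submodule.smul_mem _ _ ihf
  | mem f hf =>
    obtain ⟨u, hu, rfl⟩ := hf
    rw [AlgHom.toLinearMap_apply, mk_monomial hN hL]
    split_ifs
    · exact Submodule.subset_span ⟨deg A u, hu, rfl⟩
    · exact zero_mem _

lemma monomialClass_mem_degreePart (a : semigroup A) :
    monomialClass A w L a ∈ degreePart A L a :=
  ⟨monomial (minExp w a) 1, isWeightedHomogeneous_monomial _ _ _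
    (congrArg Subtype.val (deg_minExp (w := w) a)), rfl⟩

lemma facePart_eq_span (hN : 0 < N) (hL : ∀ j, L j = w j / N) (τ : Set (Fin d → ℚ)) :
    facePart A L τ = Submodule.span ℂ (monomialClass A w L ''
      {a | (fun i => ((a : Fin d → ℤ) i : ℚ)) ∈ PointedCone.hull ℚ τ}) := by
  apply le_antisymm
  · refine iSup_le fun a x hx => ?_
    refine Submodule.span_mono (Set.image_mono ?_) (mem_span_of_mem_degreePart hN hL hx)
    intro b hb
    have hb' : (b : Fin d → ℤ) = a := hb
    show (fun i => ((b : Fin d → ℤ) i : ℚ)) ∈ PointedCone.hull ℚ τ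
    rw [hb']
    exact a.2
  · refine Submodule.span_le.2 ?_
    rintro _ ⟨a, ha, rfl⟩
    exact le_iSup (fun a : {a : Fin d → ℤ // (fun i => (a i : ℚ)) ∈ PointedCone.hull ℚ τ} =>
      degreePart A L a) ⟨a, ha⟩ (monomialClass_mem_degreePart a)

open Classical in
variable (A L w) in
/-- The monomials of minimal weight whose degrees lie in the cone over `τ`, as elements of the
subalgebra attached to `τ`. -/
noncomputable def faceMonomialClass (τ : Set (Fin d → ℚ)) (a : semigroup A) :
    faceSubalgebra A L τ :=
  if h : (fun i => ((a : Fin d → ℤ) i : ℚ)) ∈ PointedCone.hull ℚ τ then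
    ⟨monomialClass A w L a,
      le_iSup (fun a : {a : Fin d → ℤ // (fun i => (a i : ℚ)) ∈ PointedCone.hull ℚ τ} =>
        degreePart A L a) ⟨a, h⟩ (monomialClass_mem_degreePart a)⟩
  else 0

lemma coe_faceMonomialClass {τ : Set (Fin d → ℚ)} {a : semigroup A}
    (h : (fun i => ((a : Fin d → ℤ) i : ℚ)) ∈ PointedCone.hull ℚ τ) :
    (faceMonomialClass A w L τ a : GradedToricRing A L) = monomialClass A w L a := by
  rw [faceMonomialClass, dif_pos h]

/-- The monomial basis of the subalgebra attached to a face. -/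
theorem isFaceAlgebra_faceMonomialClass (hN : 0 < N) (hL : ∀ j, L j = w j / N)
    {τ : Set (Fin d → ℚ)} {g : Dual ℚ ((Fin d → ℚ) × ℚ)} (hg : ∀ x ∈ epigraph A w, 0 ≤ g x)
    (hτ : ∀ a : semigroup A, (fun i => ((a : Fin d → ℤ) i : ℚ)) ∈ PointedCone.hull ℚ τ ↔
      g (point A w a) = 0) :
    IsFaceAlgebra A w g (faceMonomialClass A w L τ) := by
  have hS := isFaceAlgebra_monomialClass (A := A) hN hL
  have hcoe : ∀ a, g (point A w a) = 0 →
      (faceMonomialClass A w L τ a : GradedToricRing A L) = monomialClass A w L a := fun a ha =>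
    coe_faceMonomialClass ((hτ a).2 ha)
  refine ⟨hg, ?_, fun a ha => ?_, fun a b ha hb => ?_, ?_, ?_⟩
  · refine Subtype.ext ?_
    rw [hcoe 0 (IsFaceAlgebra.point_zero_mem g), hS.e_zero]
    rfl
  · rw [faceMonomialClass, dif_neg fun h => ha ((hτ a).1 h)]
  · refine Subtype.ext ?_
    rw [Subalgebra.coe_mul, hcoe a ha, hcoe b hb, hS.mul a b rfl rfl]
    split_ifs
    · exact (hcoe _ (face_add_mem hg ha hb)).symm
    · rfl
  · refine LinearIndependent.of_comp (faceSubalgebra A L τ).val.toLinearMap ?_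
    have : (faceSubalgebra A L τ).val.toLinearMap ∘
        (fun a : {a // g (point A w a) = 0} => faceMonomialClass A w L τ a) =
        fun a : {a // g (point A w a) = 0} => monomialClass A w L a := by
      funext a
      exact hcoe a a.2
    rw [this]
    exact (linearIndependent_monomialClass hN hL).comp _ Subtype.val_injective
  · rw [eq_top_iff]
    rintro ⟨x, hx⟩ -
    have hx' : x ∈ facePart A L τ := hx
    rw [facePart_eq_span hN hL] at hx'
    have hmap : x ∈ (Submodule.span ℂ (Set.range (faceMonomialClass A w L τ))).map
        (faceSubalgebra A L τ).val.toLinearMap := by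
      refine (Submodule.span_le.2 ?_ : Submodule.span ℂ (monomialClass A w L ''
        {a | (fun i => ((a : Fin d → ℤ) i : ℚ)) ∈ PointedCone.hull ℚ τ}) ≤ _) hx'
      rintro _ ⟨a, ha, rfl⟩
      exact ⟨_, Submodule.subset_span ⟨a, rfl⟩, coe_faceMonomialClass ha⟩
    obtain ⟨y, hy, hyx⟩ := hmap
    have : y = ⟨x, hx⟩ := Subtype.ext hyx
    rwa [this] at hy

end Weights

end ToricGr

/-! ### Faces of the umbrella and lower faces of the epigraph -/

namespace ToricGr

open Module

variable {d n : ℕ} {A : Matrix (Fin d) (Fin n) ℤ} {w : Fin n → ℕ} {L : Fin n → ℚ} {N : ℕ}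
  {g : Dual ℚ ((Fin d → ℚ) × ℚ)}

/-- The linear function whose graph contains the face `g = 0` of the epigraph. -/
noncomputable def slope (g : Dual ℚ ((Fin d → ℚ) × ℚ)) : Dual ℚ (Fin d → ℚ) :=
  -(g (apex d))⁻¹ • g ∘ₗ LinearMap.inl ℚ (Fin d → ℚ) ℚ

lemma apply_eq_slope (hg : g (apex d) ≠ 0) (x : Fin d → ℚ) (s : ℚ) :
    g (x, s) = g (apex d) * (s - slope g x) := by
  rw [eq_add_smul_apex, map_add, map_smul, slope, LinearMap.smul_apply, LinearMap.comp_apply,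
    LinearMap.inl_apply, smul_eq_mul, smul_eq_mul]
  field_simp
  ring

variable (A L N) in
/-- The face of the polyhedron that corresponds to the face `g = 0` of the epigraph. -/
def umbrellaFace (g : Dual ℚ ((Fin d → ℚ) × ℚ)) : Set (Fin d → ℚ) :=
  {x | x ∈ polyhedron A L ∧ slope g x = N}

/-- The points `a_j / L_j`, put at the height `N`, lie on the rays through the lifted columns
`(a_j, w_j)`. -/
lemma mem_epigraph_of_mem_polyhedron (hL : ∀ j, L j = w j / N) (hw : ∀ j, 0 < w j)
    (hN : 0 < N) {x : Fin d → ℚ} (hx : x ∈ polyhedron A L) : (x, (N : ℚ)) ∈ epigraph A w := by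
  have hconv : Convex ℚ {x : Fin d → ℚ | (x, (N : ℚ)) ∈ epigraph A w} := by
    intro x hx y hy s t hs ht hst
    have h := add_mem (smul_mem_epigraph hs hx) (smul_mem_epigraph ht hy)
    have h2 : s • (x, (N : ℚ)) + t • (y, (N : ℚ)) = (s • x + t • y, (N : ℚ)) := by
      ext
      · rfl
      · simp only [Prod.smul_mk, Prod.mk_add_mk, smul_eq_mul]
        rw [← add_mul, hst, one_mul]
    rwa [h2] at h
  refine convexHull_min ?_ hconv hx
  have hN' : (0 : ℚ) < N := by exact_mod_cast hN
  rintro _ (rfl | ⟨j, rfl⟩)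
  · have h := smul_mem_epigraph hN'.le (apex_mem_epigraph (A := A) (w := w))
    have h2 : (N : ℚ) • apex d = (0, (N : ℚ)) := by ext <;> simp [apex]
    rwa [h2] at h
  · have hwj : (0 : ℚ) < w j := by exact_mod_cast hw j
    have hc : (0 : ℚ) ≤ N / w j := by positivity
    have h := smul_mem_epigraph hc (gen_mem_epigraph (A := A) (w := w) j)
    have h2 : ((N : ℚ) / w j) • gen A w j = ((L j)⁻¹ • column A j, (N : ℚ)) := by
      rw [hL, inv_div]
      ext
      · rfl
      · simp only [gen, Prod.smul_mk, smul_eq_mul]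
        field_simp
    rwa [h2] at h

lemma slope_le (hL : ∀ j, L j = w j / N) (hw : ∀ j, 0 < w j) (hN : 0 < N) (hg : IsLower A w g)
    {x : Fin d → ℚ} (hx : x ∈ polyhedron A L) : slope g x ≤ N := by
  have h := hg.nonneg _ (mem_epigraph_of_mem_polyhedron hL hw hN hx)
  rw [apply_eq_slope hg.apex_pos.ne'] at h
  have := nonneg_of_mul_nonneg_right h hg.apex_pos
  linarith

lemma vertex_mem_umbrellaFace (hL : ∀ j, L j = w j / N) (hw : ∀ j, 0 < w j) (hg : IsLower A w g)
    {j : Fin n} (hj : j ∈ zeros A w g) : (L j)⁻¹ • column A j ∈ umbrellaFace A L N g := by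
  refine ⟨subset_convexHull ℚ _ (Set.mem_insert_of_mem _ ⟨j, rfl⟩), ?_⟩
  have h := mem_zeros.1 hj
  rw [gen, apply_eq_slope hg.apex_pos.ne'] at h
  have h1 : (w j : ℚ) - slope g (column A j) = 0 := (mul_eq_zero.1 h).resolve_left hg.apex_pos.ne'
  have hwj : (0 : ℚ) < w j := by exact_mod_cast hw j
  rw [map_smul, hL, inv_div, smul_eq_mul, ← sub_eq_zero.1 h1]
  field_simp

lemma umbrellaFace_mem_umbrella (hL : ∀ j, L j = w j / N) (hw : ∀ j, 0 < w j) (hN : 0 < N)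
    (hg : IsLower A w g) : umbrellaFace A L N g ∈ umbrella A L := by
  refine ⟨fun ⟨y, hy, hyN⟩ => ⟨⟨slope g, LinearMap.continuous_on_pi _⟩, ?_⟩, fun h => ?_⟩
  · ext x
    refine and_congr_right fun hx => ⟨fun h z hz => ?_, fun h => ?_⟩
    · show slope g z ≤ slope g x
      rw [h]
      exact slope_le hL hw hN hg hz
    · have h1 : slope g y ≤ slope g x := h y hy
      exact le_antisymm (slope_le hL hw hN hg hx) (hyN ▸ h1)
  · have h1 := h.2
    rw [map_zero] at h1
    exact hN.ne (by exact_mod_cast h1)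

/-- The elements of the semigroup in the cone over the umbrella face are those above the
corresponding lower face. -/
lemma mem_hull_umbrellaFace_iff (hL : ∀ j, L j = w j / N) (hw : ∀ j, 0 < w j) (hN : 0 < N)
    (hg : IsLower A w g) (a : semigroup A) :
    (fun i => ((a : Fin d → ℤ) i : ℚ)) ∈ PointedCone.hull ℚ (umbrellaFace A L N g) ↔
      g (point A w a) = 0 := by
  constructor
  · intro h
    have hepi : ∀ x ∈ PointedCone.hull ℚ (umbrellaFace A L N g), (x, slope g x) ∈ epigraph A w := by
      intro x hx
      induction hx using Submodule.span_induction with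
      | mem x hx =>
        rw [hx.2]
        exact mem_epigraph_of_mem_polyhedron hL hw hN hx.1
      | zero => rw [map_zero]; exact zero_mem _
      | add x y _ _ hx hy => rw [map_add]; exact add_mem hx hy
      | smul c x _ hx =>
        have h := (epigraph A w).smul_mem c.2 hx
        have h2 : slope g (c • x) = (c : ℚ) * slope g x := map_smul (slope g) (c : ℚ) x
        rw [h2]
        exact h
    have h1 := newton_le (hepi _ h)
    have h2 := hg.nonneg _ (point_mem_epigraph a)
    refine le_antisymm ?_ h2
    rw [point, apply_eq_slope hg.apex_pos.ne']
    exact mul_nonpos_of_nonneg_of_nonpos hg.apex_pos.le (by linarith)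
  · intro h
    obtain ⟨c, hc, hc0, hpt⟩ := exists_eq_sum_of_isLower hg (point_mem_epigraph a) h
    have h1 : (fun i => ((a : Fin d → ℤ) i : ℚ)) = ∑ j, c j • column A j := by
      have := congrArg Prod.fst hpt
      rw [Prod.fst_sum] at this
      exact this
    rw [h1]
    refine sum_mem fun j _ => ?_
    by_cases hj : j ∈ zeros A w g
    · have hmem := PointedCone.subset_hull (R := ℚ) (vertex_mem_umbrellaFace hL hw hg hj)
      have hLj : 0 < L j := by
        rw [hL]
        have := hw j
        positivity
      have h2 := (PointedCone.hull ℚ (umbrellaFace A L N g)).smul_mem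
        (mul_nonneg (hc j) hLj.le) hmem
      rwa [smul_smul, mul_assoc, mul_inv_cancel₀ hLj.ne', mul_one] at h2
    · rw [hc0 j hj, zero_smul]
      exact zero_mem _

/-- An umbrella face that lies in the boundary is contained in a vertical facet of the epigraph. -/
lemma not_umbrellaFace_subset_boundary (hL : ∀ j, L j = w j / N) (hw : ∀ j, 0 < w j)
    (hN : 0 < N) (hg : IsLower A w g) (hne : (zeros A w g).Nonempty)
    (H : ∀ f : Dual ℚ ((Fin d → ℚ) × ℚ), (∀ x ∈ epigraph A w, 0 ≤ f x) →
      zeros A w g ⊆ zeros A w f → f ≠ 0 → 0 < f (apex d)) :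
    ¬ umbrellaFace A L N g ⊆ umbrellaBoundary A L := by
  classical
  intro hsub
  have hLpos : ∀ j, 0 < L j := fun j => by
    rw [hL]
    have := hw j
    positivity
  let p : Fin n → Fin d → ℚ := fun j => (L j)⁻¹ • column A j
  have hcard : (0 : ℚ) < (zeros A w g).card := by exact_mod_cast hne.card_pos
  -- the barycentre of the vertices of the face
  let x : Fin d → ℚ := ∑ j ∈ zeros A w g, ((zeros A w g).card : ℚ)⁻¹ • p j
  have hxτ : x ∈ umbrellaFace A L N g := by
    have hconv : Convex ℚ (umbrellaFace A L N g) :=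
      (convex_convexHull ℚ _).inter (convex_hyperplane (slope g).isLinear _)
    refine hconv.sum_mem (fun _ _ => by positivity) ?_
      fun j hj => vertex_mem_umbrellaFace hL hw hg hj
    rw [Finset.sum_const, nsmul_eq_mul, mul_inv_cancel₀ hcard.ne']
  obtain ⟨I, hI⟩ := exists_finset_dual_hull (Finset.univ.image (column A))
  have hQ : ∀ y, y ∈ PointedCone.hull ℚ (Set.range (column A)) ↔ ∀ f ∈ I, 0 ≤ f y := by
    intro y
    rw [← hI]
    simp
  have hxQ : x ∈ PointedCone.hull ℚ (Set.range (column A)) := by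
    refine sum_mem fun j _ => ?_
    simp only [p, smul_smul]
    exact (PointedCone.hull ℚ (Set.range (column A))).smul_mem
      (mul_nonneg (by positivity) (inv_nonneg.2 (hLpos j).le))
      (PointedCone.subset_hull ⟨j, rfl⟩)
  have hfr := (hsub hxτ).2
  obtain ⟨f, hf, hf0, hfx⟩ : ∃ f ∈ I, f ≠ 0 ∧ f x ≤ 0 := by
    by_contra! hcon
    refine hfr.2 (mem_interior.2 ⟨⋂ f ∈ I.filter (· ≠ 0), {y | 0 < f y}, fun y hy => ?_, ?_, ?_⟩)
    · refine (hQ y).2 fun f hf => ?_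
      by_cases hf0 : f = 0
      · rw [hf0]
        rfl
      · exact le_of_lt (Set.mem_iInter₂.1 hy f (Finset.mem_filter.2 ⟨hf, hf0⟩))
    · exact isOpen_biInter_finset fun f _ =>
        isOpen_lt continuous_const (LinearMap.continuous_on_pi f)
    · exact Set.mem_iInter₂.2 fun f hf =>
        hcon f (Finset.mem_filter.1 hf).1 (Finset.mem_filter.1 hf).2
  have hcol : ∀ j, 0 ≤ f (column A j) := fun j =>
    (hQ _).1 (PointedCone.subset_hull ⟨j, rfl⟩) f hf
  have hzero : ∀ j ∈ zeros A w g, f (column A j) = 0 := by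
    have hterm : ∀ j ∈ zeros A w g, 0 ≤ f (((zeros A w g).card : ℚ)⁻¹ • p j) := by
      intro j _
      simp only [p, map_smul, smul_eq_mul]
      exact mul_nonneg (by positivity) (mul_nonneg (inv_nonneg.2 (hLpos j).le) (hcol j))
    have hx0 : ∑ j ∈ zeros A w g, f (((zeros A w g).card : ℚ)⁻¹ • p j) = 0 := by
      rw [← map_sum]
      exact le_antisymm hfx ((hQ _).1 hxQ f hf)
    intro j hj
    have h1 := (Finset.sum_eq_zero_iff_of_nonneg hterm).1 hx0 j hj
    simp only [p, map_smul, smul_eq_mul, mul_eq_zero, inv_eq_zero] at h1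
    rcases h1 with h1 | h1 | h1
    · exact absurd h1 hcard.ne'
    · exact absurd h1 (hLpos j).ne'
    · exact h1
  have hF := H (f ∘ₗ LinearMap.fst ℚ (Fin d → ℚ) ℚ) ?_ ?_ ?_
  · rw [LinearMap.comp_apply, LinearMap.fst_apply, apex, map_zero] at hF
    exact lt_irrefl _ hF
  · intro y hy
    obtain ⟨c, t, hc, -, rfl⟩ := exists_eq_sum_of_mem_epigraph hy
    rw [map_add, map_sum, map_smul]
    simp only [LinearMap.comp_apply, LinearMap.fst_apply, apex, map_zero, smul_zero, add_zero]
    refine Finset.sum_nonneg fun j _ => ?_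
    rw [Prod.smul_fst, map_smul]
    exact mul_nonneg (hc j) (hcol j)
  · intro j hj
    exact mem_zeros.2 (hzero j hj)
  · intro h0
    refine hf0 (LinearMap.ext fun y => ?_)
    exact LinearMap.congr_fun h0 (y, 0)

end ToricGr

/-! ### Regularity of the translated parameters -/

namespace ToricGr

open Module IsLocalRing RingTheory.Sequence

variable {d n : ℕ} {A : Matrix (Fin d) (Fin n) ℤ} {w : Fin n → ℕ}

namespace IsFaceAlgebra

variable {B : Type*} [CommRing B] [Algebra ℂ B] {e : semigroup A → B}

/-- For the filtration by the Newton function the operators `theta` are the leading parts of the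
multiplications by the parameters, and subtracting constants does not change the leading parts. -/
theorem isWeaklyRegular_sub (h : IsFaceAlgebra A w 0 e) (hw : ∀ j, 0 < w j)
    (hreg : RegularMod (thetas A w d) (⊥ : Submodule ℂ (semigroup A →₀ ℂ))) (c : ℕ → ℂ) :
    IsWeaklyRegular B
      ((List.range d).map fun i => parameter A w e (i + 1) - algebraMap ℂ B (c i)) := by
  classical
  -- `M` clears the denominators of the Newton function; the constants have degree zero, less than
  -- the degree `M * baryWeight w` of the parameters
  obtain ⟨M, hM, hM'⟩ := exists_newton_scale A w
  choose k hk using hM'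
  have hMQ : (0 : ℚ) < M := by exact_mod_cast hM
  let β : B ≃ₗ[ℂ] (semigroup A →₀ ℂ) :=
    h.basis.repr.trans (Finsupp.domLCongr (Equiv.subtypeUnivEquiv fun _ => rfl))
  have hβ : ∀ a, β (e a) = Finsupp.single a 1 := by
    intro a
    have h1 : e a = h.basis ⟨a, rfl⟩ := (h.basis_apply ⟨a, rfl⟩).symm
    rw [h1]
    simp only [β, LinearEquiv.trans_apply, Basis.repr_self, Finsupp.domLCongr_single]
    rfl
  let op : B → Module.End ℂ (semigroup A →₀ ℂ) := fun x =>
    β.toLinearMap ∘ₗ LinearMap.mulLeft ℂ x ∘ₗ β.symm.toLinearMap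
  have hop : ∀ x v, op x (β v) = β (x * v) := fun x v => by
    simp [op]
  let y : ℕ → B := fun i => parameter A w e (i + 1) - algebraMap ℂ B (c i)
  let b : Basis (semigroup A) ℂ (semigroup A →₀ ℂ) := Finsupp.basisSingleOne
  have hb : ∀ a, b a = Finsupp.single a 1 := fun a => by simp [b]
  have hleading : ∀ i, (Grading.ofBasis b k).IsLeadingOp (M * baryWeight w) (op (y i))
      (theta A w (i + 1)) := by
    intro i
    have hkadd : ∀ a, ∀ σ ∈ facesOfDim A w (i + 1),
        (k (a + bary w σ) ≤ k a + M * baryWeight w) ∧ (k (a + bary w σ) = k a + M * baryWeight w ↔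
          newton A w a + newton A w (bary w σ) = newton A w (a + bary w σ)) := by
      intro a σ hσ
      have hσb := ord_bary (mem_facesOfDim.1 hσ).1 (nonempty_of_mem_facesOfDim hσ)
      have h1 := hk (a + bary w σ)
      have h2 := hk a
      have h3 := newton_add_le (w := w) a (bary w σ)
      have h4 : (M : ℚ) * newton A w (bary w σ) = M * baryWeight w := by rw [hσb.1]
      constructor
      · have : (k (a + bary w σ) : ℚ) ≤ k a + M * baryWeight w := by
          rw [← h1, ← h2, ← h4, ← mul_add]
          exact mul_le_mul_of_nonneg_left h3 hMQ.le
        exact_mod_cast this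
      · have : (k (a + bary w σ) : ℚ) = k a + M * baryWeight w ↔
            newton A w a + newton A w (bary w σ) = newton A w (a + bary w σ) := by
          rw [← h1, ← h2, ← h4, ← mul_add, mul_right_inj' hMQ.ne', eq_comm]
        rw [← this]
        exact_mod_cast Iff.rfl
    refine Grading.isLeadingOp_ofBasis b k (fun a => ?_) (fun a => ?_)
    · rw [hb, theta, LinearMap.sum_apply]
      refine Submodule.sum_mem _ fun σ hσ => ?_
      rw [shift_single]
      split_ifs with hadd
      · rw [← hb]
        exact Submodule.subset_span ⟨_, (hkadd a σ hσ).2.2 (total_add_iff.1 hadd).2, rfl⟩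
      · exact zero_mem _
    · have h1 : op (y i) (b a) = ∑ σ ∈ facesOfDim A w (i + 1),
          (if ord A w a + ord A w (bary w σ) = ord A w (a + bary w σ) then b (a + bary w σ) else 0)
          - c i • b a := by
        rw [hb, ← hβ, hop, sub_mul, map_sub, parameter, Finset.sum_mul, map_sum,
          Algebra.algebraMap_eq_smul_one, smul_mul_assoc, one_mul, map_smul]
        congr 1
        refine Finset.sum_congr rfl fun σ _ => ?_
        rw [mul_comm, h.mul a _ rfl rfl]
        split_ifs
        · rw [hβ, hb]
        · rw [map_zero]
      have hD : 0 < M * baryWeight w := mul_pos hM (baryWeight_pos hw)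
      rw [h1, hb a, theta, LinearMap.sum_apply, sub_right_comm, ← Finset.sum_sub_distrib]
      refine sub_mem (Submodule.sum_mem _ fun σ hσ => ?_) (Submodule.smul_mem _ _ ?_)
      · rw [shift_single]
        have hiff := total_add_iff (w := w) (a := a) (b := bary w σ)
        by_cases ho : ord A w a + ord A w (bary w σ) = ord A w (a + bary w σ)
        · by_cases hn : newton A w a + newton A w (bary w σ) = newton A w (a + bary w σ)
          · rw [if_pos ho, if_pos (hiff.2 ⟨ho, hn⟩), hb, sub_self]
            exact zero_mem _
          · rw [if_pos ho, if_neg fun h' => hn (hiff.1 h').2, sub_zero]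
            refine Submodule.subset_span ⟨_, ?_, rfl⟩
            have h2 := hkadd a σ hσ
            exact lt_of_le_of_ne h2.1 fun h' => hn (h2.2.1 h')
        · rw [if_neg ho, if_neg fun h' => ho (hiff.1 h').1, sub_zero]
          exact zero_mem _
      · rw [← hb]
        refine Submodule.subset_span ⟨a, ?_, rfl⟩
        show k a < k a + M * baryWeight w
        omega
  have h1 : RegularMod ((List.range d).map fun i => op (y i))
      (⊥ : Submodule ℂ (semigroup A →₀ ℂ)) := by
    refine Grading.regularMod_of_leading (G := Grading.ofBasis b k) (D := M * baryWeight w) ?_ ?_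
      Grading.isLeadingSubspace_bot (fun x _ u hu => ?_) hreg
    · rw [thetas, List.forall₂_map_left_iff, List.forall₂_map_right_iff, List.forall₂_same]
      exact fun i _ => hleading i
    · intro x hx z hz
      obtain ⟨i, -, rfl⟩ := List.mem_map.1 hx
      obtain ⟨j, -, rfl⟩ := List.mem_map.1 hz
      refine LinearMap.ext fun v => ?_
      obtain ⟨v, rfl⟩ := β.surjective v
      rw [Module.End.mul_apply, Module.End.mul_apply, hop, hop, hop, hop, mul_left_comm]
    · rw [Submodule.mem_bot] at hu
      rw [hu, map_zero]
      exact zero_mem _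
  have h2 := (regularMod_comap_iff (β := β.toLinearMap) β.surjective
    (l := (List.range d).map fun i => LinearMap.mulLeft ℂ (y i)) ?_ ⊥).2 h1
  · have h3 : (⊥ : Submodule ℂ (semigroup A →₀ ℂ)).comap β.toLinearMap = ⊥ :=
      LinearMap.ker_eq_bot.2 β.injective
    rw [h3] at h2
    refine (regularMod_bot_iff_isWeaklyRegular (k := ℂ) _).1 ?_
    rw [List.map_map]
    exact h2
  · rw [List.forall₂_map_left_iff, List.forall₂_map_right_iff, List.forall₂_same]
    exact fun i _ v => (hop _ _).symm

/-- The basis element of `u` is the product of those of the columns in a monomial of minimal weight;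
each of the columns that occur is nonzero, since their orders add up. -/
lemma mem_pow_degree (h : IsFaceAlgebra A w 0 e) {I : Ideal B}
    (hI : ∀ a, a ≠ 0 → e a ∈ I) {u : Fin n →₀ ℕ} (hw : ∀ j, 0 < w j)
    (hu : Finsupp.weight w u = ord A w (deg A u)) : e (deg A u) ∈ I ^ u.degree := by
  induction hk : u.degree generalizing u with
  | zero => simp
  | succ k ih =>
    have hu0 : u ≠ 0 := by
      rintro rfl
      simp at hk
    obtain ⟨j, hj⟩ := Finsupp.ne_iff.1 hu0
    have hle : Finsupp.single j 1 ≤ u := by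
      rw [Finsupp.single_le_iff]
      exact Nat.one_le_iff_ne_zero.2 hj
    obtain ⟨v, rfl⟩ := exists_add_of_le hle
    rw [map_add, Finsupp.degree_single] at hk
    rw [map_add, map_add, Finsupp.weight_single, one_smul] at hu
    have h1 := ord_add_le (w := w) (deg A (Finsupp.single j 1)) (deg A v)
    have h2 := ord_deg_le (A := A) (w := w) (Finsupp.single j 1)
    have h3 := ord_deg_le (A := A) (w := w) v
    rw [Finsupp.weight_single, one_smul] at h2
    have h4 := h.mul (deg A (Finsupp.single j 1)) (deg A v) rfl rfl
    rw [if_pos (by omega)] at h4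
    rw [map_add, ← h4, pow_succ']
    refine Ideal.mul_mem_mul (hI _ fun h0 => ?_) (ih (by omega) (by omega))
    have h5 : ord A w (deg A (Finsupp.single j 1)) = w j := by omega
    rw [h0, ord_zero] at h5
    exact (hw j).ne h5

/-- A prime ideal that contains translates of the parameters is maximal: by homogeneity the algebra
is finite over the subalgebra generated by the parameters. -/
theorem isMaximal_of_parameter_sub_mem [IsNoetherianRing B] (h : IsFaceAlgebra A w 0 e)
    (hw : ∀ j, 0 < w j) (c : ℕ → ℂ) {q : Ideal B} [q.IsPrime]
    (hq : ∀ i < d, parameter A w e (i + 1) - algebraMap ℂ B (c i) ∈ q) : q.IsMaximal := by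
  classical
  let J : Ideal B := Ideal.span (Set.range fun i : Fin d => parameter A w e (i + 1))
  have hrad : ∀ a, a ≠ 0 → e a ∈ J.radical := by
    intro a ha
    rw [Ideal.radical_eq_sInf, Submodule.mem_sInf]
    rintro p ⟨hJp, hp⟩
    exact h.mem_of_parameter_mem hw (r := d) (fun σ hσ _ _ => faceDim_le hσ)
      (fun i hi => hJp (Ideal.subset_span ⟨⟨i, hi⟩, rfl⟩)) ha
  obtain ⟨K, hK⟩ := J.exists_radical_pow_le_of_fg (IsNoetherian.noetherian _)
  -- the basis elements of large degree lie in the ideal generated by the parameters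
  have hmon : ∀ a, ∃ u : Fin n →₀ ℕ, deg A u = a ∧ e a ∈ J.radical ^ u.degree := by
    intro a
    obtain ⟨u, rfl, hu⟩ := exists_weight_eq_ord (w := w) a
    exact ⟨u, rfl, h.mem_pow_degree hrad hw hu⟩
  let W : Submodule ℂ B := Submodule.span ℂ
    ((fun u => e (deg A u)) '' {u : Fin n →₀ ℕ | u.degree ≤ K})
  have hWfin : Module.Finite ℂ W :=
    Module.Finite.span_of_finite ℂ ((Finsupp.finite_of_degree_le K).image _)
  -- modulo `q` the parameters are constants, so that an element of the ideal that they generate is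
  -- congruent to a combination of basis elements of smaller order
  have htop : ∀ a, e a ∈ W ⊔ q.restrictScalars ℂ := by
    intro a
    induction hm : ord A w a using Nat.strong_induction_on generalizing a with
    | _ m ih =>
      obtain ⟨u, hu, hmem⟩ := hmon a
      by_cases hdeg : u.degree ≤ K
      · exact Submodule.mem_sup_left (Submodule.subset_span ⟨u, hdeg, by rw [← hu]⟩)
      have hJ : e a ∈ J := hK (Ideal.pow_le_pow_right (by omega) hmem)
      obtain ⟨s, hs⟩ := Ideal.mem_span_range_iff_exists_fun.1 hJ
      have hcomp : e a = h.grading.comp m (e a) := by rw [grading_comp, if_pos hm]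
      rw [hcomp, ← hs, map_sum]
      refine Submodule.sum_mem _ fun i _ => ?_
      have hhom := h.isHomogeneousOp_parameter i
      rw [mul_comm]
      rcases lt_or_ge m (baryWeight w) with hlt | hge
      · have := hhom.comp_lt m (s i) hlt
        rw [LinearMap.mulLeft_apply] at this
        rw [this]
        exact zero_mem _
      obtain ⟨l, rfl⟩ := Nat.exists_eq_add_of_le' hge
      have := hhom.comp_add l (s i)
      rw [LinearMap.mulLeft_apply, LinearMap.mulLeft_apply] at this
      rw [this]
      have hz : h.grading.comp l (s i) ∈ W ⊔ q.restrictScalars ℂ := by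
        refine (Submodule.span_le.2 ?_ : Submodule.span ℂ (h.basis '' _) ≤ _)
          (Grading.comp_mem_span h.basis _ l (s i))
        rintro _ ⟨a', ha', rfl⟩
        rw [basis_apply]
        have := baryWeight_pos hw
        exact ih l (by omega) a' ha'
      have hsplit : parameter A w e (i + 1) * h.grading.comp l (s i) =
          c i • h.grading.comp l (s i) +
          (parameter A w e (i + 1) - algebraMap ℂ B (c i)) * h.grading.comp l (s i) := by
        rw [Algebra.smul_def]
        ring
      rw [hsplit]
      exact add_mem (Submodule.smul_mem _ _ hz)
        (Submodule.mem_sup_right (q.mul_mem_right _ (hq i i.2)))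
  have hfin : Module.Finite ℂ (B ⧸ q) := by
    refine Module.Finite.of_surjective ((Ideal.Quotient.mkₐ ℂ q).toLinearMap ∘ₗ W.subtype) ?_
    intro x
    obtain ⟨x, rfl⟩ := Ideal.Quotient.mkₐ_surjective ℂ q x
    have hx : x ∈ W ⊔ q.restrictScalars ℂ := by
      have : Submodule.span ℂ (Set.range e) ≤ W ⊔ q.restrictScalars ℂ := by
        refine Submodule.span_le.2 ?_
        rintro _ ⟨a, rfl⟩
        exact htop a
      rw [h.span_range] at this
      exact this trivial
    obtain ⟨z, hz, t, ht, rfl⟩ := Submodule.mem_sup.1 hx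
    refine ⟨⟨z, hz⟩, ?_⟩
    show Ideal.Quotient.mk q z = Ideal.Quotient.mk q (z + t)
    rw [map_add, Ideal.Quotient.eq_zero_iff_mem.2 ht, add_zero]
  have : IsArtinianRing (B ⧸ q) := isArtinian_of_tower ℂ inferInstance
  exact Ideal.Quotient.maximal_of_isField _ (IsArtinianRing.isField_of_isDomain _)

/-- If the operators `theta` are regular, then the algebra is Cohen–Macaulay. By the Nullstellensatz
every maximal ideal contains suitable translates of the parameters. -/
theorem isCohenMacaulayRing [IsNoetherianRing B] [Algebra.FiniteType ℂ B]
    (h : IsFaceAlgebra A w 0 e) (hw : ∀ j, 0 < w j)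
    (hreg : RegularMod (thetas A w d) (⊥ : Submodule ℂ (semigroup A →₀ ℂ))) :
    IsCohenMacaulayRing B := by
  refine ⟨inferInstance, fun m hm => ?_⟩
  have : IsNoetherianRing (Localization.AtPrime m) :=
    IsLocalization.isNoetherianRing m.primeCompl _ inferInstance
  let _ : Field (B ⧸ m) := Ideal.Quotient.field m
  have hfin : Module.Finite ℂ (B ⧸ m) := finite_of_finite_type_of_isJacobsonRing ℂ (B ⧸ m)
  have hsurj : Function.Surjective (algebraMap ℂ (B ⧸ m)) :=
    (IsAlgClosed.algebraMap_bijective_of_isIntegral (k := ℂ) (K := B ⧸ m)).2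
  choose c hc using fun i : ℕ => hsurj (Ideal.Quotient.mk m (parameter A w e (i + 1)))
  have hmem : ∀ i, parameter A w e (i + 1) - algebraMap ℂ B (c i) ∈ m := fun i => by
    rw [← Ideal.Quotient.eq_zero_iff_mem, map_sub, ← hc, sub_eq_zero]
    rfl
  have hreg' := (h.isWeaklyRegular_sub hw hreg c).of_isLocalization (Localization.AtPrime m)
    m.primeCompl
  refine IsCohenMacaulayLocalRing.of_isWeaklyRegular ?_ hreg' ?_
  · intro x hx
    simp only [List.map_map, List.mem_map] at hx
    obtain ⟨i, -, rfl⟩ := hx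
    rw [← Localization.AtPrime.map_eq_maximalIdeal]
    exact Ideal.mem_map_of_mem _ (hmem i)
  · intro Q hQ hQmem
    have hprime : (Q.comap (algebraMap B (Localization.AtPrime m))).IsPrime :=
      Ideal.comap_isPrime _ _
    have hmax := h.isMaximal_of_parameter_sub_mem hw c
      (q := Q.comap (algebraMap B (Localization.AtPrime m)))
      fun i hi => hQmem _ (List.mem_map_of_mem (List.mem_map.2 ⟨i, List.mem_range.2 hi, rfl⟩))
    have hle : Q.comap (algebraMap B (Localization.AtPrime m)) ≤ m := by
      intro x hx
      by_contra hxm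
      exact hQ.ne_top (Ideal.eq_top_of_isUnit_mem Q hx
        (IsLocalization.map_units (Localization.AtPrime m) (⟨x, hxm⟩ : m.primeCompl)))
    have heq := hmax.eq_of_le hm.ne_top hle
    refine le_antisymm (le_maximalIdeal hQ.ne_top) ?_
    rw [← Localization.AtPrime.map_eq_maximalIdeal, Ideal.map_le_iff_le_comap, heq]

end IsFaceAlgebra

/-! ### The weight vector and the columns -/

lemma exists_common_denominator {L : Fin n → ℚ} (hL : ∀ j, 0 < L j) :
    ∃ (N : ℕ) (w : Fin n → ℕ), 0 < N ∧ (∀ j, 0 < w j) ∧ ∀ j, L j = w j / N := by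
  have hN : 0 < ∏ j, (L j).den := Finset.prod_pos fun j _ => (L j).den_pos
  refine ⟨∏ j, (L j).den, fun j => (L j).num.toNat * ∏ i ∈ Finset.univ.erase j, (L i).den, hN,
    fun j => ?_, fun j => ?_⟩
  · exact mul_pos (by have := Rat.num_pos.2 (hL j); omega)
      (Finset.prod_pos fun i _ => (L i).den_pos)
  · have h1 : ((L j).num.toNat : ℚ) = (L j).num := by
      exact_mod_cast Int.toNat_of_nonneg (Rat.num_pos.2 (hL j)).le
    have h2 : (∏ i ∈ Finset.univ.erase j, ((L i).den : ℚ)) ≠ 0 :=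
      Finset.prod_ne_zero_iff.2 fun i _ => by exact_mod_cast (L i).den_ne_zero
    rw [← Finset.mul_prod_erase _ _ (Finset.mem_univ j)]
    push_cast
    rw [h1, mul_div_mul_right _ _ h2, Rat.num_div_den]

lemma span_column_eq_top (hspan : AddSubgroup.closure (Set.range A.col) = ⊤) :
    Submodule.span ℚ (Set.range (column A)) = ⊤ := by
  let φ : (Fin d → ℤ) →+ (Fin d → ℚ) := (Int.castAddHom ℚ).compLeft (Fin d)
  have h1 : ∀ a, φ a ∈ Submodule.span ℚ (Set.range (column A)) := by
    intro a
    have ha : a ∈ AddSubgroup.closure (Set.range A.col) := by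
      rw [hspan]
      trivial
    induction ha using AddSubgroup.closure_induction with
    | mem x hx =>
      obtain ⟨j, rfl⟩ := hx
      exact Submodule.subset_span ⟨j, rfl⟩
    | zero => rw [map_zero]; exact zero_mem _
    | add x y _ _ hx hy => rw [map_add]; exact add_mem hx hy
    | neg x _ hx => rw [map_neg]; exact neg_mem hx
  rw [eq_top_iff, ← (Pi.basisFun ℚ (Fin d)).span_eq, Submodule.span_le]
  rintro _ ⟨i, rfl⟩
  have h2 : φ (Pi.single i 1) = Pi.basisFun ℚ (Fin d) i := by
    ext k
    by_cases hk : k = i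
    · subst hk
      simp [φ]
    · simp [φ, hk]
  exact h2 ▸ h1 (Pi.single i 1)

end ToricGr

theorem mainTheorem11 (d n : ℕ) (A : Matrix (Fin d) (Fin n) ℤ) (L : Fin n → ℚ)
    (hA : ∀ j, A.col j ≠ 0)
    (hpos : ∀ x ∈ ToricGr.semigroup A, -x ∈ ToricGr.semigroup A → x = 0)
    (hspan : AddSubgroup.closure (Set.range A.col) = ⊤)
    (hL : ∀ j, 0 < L j)
    (hCM : ∀ τ ∈ ToricGr.umbrella A L, ¬ τ ⊆ ToricGr.umbrellaBoundary A L →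
      ToricGr.IsCohenMacaulayRing (ToricGr.faceSubalgebra A L τ)) :
    ToricGr.IsCohenMacaulayRing (ToricGr.GradedToricRing A L) := by
  obtain ⟨N, w, hN, hw, hLw⟩ := ToricGr.exists_common_denominator hL
  refine (ToricGr.isFaceAlgebra_monomialClass (A := A) hN hLw).isCohenMacaulayRing hw
    (ToricGr.regularMod_thetas_bot (ToricGr.span_column_eq_top hspan) fun g hg H => ?_)
  rcases (ToricGr.zeros A w g).eq_empty_or_nonempty with h0 | hne
  · rw [h0, ToricGr.faceDim_empty]
    trivial
  · exact (ToricGr.isFaceAlgebra_faceMonomialClass hN hLw hg.nonneg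
      (ToricGr.mem_hull_umbrellaFace_iff hLw hw hN hg)).regularMod_thetas hw hg
      (hCM _ (ToricGr.umbrellaFace_mem_umbrella hLw hw hN hg)
        (ToricGr.not_umbrellaFace_subset_boundary hLw hw hN hg hne H))
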